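/- **Setting.** Let $d,p\ge 1$ and $k\ge 0$ be integers, $\Omega\subset\mathbb R^d$ a bounded Lipschitz domain, and $\mathcal T_0,\dots,\mathcal T_L$ regular (face-to-face) subdivisions of $\overline\Omega$ into finitely many nondegenerate simplices, such that every cell of $\mathcal T_{\ell-1}$ is a union of cells of $\mathcal T_\ell$. Let $h_\ell$ be the largest cell diameter of $\mathcal T_\ell$. Assume there are constants $\sigma,\kappa,c_{\rm ref}>0$ such that, for all $\ell$: every $T\in\mathcal T_\ell$ contains a ball of radius $r>0$ with $\operatorname{diam}T\le\sigma r$ (shape regularity), $h_\ell\le \kappa\operatorname{diam}T$ for all $T\in\mathcal T_\ell$ (quasi-uniformity), and $h_\ell\ge c_{\rm ref}h_{\ell-1}$ for $\ell\ge1$. Let $\mathcal F_\ell$ be the set of faces ($(d-1)$-dimensional facets of cells) of $\mathcal T_\ell$, and let $M_\ell$ be the space of functions $\lambda$ on the faces with $\lambda|_F\in\mathcal P_p(F)$ for all $F\in\mathcal F_\ell$ and $\lambda|_F=0$ if $F\subset\partial\Omega$. Put $$\|\mu\|_\ell^2=\sum_{T\in\mathcal T_\ell}\frac{|T|}{|\partial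 T|}\int_{\partial T}\mu^2\,ds ,$$ also for functions that are double-valued on interior faces, with $ds$ the surface measure, and let $\|\cdot\|_0$ be the norm of $L^2(\Omega)$. Let $\overline V^c_\ell=\{w\in H^1_0(\Omega): w|_T\in\mathcal P_1(T)\ \forall T\in\mathcal T_\ell\}$ and let $\gamma_\ell w$ be the trace of $w$ on the faces of $\mathcal T_\ell$. **HDG method.** On every cell let $V_T\subset\mathcal P_k(T)$ and $W_T\subset\mathcal P_k(T)^d$ be linear spaces, and let $\tau_\ell\ge0$. Assume that for every $\lambda\in M_\ell$ and $T\in\mathcal T_\ell$ there is exactly one pair $(u,\vec q)\in V_T\times W_T$ such that, with outward unit normal $\vec\nu$, $$\int_T\vec q\cdot\vec p\,dx-\int_T u\,\nabla\!\cdot\vec p\,dx=-\int_{\partial T}\lambda\,\vec p\cdot\vec\nu\,ds\quad\forall\vec p\in W_T,$$ $$\int_{\partial T}(\vec q\cdot\vec\nu+\tau_\ell u)v\,ds-\int_T\vec q\cdot\nabla v\,dx=\tau_\ell\int_{\partial T}\lambda v\,ds\quad\forall v\in V_T,$$ and define $\mathcal U_\ell\lambda|_T=u$, $\mathcal Q_\ell\lambda|_T=\vec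 q$ (with $\nabla\,\mathcal U_\ell\lambda$ taken cellwise). Let $$a_\ell(\lambda,\mu)=\int_\Omega\mathcal Q_\ell\lambda\cdot\mathcal Q_\ell\mu\,dx+\sum_{T\in\mathcal T_\ell}\int_{\partial T}\tau_\ell(\mathcal U_\ell\lambda-\lambda)(\mathcal U_\ell\mu-\mu)\,ds,\qquad \|\mu\|_{a_\ell}^2=a_\ell(\mu,\mu).$$ **Assumptions.** Let $I_\ell:M_{\ell-1}\to M_\ell$ ($1\le\ell\le L$) be linear, and assume that with a constant $K$ the following hold on all levels, for all $\mu\in M_\ell$, $\lambda\in M_{\ell-1}$: - (LS1) $\|\mathcal U_\ell\mu-\mu\|_\ell\le K h_\ell\|\mathcal Q_\ell\mu\|_0$; - (LS2) $\|\mathcal Q_\ell\mu\|_0\le K h_\ell^{-1}\|\mu\|_\ell$ and $\|\mathcal U_\ell\mu\|_0\le K\|\mu\|_\ell$; - (LS3) $\|\mathcal Q_\ell\mu+\nabla\,\mathcal U_\ell\mu\|_0\le K h_\ell^{-1}\|\mathcal U_\ell\mu-\mu\|_\ell$; - (LS4) $\mathcal Q_\ell\gamma_\ell w=-\nabla w$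 and $\mathcal U_\ell\gamma_\ell w=w$ for all $w\in\overline V^c_\ell$; - (IA1) $\|I_\ell\lambda\|_\ell\le K\|\lambda\|_{\ell-1}$; - (IA2) $I_\ell\gamma_{\ell-1}w=\gamma_\ell w$ for all $w\in\overline V^c_{\ell-1}$; - $\tau_\ell h_\ell\le K$. **Lemma.** There is a constant $C>0$, depending only on $d,p,k,\sigma,\kappa,c_{\rm ref},K$ (in particular not on $\Omega$, the meshes, $h_\ell$, $\ell$ or $L$), such that for every $1\le\ell\le L$ and every $\lambda\in M_\ell$ there is exactly one $P_{\ell-1}\lambda\in M_{\ell-1}$ with $a_{\ell-1}(P_{\ell-1}\lambda,\mu)=a_\ell(\lambda,I_\ell\mu)$ for all $\mu\in M_{\ell-1}$, and $$\|\lambda-I_\ell P_{\ell-1}\lambda\|_{a_\ell}\le C\,\|\lambda\|_{a_\ell}.$$ -/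

import Mathlib

open MeasureTheory Set Filter Topology
open scoped ContDiff ENNReal

namespace HDG

noncomputable section

/-- Euclidean space `ℝ^d`. -/
abbrev Pt (d : ℕ) : Type := EuclideanSpace ℝ (Fin d)

/-- Polynomials in the `d` coordinates. -/
abbrev Poly (d : ℕ) : Type := MvPolynomial (Fin d) ℝ

/-- The function on `ℝ^d` given by a polynomial. -/
def polyFun {d : ℕ} (q : Poly d) (x : Pt d) : ℝ := MvPolynomial.eval (fun i => x i) q

/-- Bounded Lipschitz domain: open, connected, nonempty, bounded, and near every boundary point
equal to the strict epigraph of a Lipschitz function `g` of the coordinates orthogonal to some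
unit vector `e`. -/
def IsLipschitzDomain {d : ℕ} (Ω : Set (Pt d)) : Prop :=
  IsOpen Ω ∧ IsConnected Ω ∧ Bornology.IsBounded Ω ∧
    ∀ x ∈ frontier Ω, ∃ (r : ℝ) (e : Pt d) (g : Pt d → ℝ) (K : NNReal),
      0 < r ∧ ‖e‖ = 1 ∧ LipschitzWith K g ∧ (∀ (y : Pt d) (t : ℝ), g (y + t • e) = g y) ∧
        Ω ∩ Metric.ball x r = {y ∈ Metric.ball x r | g y < inner ℝ e y}

/-- Membership in `H^1_0(Ω)`, the closure of `C_c^∞(Ω)` in the norm of `H^1(Ω)`: the functions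
`φ n` and their gradients converge in `L²(Ω)`, the former to `w`. -/
def MemH10 {d : ℕ} (Ω : Set (Pt d)) (w : Pt d → ℝ) : Prop :=
  MemLp w 2 (volume.restrict Ω) ∧
    ∃ (G : Pt d → Pt d) (φ : ℕ → Pt d → ℝ),
      MemLp G 2 (volume.restrict Ω) ∧
      (∀ n, ContDiff ℝ ∞ (φ n) ∧ HasCompactSupport (φ n) ∧ tsupport (φ n) ⊆ Ω) ∧
      Tendsto (fun n => eLpNorm (fun x => φ n x - w x) 2 (volume.restrict Ω)) atTop (𝓝 0) ∧
      Tendsto (fun n => eLpNorm (fun x => gradient (φ n) x - G x) 2 (volume.restrict Ω))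
        atTop (𝓝 0)

/-- The closed simplex spanned by a finite set of vertices. -/
def hull {d : ℕ} (s : Finset (Pt d)) : Set (Pt d) := convexHull ℝ (s : Set (Pt d))

/-- The facet of the simplex `hull s` opposite to the vertex `v ∈ s`. -/
def facet {d : ℕ} (s : Finset (Pt d)) (v : Pt d) : Set (Pt d) :=
  convexHull ℝ ((s : Set (Pt d)) \ {v})

/-- The outward unit normal of the simplex `hull s` on the facet opposite to `v`: the vector
`∑ y ∈ s, (y - v)` points from `v` towards the facet; its component orthogonal to the facet
is normalized. -/
def outwardNormal {d : ℕ} (s : Finset (Pt d)) (v : Pt d) : Pt d :=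
  let n : Pt d := (vectorSpan ℝ ((s : Set (Pt d)) \ {v}))ᗮ.starProjection (∑ y ∈ s, (y - v))
  ‖n‖⁻¹ • n

/-- Integration over `hull s` with respect to Lebesgue measure. -/
def cellInt {d : ℕ} (s : Finset (Pt d)) (f : Pt d → ℝ) : ℝ := ∫ x in hull s, f x

/-- Integration over a facet with respect to surface measure. -/
def facetInt {d : ℕ} (F : Set (Pt d)) (f : Pt d → ℝ) : ℝ :=
  ∫ x in F, f x ∂(Measure.euclideanHausdorffMeasure (d - 1))

/-- A regular (face-to-face) subdivision of `Ω` into finitely many nondegenerate simplices;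
a cell is given by its set of `d + 1` vertices. -/
structure SimplicialMesh {d : ℕ} (Ω : Set (Pt d)) where
  cells : Finset (Finset (Pt d))
  card_eq : ∀ s ∈ cells, s.card = d + 1
  indep : ∀ s ∈ cells, AffineIndependent ℝ (fun x : s => (x : Pt d))
  inter_eq : ∀ s ∈ cells, ∀ t ∈ cells,
    hull s ∩ hull t = convexHull ℝ ((s : Set (Pt d)) ∩ (t : Set (Pt d)))
  cover : ⋃ s ∈ cells, hull s = closure Ω

namespace SimplicialMesh

variable {d : ℕ} {Ω : Set (Pt d)}

/-- The set of faces of the mesh. -/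
def faces (T : SimplicialMesh Ω) : Set (Set (Pt d)) :=
  {F | ∃ s ∈ T.cells, ∃ v ∈ s, F = facet s v}

/-- The mesh size: the largest diameter of a cell. -/
def meshSize (T : SimplicialMesh Ω) : ℝ :=
  ⨆ s : {s : Finset (Pt d) // s ∈ T.cells}, Metric.diam (hull s.1)

/-- Every cell contains a ball whose radius is at least `1 / σ` times the cell diameter. -/
def ShapeRegular (T : SimplicialMesh Ω) (σ : ℝ) : Prop :=
  ∀ s ∈ T.cells, ∃ (x : Pt d) (r : ℝ), 0 < r ∧ Metric.diam (hull s) ≤ σ * r ∧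
    Metric.closedBall x r ⊆ hull s

/-- All cell diameters are comparable to the mesh size. -/
def QuasiUniform (T : SimplicialMesh Ω) (q : ℝ) : Prop :=
  ∀ s ∈ T.cells, T.meshSize ≤ q * Metric.diam (hull s)

/-- Every cell of the coarse mesh `Tc` is a union of cells of the fine mesh `Tf`. -/
def Refines (Tf Tc : SimplicialMesh Ω) : Prop :=
  ∀ s ∈ Tc.cells, ∃ A ⊆ Tf.cells, hull s = ⋃ t ∈ A, hull t

/-- The skeletal space `M`: to every face `F` is assigned a polynomial function of degree at most
`p` on `F`, which is zero if `F` lies in the boundary of `Ω`. So that functions on different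
faces have a common type, the function on `F` is extended by zero to `ℝ^d`, and sets that are
not faces are assigned the zero function. -/
def skeletal (T : SimplicialMesh Ω) (p : ℕ) : Submodule ℝ (Set (Pt d) → Pt d → ℝ) where
  carrier := {μ |
    (∀ F ∈ T.faces, ∃ q : Poly d, q.totalDegree ≤ p ∧ μ F = F.indicator (polyFun q)) ∧
    (∀ F ∈ T.faces, F ⊆ frontier Ω → μ F = 0) ∧
    (∀ F, F ∉ T.faces → μ F = 0)}
  zero_mem' := by
    refine ⟨fun F _ => ⟨0, by simp, ?_⟩, fun _ _ _ => rfl, fun _ _ => rfl⟩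
    funext x
    simp [polyFun, Set.indicator]
  add_mem' := by
    rintro a b ⟨ha, ha', ha''⟩ ⟨hb, hb', hb''⟩
    refine ⟨fun F hF => ?_, fun F hF h => ?_, fun F hF => ?_⟩
    · obtain ⟨q, hq, hqa⟩ := ha F hF
      obtain ⟨r, hr, hrb⟩ := hb F hF
      refine ⟨q + r, (MvPolynomial.totalDegree_add q r).trans (max_le hq hr), ?_⟩
      funext x
      by_cases hx : x ∈ F <;> simp [hqa, hrb, polyFun, hx]
    · simp [ha' F hF h, hb' F hF h]
    · simp [ha'' F hF, hb'' F hF]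
  smul_mem' := by
    rintro c a ⟨ha, ha', ha''⟩
    refine ⟨fun F hF => ?_, fun F hF h => ?_, fun F hF => ?_⟩
    · obtain ⟨q, hq, hqa⟩ := ha F hF
      refine ⟨c • q, (MvPolynomial.totalDegree_smul_le c q).trans hq, ?_⟩
      funext x
      by_cases hx : x ∈ F <;> simp [hqa, polyFun, hx]
    · simp [ha' F hF h]
    · simp [ha'' F hF]

/-- The space of functions in `H^1_0(Ω)` that are polynomial of degree at most one on every
cell (represented by their values on the closed cells). -/
def conforming (T : SimplicialMesh Ω) : Set (Pt d → ℝ) :=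
  {w | MemH10 Ω w ∧
    ∀ s ∈ T.cells, ∃ q : Poly d, q.totalDegree ≤ 1 ∧ ∀ x ∈ hull s, w x = polyFun q x}

/-- The trace operator: restriction of a function to every face of the mesh. -/
def trace (T : SimplicialMesh Ω) (w : Pt d → ℝ) : Set (Pt d) → Pt d → ℝ :=
  T.faces.indicator fun F => F.indicator w

/-- `|T| / |∂T|` for a cell. -/
def cellRatio (s : Finset (Pt d)) : ℝ :=
  cellInt s (fun _ => 1) / ∑ v ∈ s, facetInt (facet s v) (fun _ => 1)

/-- The norm `‖f‖_ℓ`, where `‖f‖_ℓ² = ∑_T |T| / |∂T| ∫_{∂T} f²`, of a function `f` on the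
boundaries of the cells; `f s F` is its value on the facet `F` as seen from the cell `s`. -/
def bdryNorm (T : SimplicialMesh Ω) (f : Finset (Pt d) → Set (Pt d) → Pt d → ℝ) : ℝ :=
  √(∑ s ∈ T.cells, cellRatio s *
      ∑ v ∈ s, facetInt (facet s v) fun x => f s (facet s v) x ^ 2)

/-- The norm `‖μ‖_ℓ` of a skeletal function. -/
def skelNorm (T : SimplicialMesh Ω) (μ : Set (Pt d) → Pt d → ℝ) : ℝ :=
  T.bdryNorm fun _ F x => μ F x

/-- The `L²(Ω)` norm of a piecewise polynomial function; `u s` is the polynomial on `s`. -/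
def norm0 (T : SimplicialMesh Ω) (u : Finset (Pt d) → Poly d) : ℝ :=
  √(∑ s ∈ T.cells, cellInt s fun x => polyFun (u s) x ^ 2)

/-- The `L²(Ω; ℝ^d)` norm of a piecewise polynomial vector field. -/
def vecNorm0 (T : SimplicialMesh Ω) (q : Finset (Pt d) → Fin d → Poly d) : ℝ :=
  √(∑ s ∈ T.cells, cellInt s fun x => ∑ i, polyFun (q s i) x ^ 2)

end SimplicialMesh

/-- The data of an HDG method on a mesh: on every cell, a local space `V` of polynomials and a
local space `W` of polynomial vector fields, of degree at most `k`, and the penalty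
coefficient `τ` (zero is allowed, as for hybridized mixed methods). -/
structure Method {d : ℕ} {Ω : Set (Pt d)} (k : ℕ) (T : SimplicialMesh Ω) where
  V : Finset (Pt d) → Submodule ℝ (Poly d)
  W : Finset (Pt d) → Submodule ℝ (Fin d → Poly d)
  τ : ℝ
  V_degree : ∀ s ∈ T.cells, ∀ v ∈ V s, v.totalDegree ≤ k
  W_degree : ∀ s ∈ T.cells, ∀ w ∈ W s, ∀ i, (w i).totalDegree ≤ k
  τ_nonneg : 0 ≤ τ

namespace Method

variable {d : ℕ} {Ω : Set (Pt d)} {k : ℕ} {T : SimplicialMesh Ω}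

/-- `uq = (u, q)` solves the local problem on the cell `s` with skeletal data `μ`. -/
def IsLocalSolution (S : Method k T) (μ : Set (Pt d) → Pt d → ℝ) (s : Finset (Pt d))
    (uq : Poly d × (Fin d → Poly d)) : Prop :=
  uq.1 ∈ S.V s ∧ uq.2 ∈ S.W s ∧
  (∀ w ∈ S.W s,
    cellInt s (fun x => ∑ i, polyFun (uq.2 i) x * polyFun (w i) x)
      - cellInt s (fun x => polyFun uq.1 x * ∑ i, polyFun (MvPolynomial.pderiv i (w i)) x)
    = - ∑ v ∈ s, facetInt (facet s v) fun x =>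
        μ (facet s v) x * ∑ i, polyFun (w i) x * outwardNormal s v i) ∧
  (∀ z ∈ S.V s,
    (∑ v ∈ s, facetInt (facet s v) fun x =>
        ((∑ i, polyFun (uq.2 i) x * outwardNormal s v i) + S.τ * polyFun uq.1 x) * polyFun z x)
      - cellInt s (fun x => ∑ i, polyFun (uq.2 i) x * polyFun (MvPolynomial.pderiv i z) x)
    = S.τ * ∑ v ∈ s, facetInt (facet s v) fun x => μ (facet s v) x * polyFun z x)

/-- The local problems have exactly one solution for all skeletal data of degree `p`, that is,
the local solvers are well defined. -/
def WellPosed (S : Method k T) (p : ℕ) : Prop :=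
  ∀ μ ∈ T.skeletal p, ∀ s ∈ T.cells, ∃! uq, S.IsLocalSolution μ s uq

/-- The local solver `μ ↦ U μ` (the first part of the local solution on every cell). -/
def U (S : Method k T) (μ : Set (Pt d) → Pt d → ℝ) (s : Finset (Pt d)) : Poly d :=
  (Classical.epsilon (S.IsLocalSolution μ s)).1

/-- The local solver `μ ↦ Q μ` (the second part of the local solution on every cell). -/
def Q (S : Method k T) (μ : Set (Pt d) → Pt d → ℝ) (s : Finset (Pt d)) : Fin d → Poly d :=
  (Classical.epsilon (S.IsLocalSolution μ s)).2

/-- The condensed bilinear form `a`. -/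
def energyForm (S : Method k T) (μ ν : Set (Pt d) → Pt d → ℝ) : ℝ :=
  (∑ s ∈ T.cells, cellInt s fun x => ∑ i, polyFun (S.Q μ s i) x * polyFun (S.Q ν s i) x)
  + ∑ s ∈ T.cells, ∑ v ∈ s, facetInt (facet s v) fun x =>
      S.τ * (polyFun (S.U μ s) x - μ (facet s v) x) * (polyFun (S.U ν s) x - ν (facet s v) x)

/-- The energy norm, `‖μ‖_a² = a(μ, μ)`. -/
def energyNorm (S : Method k T) (μ : Set (Pt d) → Pt d → ℝ) : ℝ := √(S.energyForm μ μ)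

/-- `‖U μ - μ‖_ℓ`. -/
def traceError (S : Method k T) (μ : Set (Pt d) → Pt d → ℝ) : ℝ :=
  T.bdryNorm fun s F x => polyFun (S.U μ s) x - μ F x

/-- The trace of `U μ` approximates `μ`: `‖U μ - μ‖_ℓ ≤ K h ‖Q μ‖_0`. -/
def LS1 (S : Method k T) (p : ℕ) (K : ℝ) : Prop :=
  ∀ μ ∈ T.skeletal p, S.traceError μ ≤ K * (T.meshSize * T.vecNorm0 (S.Q μ))

/-- `Q μ` and `U μ` are bounded by `μ`: `‖Q μ‖_0 ≤ K h⁻¹ ‖μ‖_ℓ` and `‖U μ‖_0 ≤ K ‖μ‖_ℓ`. -/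
def LS2 (S : Method k T) (p : ℕ) (K : ℝ) : Prop :=
  ∀ μ ∈ T.skeletal p,
    T.vecNorm0 (S.Q μ) ≤ K * (T.meshSize⁻¹ * T.skelNorm μ) ∧
    T.norm0 (S.U μ) ≤ K * T.skelNorm μ

/-- `Q μ` approximates `-∇ U μ`: `‖Q μ + ∇ U μ‖_0 ≤ K h⁻¹ ‖U μ - μ‖_ℓ`. -/
def LS3 (S : Method k T) (p : ℕ) (K : ℝ) : Prop :=
  ∀ μ ∈ T.skeletal p,
    T.vecNorm0 (fun s i => S.Q μ s i + MvPolynomial.pderiv i (S.U μ s))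
      ≤ K * (T.meshSize⁻¹ * S.traceError μ)

/-- Consistency: for conforming piecewise linear `w` and its trace `μ`, `Q μ = -∇w` and `U μ = w`. -/
def LS4 (S : Method k T) (p : ℕ) : Prop :=
  ∀ w ∈ T.conforming, ∀ μ ∈ T.skeletal p, μ = T.trace w → ∀ s ∈ T.cells,
    (∀ x ∈ interior (hull s), ∀ i, polyFun (S.Q μ s i) x = -(gradient w x) i) ∧
    (∀ x ∈ hull s, polyFun (S.U μ s) x = w x)

end Method

section Injection

variable {d : ℕ} {Ω : Set (Pt d)} {k p : ℕ} {Tc Tf : SimplicialMesh Ω}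

/-- Stability of the injection: `‖I μ‖_ℓ ≤ K ‖μ‖_{ℓ-1}`. -/
def IA1 (I : Tc.skeletal p →ₗ[ℝ] Tf.skeletal p) (K : ℝ) : Prop :=
  ∀ μ : Tc.skeletal p, Tf.skelNorm (I μ).1 ≤ K * Tc.skelNorm μ.1

/-- Trace identity: the injection maps coarse traces of conforming piecewise linear functions to their
fine traces. -/
def IA2 (I : Tc.skeletal p →ₗ[ℝ] Tf.skeletal p) : Prop :=
  ∀ w ∈ Tc.conforming, ∀ μ : Tc.skeletal p, μ.1 = Tc.trace w → (I μ).1 = Tf.trace w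

/-- `ν` satisfies the defining condition of the Ritz quasi-projection of `μ`:
`a_{coarse}(ν, η) = a_{fine}(μ, I η)` for all coarse skeletal functions `η`. -/
def IsRitz (Sc : Method k Tc) (Sf : Method k Tf) (I : Tc.skeletal p →ₗ[ℝ] Tf.skeletal p)
    (μ : Tf.skeletal p) (ν : Tc.skeletal p) : Prop :=
  ∀ η : Tc.skeletal p, Sc.energyForm ν.1 η.1 = Sf.energyForm μ.1 (I η).1

/-- The Ritz quasi-projection from the fine to the coarse skeletal space. -/
def ritz (Sc : Method k Tc) (Sf : Method k Tf) (I : Tc.skeletal p →ₗ[ℝ] Tf.skeletal p)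
    (μ : Tf.skeletal p) : Tc.skeletal p :=
  Classical.epsilon (IsRitz Sc Sf I μ)

end Injection

end

end HDG

/-! Everything reduces to the stability of the injection in energy norms, ‖I μ‖_{a_ℓ} ≤ C
‖μ‖_{a_{ℓ-1}}, together with definiteness of the coarse form (`exists_energy_bound`). Definiteness
in finite dimension gives existence and uniqueness of Pλ. Testing with Pλ itself, ‖Pλ‖² = a_ℓ(λ, I
Pλ) ≤ C ‖λ‖ ‖Pλ‖, so P is bounded by C, and the triangle inequality gives the constant 1 + C²
(`exists_unique_ritz_and_le`).

For the stability, a coarse μ is split as γw + (μ - γw) with w conforming and piecewise affine, such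
that ‖∇w‖₀ ≲ ‖Qμ‖₀ and ‖μ - γw‖ ≲ h ‖Qμ‖₀. By (IA2) and (LS4) the fine energy of I γw is the
Dirichlet energy of w, which no longer depends on the mesh. The remainder is treated by brute force:
(LS1) and τh ≤ K bound its fine energy by ‖Q I(μ - γw)‖₀², (LS2) and (IA1) bound this by h⁻² ‖μ -
γw‖², and the factor h from the approximation cancels h⁻¹. Definiteness comes from the same
approximation: if the energy vanishes then so does Qμ, w is constant on cells, hence zero, and μ =
γw = 0.

The function w is a quasi-interpolant of Uμ (`exists_conforming_approximation`). At an interior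
vertex it takes the value of Uμ from any one cell of the vertex star, at a boundary vertex the value
zero. Inverse inequalities turn (LS1) and (LS3) into pointwise bounds for the oscillation of Uμ on
cells and for Uμ - μ on facets. As μ is single-valued, cells sharing a facet have nearly equal
values there, and these differences are summed along chains of cells in a star.

Such chains exist because sets of codimension two do not separate a ball (`false_of_codim_two`,
`star_connected`): the star of an interior vertex is connected through facets, and each
facet-connected part of the star of a boundary vertex reaches a boundary facet, where μ = 0. The
Lipschitz property of Ω enters only through the fact that Ω does not lie on both sides of its
boundary. That w belongs to H¹₀ is shown by explicit approximation, thresholding followed by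
mollification (`memH10_of_lipschitzWith`). -/

namespace HDG

/-! ### Simplices and barycentric coordinates -/

/-- A nondegenerate simplex, given by its `d + 1` vertices. -/
structure IsSimplex {d : ℕ} (s : Finset (Pt d)) : Prop where
  card_eq : s.card = d + 1
  indep : AffineIndependent ℝ (fun x : s => (x : Pt d))

namespace IsSimplex

variable {d : ℕ} {s t : Finset (Pt d)}

/-- The affine basis formed by the vertices. -/
noncomputable def basis (h : IsSimplex s) : AffineBasis s ℝ (Pt d) where
  toFun := fun x => (x : Pt d)
  ind' := h.indep
  tot' := by
    rw [h.indep.affineSpan_eq_top_iff_card_eq_finrank_add_one]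
    simp [h.card_eq]

end IsSimplex

open Classical in
/-- The barycentric coordinate of the simplex `hull s` belonging to the vertex `v`. -/
noncomputable def bary {d : ℕ} (s : Finset (Pt d)) (v : Pt d) : Pt d →ᵃ[ℝ] ℝ :=
  if h : IsSimplex s ∧ v ∈ s then h.1.basis.coord ⟨v, h.2⟩ else 0

lemma continuous_bary {d : ℕ} (s : Finset (Pt d)) (v : Pt d) : Continuous (bary s v) :=
  (bary s v).continuous_of_finiteDimensional

namespace IsSimplex

variable {d : ℕ} {s t : Finset (Pt d)}

lemma bary_eq (h : IsSimplex s) {v : Pt d} (hv : v ∈ s) : bary s v = h.basis.coord ⟨v, hv⟩ := by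
  rw [bary, dif_pos ⟨h, hv⟩]

lemma sum_bary (h : IsSimplex s) (x : Pt d) : ∑ v ∈ s, bary s v x = 1 := by
  rw [← h.basis.sum_coord_apply_eq_one x, ← Finset.sum_coe_sort s]
  exact Finset.sum_congr rfl fun v _ => by rw [h.bary_eq v.2]

lemma sum_bary_smul (h : IsSimplex s) (x : Pt d) : ∑ v ∈ s, bary s v x • v = x := by
  conv_rhs => rw [← h.basis.linear_combination_coord_eq_self x]
  rw [← Finset.sum_coe_sort s]
  exact Finset.sum_congr rfl fun v _ => by rw [h.bary_eq v.2]; rfl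

lemma bary_self (h : IsSimplex s) {v : Pt d} (hv : v ∈ s) : bary s v v = 1 := by
  rw [h.bary_eq hv]; exact h.basis.coord_apply_eq ⟨v, hv⟩

lemma bary_ne (h : IsSimplex s) {v w : Pt d} (hv : v ∈ s) (hw : w ∈ s) (hvw : v ≠ w) :
    bary s v w = 0 := by
  rw [h.bary_eq hv]
  exact h.basis.coord_apply_ne (i := ⟨v, hv⟩) (j := ⟨w, hw⟩) (by simpa using hvw)

lemma range_basis (h : IsSimplex s) : range h.basis = (s : Set (Pt d)) := by
  change range (fun x : s => (x : Pt d)) = _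
  simp

lemma mem_hull (h : IsSimplex s) {x : Pt d} : x ∈ hull s ↔ ∀ v ∈ s, 0 ≤ bary s v x := by
  rw [hull, ← h.range_basis, h.basis.convexHull_eq_nonneg_coord]
  constructor
  · intro hx v hv; rw [h.bary_eq hv]; exact hx _
  · intro hx v; rw [← h.bary_eq v.2]; exact hx _ v.2

lemma mem_interior_hull (h : IsSimplex s) {x : Pt d} :
    x ∈ interior (hull s) ↔ ∀ v ∈ s, 0 < bary s v x := by
  rw [hull, ← h.range_basis, h.basis.interior_convexHull]
  constructor
  · intro hx v hv; rw [h.bary_eq hv]; exact hx _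
  · intro hx v; rw [← h.bary_eq v.2]; exact hx _ v.2

/-- The zero set of a coordinate is convex and contains all vertices but one, which gives one
direction. For the other, the terms off `f` drop out of the barycentric representation of `x`. -/
lemma mem_convexHull (h : IsSimplex s) {f : Set (Pt d)} (hf : f ⊆ s) {x : Pt d} :
    x ∈ convexHull ℝ f ↔ (∀ v ∈ s, 0 ≤ bary s v x) ∧ ∀ v ∈ s, v ∉ f → bary s v x = 0 := by
  classical
  constructor
  · intro hx
    refine ⟨h.mem_hull.1 (convexHull_mono hf hx), fun v hv hvf => ?_⟩
    have hc : Convex ℝ {y | bary s v y = 0} := by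
      have : {y | bary s v y = 0} = (bary s v) ⁻¹' {0} := rfl
      rw [this]
      exact (convex_singleton _).affine_preimage _
    exact convexHull_min (s := f) (fun w hw => h.bary_ne hv (hf hw) (by rintro rfl; exact hvf hw))
      hc hx
  · rintro ⟨h0, hz⟩
    have hs : ∀ g : Pt d → ℝ → Pt d, (∀ v, g v 0 = 0) → ∑ v ∈ s with v ∈ f, g v (bary s v x)
        = ∑ v ∈ s, g v (bary s v x) := by
      intro g hg
      rw [Finset.sum_filter]
      refine Finset.sum_congr rfl fun v hv => ?_
      split_ifs with hvf
      · rfl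
      · rw [hz v hv hvf, hg]
    rw [← h.sum_bary_smul x, ← hs (fun v c => c • v) (by simp)]
    refine (convex_convexHull ℝ f).sum_mem (fun v hv => h0 v (Finset.mem_filter.1 hv).1) ?_
      (fun v hv => subset_convexHull ℝ f (Finset.mem_filter.1 hv).2)
    rw [← h.sum_bary x, Finset.sum_filter]
    refine Finset.sum_congr rfl fun v hv => ?_
    split_ifs with hvf
    · rfl
    · rw [hz v hv hvf]

lemma mem_facet (h : IsSimplex s) {v x : Pt d} (hv : v ∈ s) :
    x ∈ facet s v ↔ x ∈ hull s ∧ bary s v x = 0 := by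
  rw [facet, h.mem_convexHull sdiff_subset, h.mem_hull]
  refine and_congr_right fun _ => ⟨fun hx => hx v hv (by simp), fun hx w hw hwf => ?_⟩
  have : w = v := by by_contra hne; exact hwf ⟨hw, hne⟩
  rwa [this]

lemma nonempty (h : IsSimplex s) : s.Nonempty := by
  rw [← Finset.card_pos, h.card_eq]; omega

/-- The barycentre. -/
lemma exists_bary_pos (h : IsSimplex s) : ∃ c, ∀ v ∈ s, 0 < bary s v c := by
  obtain ⟨c, hc⟩ : (interior (convexHull ℝ (range h.basis))).Nonempty :=
    interior_convexHull_nonempty_iff_affineSpan_eq_top.2 h.basis.tot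
  refine ⟨c, h.mem_interior_hull.1 ?_⟩
  rwa [hull, ← h.range_basis]

lemma convex_hull : Convex ℝ (hull s) := convex_convexHull _ _

lemma interior_nonempty (h : IsSimplex s) : (interior (hull s)).Nonempty := by
  obtain ⟨c, hc⟩ := h.exists_bary_pos
  exact ⟨c, h.mem_interior_hull.2 hc⟩

lemma isCompact_hull : IsCompact (hull s) := s.finite_toSet.isCompact_convexHull ℝ

lemma isClosed_hull : IsClosed (hull s) := isCompact_hull.isClosed

lemma isCompact_facet {v : Pt d} : IsCompact (facet s v) :=
  (s.finite_toSet.subset sdiff_subset).isCompact_convexHull ℝ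

lemma subset_closure_interior (h : IsSimplex s) : hull s ⊆ closure (interior (hull s)) := by
  rw [(convex_hull (s := s)).closure_interior_eq_closure_of_nonempty_interior h.interior_nonempty]
  exact subset_closure

lemma facet_subset {v : Pt d} : facet s v ⊆ hull s := convexHull_mono sdiff_subset

lemma eq_of_subset (hs : IsSimplex s) (ht : IsSimplex t) (h : s ⊆ t) : s = t :=
  Finset.eq_of_subset_of_card_le h (by rw [hs.card_eq, ht.card_eq])

end IsSimplex

/-! ### Intersections of cells in a face-to-face mesh -/

namespace SimplicialMesh

variable {d : ℕ} {Ω : Set (Pt d)} (T : SimplicialMesh Ω) {s t : Finset (Pt d)}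

lemma isSimplex (hs : s ∈ T.cells) : IsSimplex s := ⟨T.card_eq s hs, T.indep s hs⟩

lemma hull_subset (hs : s ∈ T.cells) : hull s ⊆ closure Ω := by
  rw [← T.cover]; exact subset_biUnion_of_mem (u := fun s => hull s) hs

/-- A point of two cells whose coordinate for `v` in the first one does not vanish: `v` is a
vertex of the second cell as well. -/
lemma mem_of_bary_ne_zero (hs : s ∈ T.cells) (ht : t ∈ T.cells) {x v : Pt d} (hxs : x ∈ hull s)
    (hxt : x ∈ hull t) (hv : v ∈ s) (h : bary s v x ≠ 0) : v ∈ t := by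
  have hx : x ∈ convexHull ℝ ((s : Set (Pt d)) ∩ t) := by
    rw [← T.inter_eq s hs t ht]; exact ⟨hxs, hxt⟩
  by_contra hvt
  exact h ((((T.isSimplex hs).mem_convexHull inter_subset_left).1 hx).2 v hv fun h => hvt h.2)

/-- All coordinates of an interior point are nonzero, so every vertex of `s` is a vertex of `t`, and
both have `d + 1` vertices. -/
lemma eq_of_mem_interior (hs : s ∈ T.cells) (ht : t ∈ T.cells) {x : Pt d}
    (hxs : x ∈ interior (hull s)) (hxt : x ∈ hull t) : s = t :=
  (T.isSimplex hs).eq_of_subset (T.isSimplex ht) fun _ hv =>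
    T.mem_of_bary_ne_zero hs ht (interior_subset hxs) hxt hv
      ((T.isSimplex hs).mem_interior_hull.1 hxs _ hv).ne'

/-- On the intersection of two cells, the barycentric coordinates agree. -/
lemma bary_eq_bary (hs : s ∈ T.cells) (ht : t ∈ T.cells) {x v : Pt d} (hxs : x ∈ hull s)
    (hxt : x ∈ hull t) (hv : v ∈ s) (hvt : v ∈ t) : bary s v x = bary t v x := by
  have hx : x ∈ convexHull ℝ ((s : Set (Pt d)) ∩ t) := by
    rw [← T.inter_eq s hs t ht]; exact ⟨hxs, hxt⟩
  have hc : Convex ℝ {y | (bary s v - bary t v) y = 0} := by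
    have : {y | (bary s v - bary t v) y = 0} = (bary s v - bary t v) ⁻¹' {0} := rfl
    rw [this]
    exact (convex_singleton _).affine_preimage _
  have h0 : (bary s v - bary t v) x = 0 := by
    -- The two affine functions agree at the shared vertices, whose hull is the intersection of the
    -- cells.
    refine convexHull_min (s := (s : Set (Pt d)) ∩ t) ?_ hc hx
    rintro w ⟨hws, hwt⟩
    have hs' := T.isSimplex hs
    have ht' := T.isSimplex ht
    by_cases hvw : v = w
    · subst hvw; simp [hs'.bary_self hv, ht'.bary_self hvt]
    · simp [hs'.bary_ne hv hws hvw, ht'.bary_ne hvt hwt hvw]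
  simpa [sub_eq_zero] using h0

/-- If a point of the closure lies off all cells that are not in `A`, its neighbourhood in the
closure is covered by the cells in `A`. -/
lemma eventually_mem_hull (x : Pt d) :
    ∀ᶠ y in 𝓝 x, ∀ t ∈ T.cells, y ∈ hull t → x ∈ hull t := by
  rw [Filter.eventually_all_finset]
  intro t _
  by_cases hx : x ∈ hull t
  · exact Eventually.of_forall fun _ _ => hx
  · filter_upwards [(IsSimplex.isClosed_hull (s := t)).isOpen_compl.mem_nhds hx] with y hy hyt
    exact absurd hyt hy

lemma exists_mem_hull {x : Pt d} (hx : x ∈ closure Ω) : ∃ s ∈ T.cells, x ∈ hull s := by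
  rw [← T.cover] at hx
  simpa using hx

end SimplicialMesh

end HDG

/-! ### Boundary of the domain and connectivity of vertex stars -/

namespace HDG

variable {d : ℕ} {Ω : Set (Pt d)}

/-- Moving from `x` in direction `-e` keeps `g` fixed and lowers the height, so one enters the open
strict subgraph, which is disjoint from `Ω` near `x`. -/
lemma IsLipschitzDomain.mem_closure_compl (hΩ : IsLipschitzDomain Ω) {x : Pt d}
    (hx : x ∈ frontier Ω) : x ∈ closure (closure Ω)ᶜ := by
  obtain ⟨hopen, -, -, hbd⟩ := hΩ
  obtain ⟨r, e, g, K, hr, he, hg, hge, hΩr⟩ := hbd x hx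
  have hxΩ : x ∉ Ω := by
    rw [hopen.frontier_eq] at hx; exact hx.2
  have hgx : inner ℝ e x ≤ g x := by
    by_contra hlt
    have : x ∈ Ω ∩ Metric.ball x r := by
      rw [hΩr]; exact ⟨Metric.mem_ball_self hr, not_le.1 hlt⟩
    exact hxΩ this.1
  have hlim : Tendsto (fun t : ℝ => x + (-t) • e) (𝓝[>] 0) (𝓝 x) := by
    have : Continuous (fun t : ℝ => x + (-t) • e) := by fun_prop
    simpa using (this.tendsto 0).mono_left nhdsWithin_le_nhds
  refine mem_closure_of_tendsto hlim ?_
  filter_upwards [hlim (Metric.ball_mem_nhds x hr), self_mem_nhdsWithin] with t ht ht0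
  have ht0 : 0 < t := ht0
  set y := x + (-t) • e with hy
  have hop : IsOpen (Metric.ball x r ∩ {z | inner ℝ e z < g z}) :=
    Metric.isOpen_ball.inter (isOpen_lt (by fun_prop) hg.continuous)
  have hyU : y ∈ Metric.ball x r ∩ {z | inner ℝ e z < g z} := by
    refine ⟨ht, ?_⟩
    have h1 : g y = g x := hge x (-t)
    have h2 : inner ℝ e y = inner ℝ e x - t := by
      rw [hy, inner_add_right, inner_smul_right, real_inner_self_eq_norm_sq, he]; ring
    simp only [mem_ofPred_eq]
    rw [h1, h2]; linarith
  intro hyc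
  obtain ⟨z, hz, hzΩ⟩ := mem_closure_iff.1 hyc _ hop hyU
  have : z ∈ {y ∈ Metric.ball x r | g y < inner ℝ e y} := by
    rw [← hΩr]; exact ⟨hzΩ, hz.1⟩
  exact lt_asymm this.2 hz.2

lemma IsLipschitzDomain.interior_closure (hΩ : IsLipschitzDomain Ω) :
    interior (closure Ω) = Ω := by
  refine Subset.antisymm (fun x hx => ?_) hΩ.1.subset_interior_closure
  by_contra hxΩ
  have hf : x ∈ frontier Ω := by
    rw [hΩ.1.frontier_eq]; exact ⟨interior_subset hx, hxΩ⟩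
  have := hΩ.mem_closure_compl hf
  rw [closure_compl] at this
  exact this hx

/-- At most `d` points lie in a proper affine subspace. Applied to cones with apex `b` over faces of
codimension two. -/
lemma volume_affineSpan_insert {S : Finset (Pt d)} (hS : S.card < d) (b : Pt d) :
    volume (affineSpan ℝ (insert b (S : Set (Pt d))) : Set (Pt d)) = 0 := by
  classical
  refine Measure.addHaar_affineSubspace _ _ fun htop => ?_
  obtain ⟨n, hn⟩ : ∃ n, (insert b S).card = n + 1 :=
    Nat.exists_eq_succ_of_ne_zero (Finset.card_ne_zero_of_mem (Finset.mem_insert_self b S))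
  have h1 := finrank_vectorSpan_image_finset_le ℝ (id : Pt d → Pt d) (insert b S) hn
  have h2 : vectorSpan ℝ (insert b (S : Set (Pt d))) = ⊤ := by
    rw [← direction_affineSpan, htop, AffineSubspace.direction_top]
  have h3 := Finset.card_insert_le b S
  rw [Finset.coe_image, image_id, Finset.coe_insert] at h1
  rw [h2] at h1
  simp at h1
  omega

/-- Two closed sets that cover a convex open set and meet there in a set of codimension two only:
one of them has no interior. -/
lemma false_of_codim_two {P O U : Set (Pt d)} (hP : IsClosed P) (hO : IsClosed O)
    (hU : Convex ℝ U) (hUo : IsOpen U) (hPO : U ⊆ P ∪ O) (S : Finset (Finset (Pt d)))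
    (hS : ∀ f ∈ S, f.card < d)
    (hPOS : ∀ y ∈ P, y ∈ O → y ∈ U → ∃ f ∈ S, y ∈ convexHull ℝ (f : Set (Pt d)))
    (hp : (interior P ∩ U).Nonempty) (ho : (interior O ∩ U).Nonempty) : False := by
  -- General position: finitely many null sets do not cover a nonempty open set.
  have key : ∀ (V : Set (Pt d)) (b : Pt d), IsOpen V → V.Nonempty →
      ∃ a ∈ V, ∀ f ∈ S, a ∉ affineSpan ℝ (insert b (f : Set (Pt d))) := by
    intro V b hV hVn
    by_contra! hcon
    have hsub : V ⊆ ⋃ f ∈ S, (affineSpan ℝ (insert b (f : Set (Pt d))) : Set (Pt d)) := by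
      intro a ha
      obtain ⟨f, hf, haf⟩ := hcon a ha
      exact mem_biUnion hf haf
    have h0 : volume V = 0 := measure_mono_null hsub
      ((measure_biUnion_null_iff S.countable_toSet).2 fun f hf =>
        volume_affineSpan_insert (hS f hf) b)
    exact (hV.measure_pos volume hVn).ne' h0
  -- The apex `0` is arbitrary; it only serves to get `b` off the span of every face. Then `a` is
  -- chosen off the cones with apex `b`, so that the segment from `a` to `b` misses all faces. But
  -- it is connected and must cross `P ∩ O`.
  obtain ⟨b, ⟨hbO, hbU⟩, hb⟩ := key _ 0 (isOpen_interior.inter hUo) ho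
  obtain ⟨a, ⟨haP, haU⟩, ha⟩ := key _ b (isOpen_interior.inter hUo) hp
  have hseg : segment ℝ a b ⊆ U := hU.segment_subset haU hbU
  have hconn : IsPreconnected (segment ℝ a b) := (convex_segment a b).isPreconnected
  obtain ⟨c, hc, hcP, hcO⟩ := isPreconnected_closed_iff.1 hconn P O hP hO (hseg.trans hPO)
    ⟨a, left_mem_segment ℝ a b, interior_subset haP⟩
    ⟨b, right_mem_segment ℝ a b, interior_subset hbO⟩
  obtain ⟨f, hf, hcf⟩ := hPOS c hcP hcO (hseg hc)
  have hcf' : c ∈ affineSpan ℝ (f : Set (Pt d)) := convexHull_subset_affineSpan _ hcf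
  have hcb : c ≠ b := by
    rintro rfl
    exact hb f hf (affineSpan_mono ℝ (subset_insert _ _) hcf')
  refine ha f hf ?_
  rw [segment_eq_image_lineMap] at hc
  obtain ⟨θ, -, rfl⟩ := hc
  have hθ : 1 - θ ≠ 0 := by
    intro h
    have : θ = 1 := by linarith
    subst this; simp at hcb
  have hb' : b ∈ affineSpan ℝ (insert b (f : Set (Pt d))) :=
    subset_affineSpan ℝ _ (mem_insert _ _)
  have hc' := affineSpan_mono ℝ (subset_insert b (f : Set (Pt d))) hcf'
  -- The point `a` lies on the line through `b` and the crossing point `c`, hence in the cone that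
  -- it was chosen to avoid.
  have hline := AffineMap.lineMap_mem (1 - θ)⁻¹ hb' hc'
  convert hline using 1
  simp only [AffineMap.lineMap_apply_module]
  match_scalars <;> field_simp; ring

namespace SimplicialMesh

variable (T : SimplicialMesh Ω) {s t : Finset (Pt d)}

/-- The relative interior of a facet shared by two cells lies in the interior of their union. -/
lemma eventually_mem_union (hs : s ∈ T.cells) (ht : t ∈ T.cells) (hst : t ≠ s) {v c : Pt d}
    (hv : v ∈ s) (hsub : ∀ w ∈ s, w ≠ v → w ∈ t) (hc0 : bary s v c = 0)
    (hc : ∀ w ∈ s, w ≠ v → 0 < bary s w c) : ∀ᶠ y in 𝓝 c, y ∈ hull s ∪ hull t := by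
  classical
  have hs' := T.isSimplex hs
  have ht' := T.isSimplex ht
  have hcs : c ∈ facet s v := by
    rw [hs'.mem_facet hv, hs'.mem_hull]
    refine ⟨fun w hw => ?_, hc0⟩
    by_cases hwv : w = v
    · rw [hwv, hc0]
    · exact (hc w hw hwv).le
  have hct : c ∈ hull t := by
    refine convexHull_mono ?_ hcs
    rintro w ⟨hw, hwv⟩
    exact hsub w hw hwv
  have hvt : v ∉ t := fun hvt => hst (hs'.eq_of_subset ht' fun w hw => by
    by_cases hwv : w = v
    · rwa [hwv]
    · exact hsub w hw hwv).symm
  obtain ⟨v', hv't, hv's⟩ : ∃ v' ∈ t, v' ∉ s := by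
    by_contra! hcon
    exact hst (ht'.eq_of_subset hs' hcon)
  -- The cell `t` arises from `s` by exchanging `v` for `v'`.
  have htw : ∀ w ∈ t, w ≠ v' → w ∈ s ∧ w ≠ v := by
    have hsubset : s.erase v ⊆ t.erase v' := by
      intro w hw
      rw [Finset.mem_erase] at hw ⊢
      exact ⟨fun h => hv's (h ▸ hw.2), hsub w hw.2 hw.1⟩
    have heq := Finset.eq_of_subset_of_card_le hsubset
      (by rw [Finset.card_erase_of_mem hv't, Finset.card_erase_of_mem hv, hs'.card_eq, ht'.card_eq])
    intro w hw hwv'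
    have : w ∈ s.erase v := by rw [heq]; exact Finset.mem_erase.2 ⟨hwv', hw⟩
    exact ⟨(Finset.mem_erase.1 this).2, (Finset.mem_erase.1 this).1⟩
  have hct0 : bary t v' c = 0 := by
    by_contra h
    exact hv's (T.mem_of_bary_ne_zero ht hs hct (IsSimplex.facet_subset hcs) hv't h)
  have hctw : ∀ w ∈ t, w ≠ v' → 0 < bary t w c := by
    intro w hw hwv
    obtain ⟨hws, hwv⟩ := htw w hw hwv
    rw [← T.bary_eq_bary hs ht (IsSimplex.facet_subset hcs) hct hws hw]
    exact hc w hws hwv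
  have ev : ∀ {r : Finset (Pt d)} {u : Pt d}, (∀ w ∈ r, w ≠ u → 0 < bary r w c) →
      ∀ᶠ y in 𝓝 c, ∀ w ∈ r, w ≠ u → 0 < bary r w y := by
    intro r u h
    rw [Filter.eventually_all_finset]
    intro w hw
    by_cases hwu : w = u
    · exact Eventually.of_forall fun _ h => absurd hwu h
    · filter_upwards [((continuous_bary r w).tendsto c).eventually_const_lt (h w hw hwu)] with y hy _
      exact hy
  -- Reflection in `c`. A point near `c` outside both cells has negative coordinates for `v` in `s`
  -- and for `v'` in `t`. Its reflection then has positive ones and would lie in the interiors of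
  -- two different cells.
  have hrefl : Tendsto (fun y : Pt d => AffineMap.lineMap y c (2 : ℝ)) (𝓝 c) (𝓝 c) := by
    have : Continuous (fun y : Pt d => AffineMap.lineMap y c (2 : ℝ)) := by
      simp only [AffineMap.lineMap_apply_module]; fun_prop
    simpa using this.tendsto c
  filter_upwards [ev hc, ev hctw, hrefl.eventually (ev hc), hrefl.eventually (ev hctw)]
    with y h1 h2 h3 h4
  by_contra hy
  rw [mem_union, not_or] at hy
  have hneg : bary s v y < 0 := by
    by_contra hge
    exact hy.1 (hs'.mem_hull.2 fun w hw => by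
      by_cases hwv : w = v
      · rw [hwv]; exact not_lt.1 hge
      · exact (h1 w hw hwv).le)
  have hneg' : bary t v' y < 0 := by
    by_contra hge
    exact hy.2 (ht'.mem_hull.2 fun w hw => by
      by_cases hwv : w = v'
      · rw [hwv]; exact not_lt.1 hge
      · exact (h2 w hw hwv).le)
  have e1 : 0 < bary s v (AffineMap.lineMap y c (2 : ℝ)) := by
    rw [AffineMap.apply_lineMap, AffineMap.lineMap_apply_ring', hc0]; linarith
  have e2 : 0 < bary t v' (AffineMap.lineMap y c (2 : ℝ)) := by
    rw [AffineMap.apply_lineMap, AffineMap.lineMap_apply_ring', hct0]; linarith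
  refine hst (T.eq_of_mem_interior hs ht (x := AffineMap.lineMap y c (2 : ℝ))
    (hs'.mem_interior_hull.2 fun w hw => ?_) (ht'.mem_hull.2 fun w hw => ?_)).symm
  · by_cases hwv : w = v
    · rwa [hwv]
    · exact h3 w hw hwv
  · by_cases hwv : w = v'
    · rw [hwv]; exact e2.le
    · exact (h4 w hw hwv).le

/-- A facet is shared with another cell or lies in the boundary of the domain. -/
lemma exists_neighbour_or_subset_frontier (hd : 1 ≤ d) (hΩ : IsOpen Ω) (hs : s ∈ T.cells)
    {v : Pt d} (hv : v ∈ s) :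
    (∃ t ∈ T.cells, t ≠ s ∧ ∀ w ∈ s, w ≠ v → w ∈ t) ∨ facet s v ⊆ frontier Ω := by
  classical
  refine or_iff_not_imp_left.2 fun hno => ?_
  have hs' := T.isSimplex hs
  have hrel : ∀ c, bary s v c = 0 → (∀ w ∈ s, w ≠ v → 0 < bary s w c) → c ∈ frontier Ω := by
    intro c hc0 hc
    have hcs : c ∈ hull s := hs'.mem_hull.2 fun w hw => by
      by_cases hwv : w = v
      · rw [hwv, hc0]
      · exact (hc w hw hwv).le
    rw [hΩ.frontier_eq]
    refine ⟨T.hull_subset hs hcs, fun hcΩ => ?_⟩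
    have hev : ∀ᶠ y in 𝓝 c, y ∈ hull s := by
      filter_upwards [hΩ.mem_nhds hcΩ, T.eventually_mem_hull c] with y hyΩ hy
      obtain ⟨t, ht, hyt⟩ := T.exists_mem_hull (subset_closure hyΩ)
      have hct := hy t ht hyt
      have hts : t = s := by
        by_contra hts
        exact hno ⟨t, ht, hts, fun w hw hwv =>
          T.mem_of_bary_ne_zero hs ht hcs hct hw (hc w hw hwv).ne'⟩
      rwa [← hts]
    -- Without a neighbour, all of `Ω` near `c` would lie in `s`; walking from `c` away from `v`
    -- leaves `s`.
    have hlim : Tendsto (fun θ : ℝ => AffineMap.lineMap c v θ) (𝓝[<] 0) (𝓝 c) := by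
      have : Continuous (fun θ : ℝ => (AffineMap.lineMap c v θ : Pt d)) := by
        simp only [AffineMap.lineMap_apply_module]; fun_prop
      simpa using (this.tendsto 0).mono_left nhdsWithin_le_nhds
    obtain ⟨θ, hθ, hθ0⟩ := ((hlim.eventually hev).and self_mem_nhdsWithin).exists
    have hθ0 : θ < 0 := hθ0
    have := hs'.mem_hull.1 hθ v hv
    rw [AffineMap.apply_lineMap, AffineMap.lineMap_apply_ring', hc0, hs'.bary_self hv] at this
    linarith
  obtain ⟨c0, hc0⟩ := hs'.exists_bary_pos
  have hlt : bary s v c0 < 1 := by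
    have h1 := hs'.sum_bary c0
    rw [← Finset.add_sum_erase s _ hv] at h1
    have h2 : 0 < ∑ w ∈ s.erase v, bary s w c0 := by
      refine Finset.sum_pos (fun w hw => hc0 w (Finset.mem_of_mem_erase hw)) ?_
      rw [← Finset.card_pos, Finset.card_erase_of_mem hv, hs'.card_eq]; omega
    linarith
  -- The projection of the interior point `c0` from `v` onto the opposite facet. The segment from
  -- any point of the facet to `c` consists of relative interior points, so the closed frontier also
  -- contains the rest of the facet.
  set c := AffineMap.lineMap v c0 (1 - bary s v c0)⁻¹ with hcdef
  have hpos : 0 < 1 - bary s v c0 := by linarith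
  have hcv : bary s v c = 0 := by
    rw [hcdef, AffineMap.apply_lineMap, AffineMap.lineMap_apply_ring', hs'.bary_self hv]
    field_simp; ring
  have hcw : ∀ w ∈ s, w ≠ v → 0 < bary s w c := by
    intro w hw hwv
    rw [hcdef, AffineMap.apply_lineMap, AffineMap.lineMap_apply_ring', hs'.bary_ne hw hv hwv]
    have := hc0 w hw
    simp only [sub_zero, add_zero]
    positivity
  intro y hy
  obtain ⟨hys, hyv⟩ := (hs'.mem_facet hv).1 hy
  have hlim : Tendsto (fun θ : ℝ => AffineMap.lineMap y c θ) (𝓝[>] 0) (𝓝 y) := by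
    have : Continuous (fun θ : ℝ => (AffineMap.lineMap y c θ : Pt d)) := by
      simp only [AffineMap.lineMap_apply_module]; fun_prop
    simpa using (this.tendsto 0).mono_left nhdsWithin_le_nhds
  refine isClosed_frontier.mem_of_tendsto hlim ?_
  filter_upwards [Ioo_mem_nhdsGT (zero_lt_one' ℝ)] with θ hθ
  refine hrel _ ?_ fun w hw hwv => ?_
  · rw [AffineMap.apply_lineMap, AffineMap.lineMap_apply_ring', hcv, hyv]; simp
  · rw [AffineMap.apply_lineMap, AffineMap.lineMap_apply_ring]
    have h1 := hs'.mem_hull.1 hys w hw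
    have h2 := hcw w hw hwv
    have h3 : 0 < 1 - θ := by linarith [hθ.2]
    have h4 := hθ.1
    positivity

/-- If a point of the boundary has a positive barycentric coordinate for the vertex `v`, then `v`
lies in the boundary. -/
lemma vertex_mem_frontier (hΩ : IsOpen Ω) (hreg : interior (closure Ω) = Ω) (hs : s ∈ T.cells)
    {x v : Pt d} (hx : x ∈ frontier Ω) (hxs : x ∈ hull s) (hv : v ∈ s) (hpos : 0 < bary s v x) :
    v ∈ frontier Ω := by
  have hs' := T.isSimplex hs
  have hvs : v ∈ hull s := subset_convexHull ℝ _ hv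
  by_contra hvf
  have hvΩ : v ∈ Ω := by
    by_contra h
    exact hvf (by rw [hΩ.frontier_eq]; exact ⟨T.hull_subset hs hvs, h⟩)
  -- If `v` were in `Ω`, contracting a neighbourhood of `x` towards `v` by a single small factor `ε`
  -- would move it into `Ω` close to `v`, hence into cells with vertex `v`. Undoing the contraction
  -- keeps each point in its cell as long as the coordinate for `v` stays positive. So a
  -- neighbourhood of `x` lies in the closure of `Ω`, contrary to `x` being a regular boundary
  -- point.
  have hcont : Continuous (fun q : ℝ × Pt d => (AffineMap.lineMap v q.2 q.1 : Pt d)) := by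
    simp only [AffineMap.lineMap_apply_module]; fun_prop
  have hlim : Tendsto (fun q : ℝ × Pt d => (AffineMap.lineMap v q.2 q.1 : Pt d)) (𝓝 (0, x))
      (𝓝 v) := by
    simpa using hcont.tendsto (0, x)
  have hev := hlim.eventually ((hΩ.eventually_mem hvΩ).and (T.eventually_mem_hull v))
  have hev' := (hev.curry_nhds).filter_mono (nhdsWithin_le_nhds (s := Ioi 0))
  obtain ⟨ε, hε, hε0⟩ := (hev'.and (Ioo_mem_nhdsGT (zero_lt_one' ℝ))).exists
  have hcx : Tendsto (fun y : Pt d => (AffineMap.lineMap v y ε : Pt d)) (𝓝 x)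
      (𝓝 (AffineMap.lineMap v x ε)) :=
    (hcont.comp (Continuous.prodMk_right ε)).tendsto x
  have hbp : ∀ᶠ y in 𝓝 x, ∀ t ∈ T.cells, 0 < bary t v x → 0 < bary t v y := by
    rw [Filter.eventually_all_finset]
    intro t _
    by_cases h : 0 < bary t v x
    · filter_upwards [((continuous_bary t v).tendsto x).eventually_const_lt h] with y hy _ using hy
    · exact Eventually.of_forall fun _ h' => absurd h' h
  have hxint : x ∈ interior (closure Ω) := by
    rw [mem_interior_iff_mem_nhds]
    filter_upwards [hε, hcx.eventually (T.eventually_mem_hull _), hbp] with y hy1 hy2 hy3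
    obtain ⟨t, ht, hyt⟩ := T.exists_mem_hull (subset_closure hy1.1)
    have ht' := T.isSimplex ht
    have hvt : v ∈ t := T.mem_of_bary_ne_zero hs ht hvs (hy1.2 t ht hyt) hv
      (by rw [hs'.bary_self hv]; exact one_ne_zero)
    have hp0t := hy2 t ht hyt
    have hp0s : AffineMap.lineMap v x ε ∈ hull s :=
      IsSimplex.convex_hull.lineMap_mem hvs hxs ⟨hε0.1.le, hε0.2.le⟩
    have heq := T.bary_eq_bary hs ht hp0s hp0t hv hvt
    rw [AffineMap.apply_lineMap, AffineMap.apply_lineMap, AffineMap.lineMap_apply_ring,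
      AffineMap.lineMap_apply_ring, hs'.bary_self hv, ht'.bary_self hvt] at heq
    -- The contracted `x` lies in both cells, where the coordinates for `v` agree; thus positivity
    -- passes from `s` to `t`.
    have heq' : bary s v x = bary t v x := by
      have : ε * bary s v x = ε * bary t v x := by linarith
      exact mul_left_cancel₀ hε0.1.ne' this
    refine T.hull_subset ht (ht'.mem_hull.2 fun u hu => ?_)
    by_cases huv : u = v
    · rw [huv]; exact (hy3 t ht (heq' ▸ hpos)).le
    · have h := ht'.mem_hull.1 hyt u hu
      rw [AffineMap.apply_lineMap, AffineMap.lineMap_apply_ring, ht'.bary_ne hu hvt huv] at h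
      simp only [mul_zero, zero_add] at h
      exact nonneg_of_mul_nonneg_right h hε0.1
  rw [hreg] at hxint
  rw [hΩ.frontier_eq] at hx
  exact hx.2 hxint

/-- A nonempty set of cells around the vertex `x`, closed under passing to a neighbour through a
facet containing `x`, and without boundary facets containing `x`: then `x` lies in `Ω` and all
cells around `x` belong to the set. -/
lemma star_connected (hd : 1 ≤ d) (hΩ : IsOpen Ω) {x : Pt d} {A : Finset (Finset (Pt d))}
    (hA : A ⊆ T.cells) (hAx : ∀ s ∈ A, x ∈ s) (hAn : A.Nonempty)
    (hcl : ∀ s ∈ A, ∀ t ∈ T.cells, x ∈ t → ∀ v ∈ s, v ≠ x → (∀ w ∈ s, w ≠ v → w ∈ t) → t ∈ A)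
    (hbd : ∀ s ∈ A, ∀ v ∈ s, v ≠ x → ¬ facet s v ⊆ frontier Ω) :
    x ∉ closure (closure Ω)ᶜ ∧ ∀ t ∈ T.cells, x ∈ t → t ∈ A := by
  classical
  obtain ⟨s0, hs0⟩ := hAn
  have hs0' := T.isSimplex (hA hs0)
  have hxs0 : x ∈ hull s0 := subset_convexHull ℝ _ (hAx s0 hs0)
  have hxvert : ∀ t ∈ T.cells, x ∈ hull t → x ∈ t := fun t ht hxt =>
    T.mem_of_bary_ne_zero (hA hs0) ht hxs0 hxt (hAx s0 hs0)
      (by rw [hs0'.bary_self (hAx s0 hs0)]; exact one_ne_zero)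
  have hbp : ∀ᶠ y in 𝓝 x, ∀ s ∈ A, 0 < bary s x y := by
    rw [Filter.eventually_all_finset]
    intro s hs
    refine ((continuous_bary s x).tendsto x).eventually_const_lt ?_
    rw [(T.isSimplex (hA hs)).bary_self (hAx s hs)]; exact one_pos
  obtain ⟨δ, hδ, hball⟩ := Metric.eventually_nhds_iff_ball.1 ((T.eventually_mem_hull x).and hbp)
  set U := Metric.ball x δ
  set B := T.cells.filter fun t => x ∈ t ∧ t ∉ A with hB
  set P := ⋃ s ∈ A, hull s with hPdef
  -- Inside the ball, `P` (cells of `A`) and `O` (remaining cells at `x` and the exterior) are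
  -- closed and cover everything. Once they are seen to meet only in faces with fewer than `d`
  -- vertices, `O` can have no interior points near `x`, which is both claims.
  set O := closure (closure Ω)ᶜ ∪ ⋃ t ∈ B, hull t with hOdef
  have hPc : IsClosed P := A.finite_toSet.isClosed_biUnion fun s _ => IsSimplex.isClosed_hull
  have hOc : IsClosed O :=
    isClosed_closure.union (B.finite_toSet.isClosed_biUnion fun s _ => IsSimplex.isClosed_hull)
  have hUx : U ∈ 𝓝 x := Metric.ball_mem_nhds x hδ
  have hmeet : ∀ {V W : Set (Pt d)}, x ∈ closure V → IsOpen V → V ⊆ W →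
      (interior W ∩ U).Nonempty := by
    intro V W hxV hV hVW
    obtain ⟨y, hyU, hyV⟩ := mem_closure_iff_nhds.1 hxV U hUx
    exact ⟨y, interior_maximal hVW hV hyV, hyU⟩
  have hmeet' : ∀ {t : Finset (Pt d)} {W : Set (Pt d)}, t ∈ T.cells → x ∈ t → hull t ⊆ W →
      (interior W ∩ U).Nonempty := fun ht hxt hW =>
    hmeet ((T.isSimplex ht).subset_closure_interior (subset_convexHull ℝ _ hxt)) isOpen_interior
      (interior_subset.trans hW)
  have hfalse : ¬ (interior O ∩ U).Nonempty := by
    refine false_of_codim_two hPc hOc (convex_ball x δ) Metric.isOpen_ball ?_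
      ((T.cells.biUnion Finset.powerset).filter fun f => f.card < d)
      (fun f hf => (Finset.mem_filter.1 hf).2) ?_
      (hmeet' (hA hs0) (hAx s0 hs0) (subset_biUnion_of_mem (u := fun s => hull s) hs0))
    · intro y hy
      by_cases hyΩ : y ∈ closure Ω
      · obtain ⟨t, ht, hyt⟩ := T.exists_mem_hull hyΩ
        have hxt := hxvert t ht ((hball y hy).1 t ht hyt)
        by_cases htA : t ∈ A
        · exact Or.inl (mem_biUnion htA hyt)
        · exact Or.inr (Or.inr (mem_biUnion (Finset.mem_filter.2 ⟨ht, hxt, htA⟩) hyt))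
      · exact Or.inr (Or.inl (subset_closure hyΩ))
    · intro y hyP hyO hyU
      simp only [hPdef, mem_iUnion, exists_prop] at hyP
      obtain ⟨s, hsA, hys⟩ := hyP
      have hs := hA hsA
      have hs' := T.isSimplex hs
      rcases hyO with hyO | hyO
      · have hyint : y ∉ interior (closure Ω) := by rwa [closure_compl] at hyO
        obtain ⟨v, hv, hv0⟩ : ∃ v ∈ s, bary s v y = 0 := by
          by_contra! hcon
          refine hyint (interior_mono (T.hull_subset hs) (hs'.mem_interior_hull.2 fun w hw => ?_))
          exact lt_of_le_of_ne (hs'.mem_hull.1 hys w hw) (hcon w hw).symm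
        have hvx : v ≠ x := by
          rintro rfl
          exact ((hball y hyU).2 s hsA).ne' hv0
        -- With only one vanishing coordinate, `y` would be interior to the union of `s` and a facet
        -- neighbour, or its facet would be a boundary facet containing `x`. Hence two coordinates
        -- vanish.
        obtain ⟨w, hw, hwv, hw0⟩ : ∃ w ∈ s, w ≠ v ∧ bary s w y = 0 := by
          by_contra! hcon
          rcases T.exists_neighbour_or_subset_frontier hd hΩ hs hv with ⟨t, ht, hts, hst⟩ | h
          · refine hyint (mem_interior_iff_mem_nhds.2 ?_)
            filter_upwards [T.eventually_mem_union hs ht hts hv hst hv0 fun w hw hwv =>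
              lt_of_le_of_ne (hs'.mem_hull.1 hys w hw) (hcon w hw hwv).symm] with z hz
            exact hz.elim (fun h => T.hull_subset hs h) fun h => T.hull_subset ht h
          · exact hbd s hsA v hv hvx h
        refine ⟨(s.erase v).erase w, Finset.mem_filter.2 ⟨Finset.mem_biUnion.2 ⟨s, hs, ?_⟩, ?_⟩, ?_⟩
        · exact Finset.mem_powerset.2 ((Finset.erase_subset _ _).trans (Finset.erase_subset _ _))
        · rw [Finset.card_erase_of_mem (Finset.mem_erase.2 ⟨hwv, hw⟩), Finset.card_erase_of_mem hv,
            hs'.card_eq]; omega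
        · rw [hs'.mem_convexHull (by
            exact_mod_cast (Finset.erase_subset _ _).trans (Finset.erase_subset _ _))]
          refine ⟨hs'.mem_hull.1 hys, fun u hu hun => ?_⟩
          by_cases huw : u = w
          · rw [huw, hw0]
          · by_cases huv : u = v
            · rw [huv, hv0]
            · exact absurd (by simp [huw, huv, hu]) hun
      · simp only [mem_iUnion, exists_prop] at hyO
        obtain ⟨t, htB, hyt⟩ := hyO
        obtain ⟨ht, hxt, htA⟩ := Finset.mem_filter.1 htB
        have ht' := T.isSimplex ht
        refine ⟨s ∩ t, Finset.mem_filter.2 ⟨Finset.mem_biUnion.2 ⟨s, hs, ?_⟩, ?_⟩, ?_⟩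
        · exact Finset.mem_powerset.2 Finset.inter_subset_left
        -- Cells with at least `d` common vertices are neighbours through a facet containing `x`, so
        -- `t` would belong to `A`.
        · by_contra hcard
          have hsd : (s \ t).card ≤ 1 := by
            have := Finset.card_inter_add_card_sdiff s t
            rw [hs'.card_eq] at this; omega
          have hne : (s \ t).Nonempty := by
            rw [Finset.sdiff_nonempty]
            intro hst
            exact htA (hs'.eq_of_subset ht' hst ▸ hsA)
          obtain ⟨v, hv⟩ := hne
          obtain ⟨hvs, hvt⟩ := Finset.mem_sdiff.1 hv
          refine htA (hcl s hsA t ht hxt v hvs (fun h => hvt (h ▸ hxt)) fun w hw hwv => ?_)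
          by_contra hwt
          exact hwv (Finset.card_le_one.1 hsd w (Finset.mem_sdiff.2 ⟨hw, hwt⟩) v hv)
        · rw [Finset.coe_inter, ← T.inter_eq s hs t ht]
          exact ⟨hys, hyt⟩
  constructor
  · intro hx
    exact hfalse (hmeet hx isClosed_closure.isOpen_compl (subset_closure.trans subset_union_left))
  · intro t ht hxt
    by_contra htA
    exact hfalse (hmeet' ht hxt ((subset_biUnion_of_mem (u := fun s => hull s)
      (Finset.mem_filter.2 ⟨ht, hxt, htA⟩ : t ∈ B)).trans subset_union_right))

end SimplicialMesh

end HDG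

/-! ### Gluing Lipschitz functions, mollification and thresholding -/

namespace HDG

/-- A function that is Lipschitz continuous on finitely many closed sets covering the space is
Lipschitz continuous. -/
lemma lipschitzWith_of_finite_closed_cover {E ι : Type*} [NormedAddCommGroup E] [NormedSpace ℝ E]
    [Finite ι] {f : E → ℝ} {C : ι → Set E} {K : NNReal} (hC : ∀ i, IsClosed (C i))
    (hcov : ⋃ i, C i = univ) (hf : ∀ i, LipschitzOnWith K f (C i)) : LipschitzWith K f := by
  have hcont : Continuous f :=
    (locallyFinite_of_finite C).continuous hcov hC fun i => (hf i).continuousOn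
  refine LipschitzWith.of_dist_le_mul fun x y => ?_
  set γ : ℝ → E := fun θ => AffineMap.lineMap x y θ with hγdef
  have hγ : Continuous γ := AffineMap.lineMap_continuous
  have hγd : ∀ a b, dist (γ a) (γ b) = dist a b * dist x y := fun a b => dist_lineMap_lineMap x y a b
  -- Continuous induction along the segment from `x` to `y`. Right of any `θ`, one of the finitely
  -- many closed sets contains points arbitrarily close to `γ θ`, hence also `γ θ`, and its
  -- Lipschitz bound carries the estimate a little further.
  set S : Set ℝ := {θ | dist (f (γ θ)) (f x) ≤ K * (θ * dist x y)} with hS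
  have hSc : IsClosed (S ∩ Icc 0 1) := by
    refine IsClosed.inter (isClosed_le ?_ ?_) isClosed_Icc <;> fun_prop
  have h0 : (0 : ℝ) ∈ S := by simp [hS, hγdef]
  have hsub := hSc.Icc_subset_of_forall_exists_gt h0 (by
    rintro θ ⟨hθS, hθ⟩ z hz
    obtain ⟨i, hi⟩ : ∃ i, ∃ᶠ τ in 𝓝[>] θ, γ τ ∈ C i := by
      by_contra! hcon
      have hall : ∀ᶠ τ in 𝓝[>] θ, ∀ i, γ τ ∉ C i := by
        rw [Filter.eventually_all]
        intro i
        exact hcon i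
      obtain ⟨τ, hτ⟩ := hall.exists
      have : γ τ ∈ ⋃ i, C i := by rw [hcov]; trivial
      obtain ⟨i, hi⟩ := mem_iUnion.1 this
      exact hτ i hi
    have hθi : γ θ ∈ C i :=
      (hC i).mem_of_frequently_of_tendsto hi ((hγ.tendsto θ).mono_left nhdsWithin_le_nhds)
    obtain ⟨τ, hτi, hτ⟩ := (hi.and_eventually (Ioc_mem_nhdsGT hz)).exists
    refine ⟨τ, ?_, hτ⟩
    have h1 : dist (f (γ τ)) (f (γ θ)) ≤ K * ((τ - θ) * dist x y) := by
      have := (hf i).dist_le_mul _ hτi _ hθi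
      rwa [hγd, Real.dist_eq τ, abs_of_pos (sub_pos.2 hτ.1)] at this
    have h2 : dist (f (γ θ)) (f x) ≤ K * (θ * dist x y) := hθS
    change dist (f (γ τ)) (f x) ≤ K * (τ * dist x y)
    calc dist (f (γ τ)) (f x) ≤ dist (f (γ τ)) (f (γ θ)) + dist (f (γ θ)) (f x) :=
          dist_triangle _ _ _
      _ ≤ K * ((τ - θ) * dist x y) + K * (θ * dist x y) := add_le_add h1 h2
      _ = K * (τ * dist x y) := by ring)
  have := hsub (right_mem_Icc.2 zero_le_one)
  simp only [hS, hγdef, mem_ofPred_eq, AffineMap.lineMap_apply_one, one_mul] at this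
  rwa [dist_comm] at this

/-- Bounded functions that converge to zero almost everywhere converge to zero in `L²`. -/
lemma tendsto_eLpNorm_two_of_bounded {α E : Type*} [MeasurableSpace α] [NormedAddCommGroup E]
    {μ : Measure α} [IsFiniteMeasure μ] {f : ℕ → α → E} {B : ℝ}
    (hf : ∀ n, AEStronglyMeasurable (f n) μ) (hB : ∀ n x, ‖f n x‖ ≤ B)
    (hlim : ∀ᵐ x ∂μ, Tendsto (fun n => f n x) atTop (𝓝 0)) :
    Tendsto (fun n => eLpNorm (f n) 2 μ) atTop (𝓝 0) := by
  have hui : UnifIntegrable f 2 μ := by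
    refine unifIntegrable_of (by norm_num) (by norm_num) hf fun ε _ => ⟨Real.toNNReal B + 1, fun n => ?_⟩
    have : {x | Real.toNNReal B + 1 ≤ ‖f n x‖₊} = ∅ := by
      refine eq_empty_of_forall_notMem fun x hx => ?_
      have h1 : (Real.toNNReal B + 1 : ℝ) ≤ ‖f n x‖ := by exact_mod_cast hx
      have h2 := hB n x
      have h3 := Real.le_coe_toNNReal B
      linarith
    rw [this]
    simp
  have := tendsto_Lp_finite_of_tendsto_ae (by norm_num) (by norm_num) hf
    (MemLp.zero (ε := E) (p := 2)) hui (g := 0) (by simpa using hlim)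
  simpa using this

section Mollifier

variable {d : ℕ}

/-- Mollification with the standard bump function supported in the ball of radius `δ`. -/
noncomputable def mollify (δ : ℝ) (hδ : 0 < δ) (g : Pt d → ℝ) : Pt d → ℝ :=
  convolution ((⟨δ / 2, δ, half_pos hδ, half_lt_self hδ⟩ : ContDiffBump (0 : Pt d)).normed volume) g
    (ContinuousLinearMap.lsmul ℝ ℝ) volume

variable {δ : ℝ} {hδ : 0 < δ} {g : Pt d → ℝ}

lemma contDiff_mollify (hg : Continuous g) : ContDiff ℝ ∞ (mollify δ hδ g) :=
  HasCompactSupport.contDiff_convolution_left _ (ContDiffBump.hasCompactSupport_normed _)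
    (ContDiffBump.contDiff_normed _) hg.locallyIntegrable

/-- Mollification averages translates over a ball of radius `δ` against a probability density, so
bounds uniform over the translates survive. With `a = 0` this preserves Lipschitz constants; with `c
= 0` it preserves differences exactly where the function is affine. -/
lemma abs_mollify_sub_sub_le (hg : Continuous g) {x y : Pt d} {a c : ℝ}
    (h : ∀ t, ‖t‖ ≤ δ → |g (x - t) - g (y - t) - a| ≤ c) :
    |mollify δ hδ g x - mollify δ hδ g y - a| ≤ c := by
  set φ : ContDiffBump (0 : Pt d) := ⟨δ / 2, δ, half_pos hδ, half_lt_self hδ⟩ with hφ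
  set ρ := φ.normed volume with hρ
  have hρc : Continuous ρ := φ.continuous_normed
  have hρs : HasCompactSupport ρ := φ.hasCompactSupport_normed
  have hint : ∀ f : Pt d → ℝ, Continuous f → Integrable (fun t => ρ t * f t) := fun f hf =>
    (hρc.mul hf).integrable_of_hasCompactSupport hρs.mul_right
  have hρ1 : ∫ t, ρ t = 1 := φ.integral_normed
  have hx : ∀ z, mollify δ hδ g z = ∫ t, ρ t * g (z - t) := fun z => rfl
  have ha : a = ∫ t, ρ t * a := by rw [integral_mul_const, hρ1, one_mul]
  have hc : c = ∫ t, ρ t * c := by rw [integral_mul_const, hρ1, one_mul]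
  have hgx : ∀ z, Continuous fun t => g (z - t) := fun z => by fun_prop
  have hi1 := hint _ (hgx x)
  have hi2 := hint _ (hgx y)
  have hi3 := hint (fun _ => a) continuous_const
  have hi4 := hint (fun _ => c) continuous_const
  have heq : mollify δ hδ g x - mollify δ hδ g y - a
      = ∫ t, ρ t * (g (x - t) - g (y - t) - a) := by
    conv_lhs => rw [ha, hx, hx]
    have e : (fun t => ρ t * (g (x - t) - g (y - t) - a))
        = fun t => (ρ t * g (x - t) - ρ t * g (y - t)) - ρ t * a := by
      funext t; ring
    rw [e]
    exact (integral_sub hi1 hi2 ▸ integral_sub (hi1.sub hi2) hi3).symm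
  rw [heq, hc, ← Real.norm_eq_abs]
  refine (norm_integral_le_integral_norm _).trans (integral_mono (hint _ (by fun_prop)).norm hi4 ?_)
  intro t
  have hρ0 : 0 ≤ ρ t := φ.nonneg_normed t
  simp only [Real.norm_eq_abs, abs_mul, abs_of_nonneg hρ0]
  by_cases ht : ‖t‖ ≤ δ
  · exact mul_le_mul_of_nonneg_left (h t ht) hρ0
  · have : ρ t = 0 := by
      by_contra hne
      have hmem : t ∈ Function.support ρ := hne
      rw [hρ, φ.support_normed_eq] at hmem
      exact ht (by simpa using (Metric.mem_ball.1 hmem).le)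
    simp [this]

lemma abs_mollify_sub_le (hg : Continuous g) {x : Pt d} {c : ℝ}
    (h : ∀ y, dist y x < δ → |g y - g x| ≤ c) : |mollify δ hδ g x - g x| ≤ c :=
  ContDiffBump.dist_normed_convolution_le hg.aestronglyMeasurable h

lemma lipschitzWith_mollify {K : NNReal} (hg : LipschitzWith K g) :
    LipschitzWith K (mollify δ hδ g) := by
  refine LipschitzWith.of_dist_le_mul fun x y => ?_
  rw [Real.dist_eq]
  have := abs_mollify_sub_sub_le (hδ := hδ) hg.continuous (x := x) (y := y) (a := 0)
    (c := K * dist x y) fun t _ => by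
      have := hg.dist_le_mul (x - t) (y - t)
      rw [Real.dist_eq, dist_sub_right] at this
      simpa using this
  simpa using this

end Mollifier

/-- Soft thresholding. -/
def softThreshold (ε t : ℝ) : ℝ := max (t - ε) (min (t + ε) 0)

lemma lipschitzWith_softThreshold (ε : ℝ) : LipschitzWith 1 (softThreshold ε) := by
  have h1 : LipschitzWith 1 (fun t : ℝ => t - ε) := by
    simpa using LipschitzWith.id.sub (LipschitzWith.const ε)
  have h2 : LipschitzWith 1 (fun t : ℝ => t + ε) := by
    simpa using LipschitzWith.id.add (LipschitzWith.const ε)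
  have h3 := h1.max (h2.min_const 0)
  rw [max_self] at h3
  exact h3

lemma softThreshold_of_le {ε t : ℝ} (hε : 0 ≤ ε) (h : ε ≤ t) : softThreshold ε t = t - ε := by
  rw [softThreshold, min_eq_right (by linarith), max_eq_left (by linarith)]

lemma softThreshold_of_le_neg {ε t : ℝ} (hε : 0 ≤ ε) (h : t ≤ -ε) : softThreshold ε t = t + ε := by
  rw [softThreshold, min_eq_left (by linarith), max_eq_right (by linarith)]

lemma softThreshold_of_abs_le {ε t : ℝ} (h : |t| ≤ ε) : softThreshold ε t = 0 := by
  obtain ⟨h1, h2⟩ := abs_le.1 h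
  rw [softThreshold, min_eq_right (by linarith), max_eq_right (by linarith)]

lemma abs_softThreshold_sub_le {ε : ℝ} (hε : 0 ≤ ε) (t : ℝ) : |softThreshold ε t - t| ≤ ε := by
  rcases le_total ε t with h | h
  · rw [softThreshold_of_le hε h, abs_le]; constructor <;> linarith
  · rcases le_total t (-ε) with h' | h'
    · rw [softThreshold_of_le_neg hε h', abs_le]; constructor <;> linarith
    · rw [softThreshold_of_abs_le (abs_le.2 ⟨h', h⟩), abs_le]; constructor <;> linarith

end HDG

/-! ### Piecewise affine functions belong to H¹₀ -/

namespace HDG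

variable {d : ℕ} {Ω : Set (Pt d)}

lemma volume_affineMap_eq_zero (f : Pt d →ᵃ[ℝ] ℝ) (hf : f.linear ≠ 0) :
    volume {x | f x = 0} = 0 := by
  set A : AffineSubspace ℝ (Pt d) := (AffineSubspace.mk' (0 : ℝ) ⊥).comap f with hA
  have hmem : ∀ x, x ∈ A ↔ f x = 0 := by
    intro x
    rw [hA, AffineSubspace.mem_comap, AffineSubspace.mem_mk']
    simp
  have : {x | f x = 0} = (A : Set (Pt d)) := by
    ext x; exact (hmem x).symm
  rw [this]
  refine Measure.addHaar_affineSubspace _ _ fun htop => hf ?_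
  have hall : ∀ x, f x = 0 := fun x => (hmem x).1 (htop ▸ AffineSubspace.mem_top ℝ _ x)
  ext v
  have := f.linearMap_vsub v 0
  simpa [hall] using this

namespace SimplicialMesh

variable (T : SimplicialMesh Ω)

/-- Almost every point of the domain lies in the interior of a cell. -/
lemma ae_mem_interior : ∀ᵐ x ∂(volume.restrict Ω), ∃ s ∈ T.cells, x ∈ interior (hull s) := by
  have hnull : volume (⋃ s ∈ T.cells, frontier (hull s)) = 0 :=
    (measure_biUnion_null_iff T.cells.countable_toSet).2 fun s _ =>
      IsSimplex.convex_hull.addHaar_frontier volume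
  have h1 : ∀ᵐ x ∂(volume : Measure (Pt d)), x ∉ ⋃ s ∈ T.cells, frontier (hull s) :=
    measure_eq_zero_iff_ae_notMem.1 hnull
  have h2 : ∀ᵐ x ∂(volume.restrict Ω), x ∈ closure Ω := by
    refine ae_restrict_of_ae_restrict_of_subset subset_closure ?_
    exact ae_restrict_mem isClosed_closure.measurableSet
  filter_upwards [ae_restrict_of_ae h1, h2] with x hx hxΩ
  obtain ⟨s, hs, hxs⟩ := T.exists_mem_hull hxΩ
  refine ⟨s, hs, ?_⟩
  by_contra hns
  refine hx (mem_biUnion hs ?_)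
  rw [frontier, IsSimplex.isClosed_hull.closure_eq]
  exact ⟨hxs, hns⟩

end SimplicialMesh

lemma norm_gradient_le_of_lipschitz {f : Pt d → ℝ} {K : NNReal} (hf : LipschitzWith K f)
    (x : Pt d) : ‖gradient f x‖ ≤ K := by
  rw [gradient, LinearIsometryEquiv.norm_map]
  exact norm_fderiv_le_of_lipschitz ℝ hf

lemma measurable_gradient (f : Pt d → ℝ) : Measurable (gradient f) :=
  (InnerProductSpace.toDual ℝ (Pt d)).symm.continuous.measurable.comp (measurable_fderiv ℝ f)

lemma gradient_eq_of_eventually {f g : Pt d → ℝ} {x : Pt d} {c : ℝ}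
    (h : ∀ᶠ z in 𝓝 x, f z = g z + c) : gradient f x = gradient g x := by
  rw [gradient, gradient, Filter.EventuallyEq.fderiv_eq (show f =ᶠ[𝓝 x] fun z => g z + c from h)]
  simp

/-- A Lipschitz function that vanishes outside of a bounded open set and is affine on the cells of
a mesh is in `H^1_0`. -/
lemma memH10_of_lipschitzWith (T : SimplicialMesh Ω) (hb : Bornology.IsBounded Ω)
    {w : Pt d → ℝ} {K : NNReal} (hw : LipschitzWith K w) (h0 : ∀ x ∉ Ω, w x = 0)
    (haff : ∀ s ∈ T.cells, ∃ f : Pt d →ᵃ[ℝ] ℝ, ∀ x ∈ hull s, w x = f x) : MemH10 Ω w := by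
  have hfin : IsFiniteMeasure (volume.restrict Ω) := ⟨by
    rw [Measure.restrict_apply_univ]; exact hb.measure_lt_top⟩
  have hcb : IsCompact (closure Ω) := hb.isCompact_closure
  obtain ⟨B, hB⟩ : ∃ B, ∀ x, |w x| ≤ B := by
    obtain ⟨B, hB⟩ := hcb.exists_bound_of_continuousOn hw.continuous.continuousOn
    refine ⟨max B 0, fun x => ?_⟩
    by_cases hx : x ∈ Ω
    · exact (hB x (subset_closure hx)).trans (le_max_left _ _)
    · rw [h0 x hx, abs_zero]; exact le_max_right _ _
  set ε : ℕ → ℝ := fun n => 1 / ((n : ℝ) + 1) with hεdef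
  have hε : ∀ n, 0 < ε n := fun n => Nat.one_div_pos_of_nat
  have hε1 : ∀ n, ε n ≤ 1 := fun n => by
    rw [hεdef]; simp only; rw [div_le_one (by positivity)]; linarith [Nat.cast_nonneg (α := ℝ) n]
  have hεlim : Tendsto ε atTop (𝓝 0) := tendsto_one_div_add_atTop_nhds_zero_nat
  -- The radius is so small that `w` changes by at most `ε n / 2` over it. Hence mollifying the
  -- thresholded function leaves zero wherever `|w| < ε n / 2`, and the support stays in the closed
  -- set `|w| ≥ ε n / 2` inside `Ω`.
  set δ : ℕ → ℝ := fun n => ε n / (2 * (K + 1)) with hδdef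
  have hδ : ∀ n, 0 < δ n := fun n => div_pos (hε n) (by positivity)
  have hKδ : ∀ n, K * δ n ≤ ε n / 2 := fun n => by
    have h1 : (K + 1 : ℝ) * δ n = ε n / 2 := by
      rw [hδdef]; field_simp
    have h2 := hδ n
    nlinarith
  have hδε : ∀ n, δ n ≤ ε n := fun n => by
    rw [hδdef]
    have : (0 : ℝ) ≤ K := K.2
    exact div_le_self (hε n).le (by linarith)
  set v : ℕ → Pt d → ℝ := fun n x => softThreshold (ε n) (w x) with hv
  have hvL : ∀ n, LipschitzWith K (v n) := fun n => by
    have := (lipschitzWith_softThreshold (ε n)).comp hw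
    rwa [one_mul] at this
  set φ : ℕ → Pt d → ℝ := fun n => mollify (δ n) (hδ n) (v n) with hφ
  have hφL : ∀ n, LipschitzWith K (φ n) := fun n => lipschitzWith_mollify (hvL n)
  have hφv : ∀ n x, |φ n x - v n x| ≤ ε n / 2 := fun n x =>
    abs_mollify_sub_le (hvL n).continuous fun y hy => by
      have := (hvL n).dist_le_mul y x
      rw [Real.dist_eq] at this
      exact this.trans ((mul_le_mul_of_nonneg_left hy.le K.2).trans (hKδ n))
  have hφw : ∀ n x, |φ n x - w x| ≤ 2 * ε n := fun n x => by
    have h1 := abs_softThreshold_sub_le (hε n).le (w x)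
    have h2 := abs_sub_le (φ n x) (v n x) (w x)
    have h3 := hφv n x
    have h4 := hε n
    have h5 : |v n x - w x| ≤ ε n := h1
    linarith
  have hsupp : ∀ n x, |w x| < ε n / 2 → φ n x = 0 := fun n x hx => by
    have hvx : v n x = 0 := softThreshold_of_abs_le (by linarith [hε n])
    have := abs_mollify_sub_le (hδ := hδ n) (hvL n).continuous (x := x) (c := 0) fun y hy => by
      have h1 := hw.dist_le_mul y x
      rw [Real.dist_eq] at h1
      have h2 := h1.trans ((mul_le_mul_of_nonneg_left hy.le K.2).trans (hKδ n))
      have h3 := abs_sub_abs_le_abs_sub (w y) (w x)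
      have hvy : v n y = 0 := softThreshold_of_abs_le (by linarith)
      rw [hvx, hvy]; simp
    rw [hvx, sub_zero] at this
    exact abs_nonpos_iff.1 this
  have htsupp : ∀ n, tsupport (φ n) ⊆ Ω := fun n => by
    have hcl : IsClosed {x | ε n / 2 ≤ |w x|} := isClosed_le continuous_const hw.continuous.abs
    refine (closure_minimal (fun x hx => ?_) hcl).trans fun x hx => ?_
    · by_contra hlt
      exact hx (hsupp n x (not_le.1 hlt))
    · by_contra hxΩ
      have hx' : ε n / 2 ≤ |w x| := hx
      rw [h0 x hxΩ, abs_zero] at hx'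
      linarith [hε n]
  -- Almost everywhere the gradients are eventually equal, not only close. The exceptional set
  -- consists of cell boundaries and zero sets of nonconstant affine pieces.
  have hgrad : ∀ᵐ x ∂(volume.restrict Ω),
      Tendsto (fun n => gradient (φ n) x - gradient w x) atTop (𝓝 0) := by
    choose! f hf using haff
    have hnull : ∀ᵐ x ∂(volume : Measure (Pt d)),
        ∀ s ∈ T.cells, (f s).linear ≠ 0 → f s x ≠ 0 := by
      refine (ae_ball_iff T.cells.countable_toSet).2 ?_
      intro s _
      by_cases hs : (f s).linear = 0
      · exact Eventually.of_forall fun _ h => absurd hs h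
      · filter_upwards [measure_eq_zero_iff_ae_notMem.1 (volume_affineMap_eq_zero (f s) hs)]
          with x hx _ using hx
    filter_upwards [T.ae_mem_interior, ae_restrict_of_ae hnull] with x hx hx0
    obtain ⟨s, hs, hxs⟩ := hx
    have hnear : ∀ᶠ y in 𝓝 x, y ∈ hull s := mem_interior_iff_mem_nhds.1 hxs
    have hwx : w x = f s x := hf s hs x (interior_subset hxs)
    -- Near such an `x`, small thresholds do not change differences of `w`: either `w x ≠ 0` and
    -- thresholding is a shift by `±e`, or the piece is constant and `w` vanishes nearby.
    -- Mollification then reproduces these differences, as `w` is affine there.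
    suffices hkey : ∃ η > 0, ∃ ε0 > 0, ∀ e, 0 < e → e < ε0 → ∀ y ∈ Metric.ball x η,
        ∀ z ∈ Metric.ball x η, softThreshold e (w y) - softThreshold e (w z) = w y - w z by
      obtain ⟨η, hη, ε0, hε0, hkey⟩ := hkey
      have hfl : ∀ y z t : Pt d, f s (y - t) - f s (z - t) = f s y - f s z := by
        intro y z t
        have h1 := (f s).linearMap_vsub (y - t) (z - t)
        have h2 := (f s).linearMap_vsub y z
        simp only [vsub_eq_sub, sub_sub_sub_cancel_right] at h1 h2
        rw [← h1, h2]
      obtain ⟨η', hη', hball⟩ := Metric.eventually_nhds_iff_ball.1 hnear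
      refine tendsto_const_nhds.congr' ?_
      filter_upwards [hεlim.eventually_lt_const (lt_min hε0 (half_pos (lt_min hη hη')))] with n hn
      rw [lt_min_iff] at hn
      symm
      rw [sub_eq_zero]
      refine gradient_eq_of_eventually (c := φ n x - w x) ?_
      filter_upwards [Metric.ball_mem_nhds x (half_pos (lt_min hη hη'))] with y hy
      have hsub : ∀ z t : Pt d, dist z x < min η η' / 2 → ‖t‖ ≤ δ n →
          dist (z - t) x < min η η' := by
        intro z t hz ht
        have h1 := dist_triangle (z - t) z x
        have h2 : dist (z - t) z = ‖t‖ := by simp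
        have h3 := hδε n
        linarith [hn.2]
      have hyy : w y = f s y := hf s hs y (hball y (by
        have := hsub y 0 hy (by simpa using (hδ n).le)
        rw [sub_zero] at this
        exact this.trans_le (min_le_right _ _)))
      have := abs_mollify_sub_sub_le (hδ := hδ n) (hvL n).continuous (x := y) (y := x)
        (a := w y - w x) (c := 0) fun t ht => by
          have hx1 := hsub x t (by simpa using half_pos (lt_min hη hη')) ht
          have hy1 := hsub y t hy ht
          have e1 := hkey (ε n) (hε n) hn.1 (y - t) (hy1.trans_le (min_le_left _ _)) (x - t)
            (hx1.trans_le (min_le_left _ _))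
          have e2 := hf s hs _ (hball _ (hy1.trans_le (min_le_right _ _)))
          have e3 := hf s hs _ (hball _ (hx1.trans_le (min_le_right _ _)))
          have e4 := hfl y x t
          have e5 : v n (y - t) - v n (x - t) - (w y - w x) = 0 := by
            simp only [hv]; rw [e1, e2, e3, e4, hyy, hwx]; ring
          rw [e5, abs_zero]
      have := abs_nonpos_iff.1 this
      have h6 : mollify (δ n) (hδ n) (v n) y = φ n y := rfl
      have h7 : mollify (δ n) (hδ n) (v n) x = φ n x := rfl
      rw [h6, h7] at this
      linarith
    by_cases hwx0 : w x = 0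
    · have hlin : (f s).linear = 0 := by
        by_contra hlin
        exact hx0 s hs hlin (by rw [← hwx, hwx0])
      obtain ⟨η', hη', hball⟩ := Metric.eventually_nhds_iff_ball.1 hnear
      have hz : ∀ y ∈ Metric.ball x η', w y = 0 := by
        intro y hy
        have h1 := (f s).linearMap_vsub y x
        rw [hlin, LinearMap.zero_apply, vsub_eq_sub] at h1
        rw [hf s hs y (hball y hy), ← hwx0, hwx]
        linarith
      exact ⟨η', hη', 1, one_pos, fun e _ _ y hy z hz' => by rw [hz y hy, hz z hz']; simp⟩
    · have hpos : 0 < |w x| := abs_pos.2 hwx0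
      have hc : ∀ᶠ y in 𝓝 x, |w y - w x| < |w x| / 2 := by
        have : Tendsto (fun y => |w y - w x|) (𝓝 x) (𝓝 0) := by
          have h : Continuous fun y => |w y - w x| := (hw.continuous.sub continuous_const).abs
          simpa using h.tendsto x
        exact this.eventually_lt_const (half_pos hpos)
      obtain ⟨η', hη', hball⟩ := Metric.eventually_nhds_iff_ball.1 hc
      refine ⟨η', hη', |w x| / 2, half_pos hpos, fun e he0 he y hy z hz => ?_⟩
      obtain ⟨hy1, hy2⟩ := abs_lt.1 (hball y hy)
      obtain ⟨hz1, hz2⟩ := abs_lt.1 (hball z hz)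
      rcases lt_or_gt_of_ne hwx0 with hneg | hpos'
      · rw [abs_of_neg hneg] at *
        rw [softThreshold_of_le_neg he0.le (by linarith),
          softThreshold_of_le_neg he0.le (by linarith)]
        ring
      · rw [abs_of_pos hpos'] at *
        rw [softThreshold_of_le he0.le (by linarith), softThreshold_of_le he0.le (by linarith)]
        ring
  have hφs : ∀ n, ContDiff ℝ ∞ (φ n) := fun n => contDiff_mollify (hvL n).continuous
  refine ⟨?_, gradient w, φ, ?_, fun n => ⟨hφs n, ?_, htsupp n⟩, ?_, ?_⟩
  · exact MemLp.of_bound hw.continuous.aestronglyMeasurable B (Eventually.of_forall hB)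
  · exact MemLp.of_bound (measurable_gradient w).aestronglyMeasurable K
      (Eventually.of_forall fun x => norm_gradient_le_of_lipschitz hw x)
  · exact hcb.of_isClosed_subset (isClosed_tsupport _) ((htsupp n).trans subset_closure)
  · refine tendsto_eLpNorm_two_of_bounded (B := 2) (fun n => ?_) (fun n x => ?_)
      (Eventually.of_forall fun x => ?_)
    · exact ((hφs n).continuous.sub hw.continuous).aestronglyMeasurable
    · exact (hφw n x).trans (by linarith [hε1 n])
    · refine squeeze_zero_norm (hφw · x) ?_
      simpa using hεlim.const_mul 2
  · refine tendsto_eLpNorm_two_of_bounded (B := K + K) (fun n => ?_) (fun n x => ?_) hgrad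
    · exact ((measurable_gradient _).sub (measurable_gradient _)).aestronglyMeasurable
    · exact (norm_sub_le _ _).trans (add_le_add (norm_gradient_le_of_lipschitz (hφL n) x)
        (norm_gradient_le_of_lipschitz hw x))

end HDG

/-! ### Polynomials and inverse inequalities -/

namespace HDG

section Polynomials

variable {m n : ℕ}

lemma continuous_polyFun (q : Poly n) : Continuous (polyFun q) :=
  (MvPolynomial.continuous_eval q).comp (by fun_prop)

lemma polyFun_add (q r : Poly n) (x : Pt n) : polyFun (q + r) x = polyFun q x + polyFun r x := by
  simp [polyFun]

lemma polyFun_sub (q r : Poly n) (x : Pt n) : polyFun (q - r) x = polyFun q x - polyFun r x := by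
  simp [polyFun]

lemma polyFun_smul (c : ℝ) (q : Poly n) (x : Pt n) : polyFun (c • q) x = c * polyFun q x := by
  simp [polyFun]

/-- Affine functions are polynomials of degree at most one. -/
lemma exists_poly_affine (f : Pt n →ᵃ[ℝ] ℝ) :
    ∃ q : Poly n, q.totalDegree ≤ 1 ∧ ∀ x, polyFun q x = f x := by
  refine ⟨MvPolynomial.C (f 0) + ∑ i, MvPolynomial.C (f.linear (EuclideanSpace.single i 1)) *
    MvPolynomial.X i, ?_, fun x => ?_⟩
  · refine (MvPolynomial.totalDegree_add _ _).trans (max_le (by simp) ?_)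
    refine MvPolynomial.totalDegree_finsetSum_le fun i _ =>
      (MvPolynomial.totalDegree_mul _ _).trans ?_
    simp
  · have h1 : f x = f.linear x + f 0 := by
      have := f.linearMap_vsub x 0
      simp at this
      linarith
    have h2 : x = ∑ i, x i • EuclideanSpace.single i (1 : ℝ) := by
      ext j
      simp [Pi.single_apply]
    rw [h1]
    conv_rhs => rw [h2]
    simp [polyFun, mul_comm, add_comm]

/-- The composition of a polynomial with an affine map is a polynomial of at most the same degree. -/
lemma exists_poly_comp_affine (q : Poly n) (A : Pt m →ᵃ[ℝ] Pt n) :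
    ∃ q' : Poly m, q'.totalDegree ≤ q.totalDegree ∧ ∀ x, polyFun q' x = polyFun q (A x) := by
  choose a ha hax using fun i : Fin n => exists_poly_affine
    ((EuclideanSpace.proj (𝕜 := ℝ) i).toLinearMap.toAffineMap.comp A)
  refine ⟨∑ e ∈ q.support, MvPolynomial.C (q.coeff e) * ∏ i, a i ^ e i, ?_, fun x => ?_⟩
  · refine MvPolynomial.totalDegree_finsetSum_le fun e he => ?_
    refine (MvPolynomial.totalDegree_mul _ _).trans ?_
    rw [MvPolynomial.totalDegree_C, zero_add]
    refine (MvPolynomial.totalDegree_finsetProd _ _).trans ?_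
    refine le_trans ?_ (MvPolynomial.le_totalDegree he)
    rw [Finsupp.sum_fintype _ _ fun _ => rfl]
    refine Finset.sum_le_sum fun i _ => (MvPolynomial.totalDegree_pow _ _).trans ?_
    simpa using Nat.mul_le_mul_left (e i) (ha i)
  · have h : ∀ i, MvPolynomial.eval (fun j => x j) (a i) = A x i := fun i => hax i x
    rw [polyFun, polyFun, MvPolynomial.eval_eq' _ q]
    simp [h]

/-- A ball contains a product of intervals, and a polynomial vanishing on a product of infinite sets
is zero. -/
lemma eq_zero_of_polyFun_eq_zero {q : Poly n} {x : Pt n} {r : ℝ} (hr : 0 < r)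
    (h : ∀ y ∈ Metric.ball x r, polyFun q y = 0) : q = 0 := by
  have hopen : IsOpen ((fun f : Fin n → ℝ => (WithLp.toLp 2 f : Pt n)) ⁻¹' Metric.ball x r) :=
    Metric.isOpen_ball.preimage (by fun_prop)
  obtain ⟨η, hη, hball⟩ := Metric.isOpen_iff.1 hopen (fun i => x i) (by simpa using hr)
  refine MvPolynomial.funext_set (fun i => Metric.ball (x i) η) (fun i => ?_) fun f hf => ?_
  · rw [Real.ball_eq_Ioo]
    exact Ioo_infinite (by linarith)
  · have hmem : f ∈ Metric.ball (fun i => x i) η := by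
      rw [ball_pi _ hη]; exact hf
    have := h _ (hball hmem)
    simpa [polyFun] using this

lemma integrableOn_of_continuous {f : Pt n → ℝ} (hf : Continuous f) {s : Set (Pt n)}
    (hs : IsCompact s) : IntegrableOn f s := hf.continuousOn.integrableOn_compact hs

/-- Inverse inequality on the unit ball. -/
lemma exists_inverse_inequality_unit (n m : ℕ) (ρ : ℝ) :
    ∃ C : ℝ, 0 < C ∧ ∀ q : Poly n, q.totalDegree ≤ m → ∀ x ∈ Metric.closedBall (0 : Pt n) ρ,
      polyFun q x ^ 2 ≤ C * ∫ z in Metric.closedBall (0 : Pt n) 1, polyFun q z ^ 2 := by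
  set b := Module.finBasis ℝ (MvPolynomial.restrictTotalDegree (Fin n) ℝ m) with hb
  set N := Module.finrank ℝ (MvPolynomial.restrictTotalDegree (Fin n) ℝ m)
  set β : Fin N → Pt n → ℝ := fun i => polyFun (b i : Poly n) with hβ
  have hβc : ∀ i, Continuous (β i) := fun i => continuous_polyFun _
  set P : (Fin N → ℝ) → Poly n := fun c => ∑ i, c i • (b i : Poly n) with hP
  have hPf : ∀ c x, polyFun (P c) x = ∑ i, c i * β i x := fun c x => by
    simp [hP, hβ, polyFun]
  set I : (Fin N → ℝ) → ℝ := fun c => ∫ z in Metric.closedBall (0 : Pt n) 1, polyFun (P c) z ^ 2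
    with hI
  have hIc : Continuous I := by
    refine continuous_parametric_integral_of_continuous ?_ (isCompact_closedBall _ _)
    have : (Function.uncurry fun (c : Fin N → ℝ) (z : Pt n) => polyFun (P c) z ^ 2)
        = fun p => (∑ i, p.1 i * β i p.2) ^ 2 := by
      funext p; simp [Function.uncurry, hPf]
    rw [this]
    fun_prop
  have hpos : ∀ c ∈ Metric.sphere (0 : Fin N → ℝ) 1, 0 < I c := by
    intro c hc
    refine lt_of_le_of_ne (integral_nonneg fun _ => sq_nonneg _) fun h0 => ?_
    have hcont : Continuous fun z => polyFun (P c) z ^ 2 := (continuous_polyFun _).pow 2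
    have hae := (setIntegral_eq_zero_iff_of_nonneg_ae (Eventually.of_forall fun _ => sq_nonneg _)
      (integrableOn_of_continuous hcont (isCompact_closedBall _ _))).1 h0.symm
    have hae' : (fun z => polyFun (P c) z ^ 2) =ᵐ[volume.restrict (Metric.ball (0 : Pt n) 1)] 0 :=
      ae_restrict_of_ae_restrict_of_subset Metric.ball_subset_closedBall hae
    have hzero := Measure.eqOn_open_of_ae_eq hae' Metric.isOpen_ball hcont.continuousOn
      continuousOn_const
    have hP0 : P c = 0 := eq_zero_of_polyFun_eq_zero one_pos fun y hy =>
      pow_eq_zero_iff two_ne_zero |>.1 (hzero hy)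
    have hli := b.linearIndependent
    rw [Fintype.linearIndependent_iff] at hli
    have hc0 : c = 0 := by
      funext i
      refine hli c ?_ i
      apply Subtype.ext
      refine Eq.trans ?_ hP0
      simp [hP]
    rw [hc0] at hc
    simp at hc
  -- The squared `L²` norm is a positive continuous function of the coefficients on their unit
  -- sphere, so it is bounded below by some `δ > 0`; homogeneity does the rest.
  obtain ⟨δ, hδ, hδI⟩ := (isCompact_sphere (0 : Fin N → ℝ) 1).exists_forall_le' hIc.continuousOn hpos
  have hδI' : ∀ c, δ * ‖c‖ ^ 2 ≤ I c := by
    intro c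
    rcases eq_or_ne c 0 with rfl | hc
    · have : 0 ≤ I 0 := integral_nonneg fun _ => sq_nonneg _
      simpa using this
    · have hn : 0 < ‖c‖ := norm_pos_iff.2 hc
      have h1 := hδI (‖c‖⁻¹ • c) (by simp [norm_smul, hn.ne'])
      have h2 : I (‖c‖⁻¹ • c) = (‖c‖ ^ 2)⁻¹ * I c := by
        simp only [hI]
        rw [← integral_const_mul]
        congr 1
        funext z
        rw [hPf, hPf]
        simp only [Pi.smul_apply, smul_eq_mul, mul_assoc, ← Finset.mul_sum]
        rw [mul_pow, inv_pow]
      rw [h2] at h1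
      calc δ * ‖c‖ ^ 2 ≤ ((‖c‖ ^ 2)⁻¹ * I c) * ‖c‖ ^ 2 := by gcongr
        _ = I c := by field_simp
  obtain ⟨M, hM⟩ : ∃ M, ∀ x ∈ Metric.closedBall (0 : Pt n) ρ, ‖∑ i, |β i x|‖ ≤ M :=
    (isCompact_closedBall _ _).exists_bound_of_continuousOn (by fun_prop)
  refine ⟨(M ^ 2 + 1) / δ, by positivity, fun q hq x hx => ?_⟩
  set c := b.repr ⟨q, (MvPolynomial.mem_restrictTotalDegree _ _ _).2 hq⟩ with hc
  have hqc : P c = q := by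
    have := congrArg Subtype.val
      (b.sum_repr ⟨q, (MvPolynomial.mem_restrictTotalDegree _ _ _).2 hq⟩)
    simp only [Submodule.coe_sum, Submodule.coe_smul] at this
    exact this
  have h1 : |polyFun q x| ≤ ‖(c : Fin N → ℝ)‖ * M := by
    rw [← hqc, hPf]
    calc |∑ i, c i * β i x| ≤ ∑ i, |c i * β i x| := Finset.abs_sum_le_sum_abs _ _
      _ ≤ ∑ i, ‖(c : Fin N → ℝ)‖ * |β i x| := Finset.sum_le_sum fun i _ => by
          rw [abs_mul]
          exact mul_le_mul_of_nonneg_right (norm_le_pi_norm (c : Fin N → ℝ) i) (abs_nonneg _)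
      _ = ‖(c : Fin N → ℝ)‖ * ∑ i, |β i x| := by rw [Finset.mul_sum]
      _ ≤ ‖(c : Fin N → ℝ)‖ * M :=
          mul_le_mul_of_nonneg_left ((le_abs_self _).trans (hM x hx)) (norm_nonneg _)
  have h2 := hδI' c
  have h3 : I c = ∫ z in Metric.closedBall (0 : Pt n) 1, polyFun q z ^ 2 := by
    simp only [hI]; rw [hqc]
  rw [← h3]
  calc polyFun q x ^ 2 = |polyFun q x| ^ 2 := (sq_abs _).symm
    _ ≤ (‖(c : Fin N → ℝ)‖ * M) ^ 2 := by gcongr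
    _ = M ^ 2 / δ * (δ * ‖(c : Fin N → ℝ)‖ ^ 2) := by field_simp
    _ ≤ (M ^ 2 + 1) / δ * I c := by
        gcongr
        linarith

/-- Inverse inequality: the values of a polynomial on a ball are bounded by the `L²` norm on a
smaller ball. -/
lemma exists_inverse_inequality (n m : ℕ) (ρ : ℝ) :
    ∃ C : ℝ, 0 < C ∧ ∀ q : Poly n, q.totalDegree ≤ m → ∀ (y : Pt n) (r : ℝ), 0 < r →
      ∀ x ∈ Metric.closedBall y (ρ * r),
      polyFun q x ^ 2 ≤ C * ((r ^ n)⁻¹ * ∫ z in Metric.closedBall y r, polyFun q z ^ 2) := by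
  obtain ⟨C, hC, h⟩ := exists_inverse_inequality_unit n m ρ
  refine ⟨C, hC, fun q hq y r hr x hx => ?_⟩
  -- Pull-back to the unit ball by dilation and translation; the factor `(r ^ n)⁻¹` is the Jacobian.
  set A : Pt n →ᵃ[ℝ] Pt n := AffineMap.const ℝ (Pt n) y + r • AffineMap.id ℝ (Pt n) with hA
  have hAz : ∀ z, A z = y + r • z := fun z => by simp [hA]
  obtain ⟨q', hq', hqA⟩ := exists_poly_comp_affine q A
  have h1 := h q' (hq'.trans hq) (r⁻¹ • (x - y)) (by
    rw [mem_closedBall_zero_iff, norm_smul, Real.norm_eq_abs, abs_of_pos (inv_pos.2 hr)]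
    rw [Metric.mem_closedBall, dist_eq_norm] at hx
    rw [inv_mul_le_iff₀ hr]; linarith)
  rw [hqA, hAz, smul_inv_smul₀ hr.ne', add_sub_cancel] at h1
  convert h1 using 2
  simp only [hqA, hAz]
  rw [Measure.setIntegral_comp_smul_of_pos volume (fun z => polyFun q (y + z) ^ 2) _ hr,
    smul_closedBall _ _ zero_le_one, smul_zero, Real.norm_eq_abs, abs_of_pos hr, mul_one,
    finrank_euclideanSpace_fin, smul_eq_mul]
  congr 1
  have := (measurePreserving_add_left (volume : Measure (Pt n)) y).setIntegral_preimage_emb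
    (Homeomorph.addLeft y).measurableEmbedding (fun z => polyFun q z ^ 2) (Metric.closedBall y r)
  rw [← this]
  congr 2
  ext z
  simp

end Polynomials

end HDG

/-! ### Conforming interpolation and traces -/

namespace HDG

variable {d : ℕ} {Ω : Set (Pt d)}

lemma affineMap_sum_apply {ι : Type*} (s : Finset ι) (f : ι → Pt d →ᵃ[ℝ] ℝ) (x : Pt d) :
    (∑ i ∈ s, f i) x = ∑ i ∈ s, f i x := by
  classical
  induction s using Finset.induction_on with
  | empty => simp
  | insert a t ha ih => rw [Finset.sum_insert ha, Finset.sum_insert ha, ← ih]; rfl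

/-- The affine function on a simplex with prescribed values at the vertices. -/
noncomputable def affineInterp (s : Finset (Pt d)) (g : Pt d → ℝ) : Pt d →ᵃ[ℝ] ℝ :=
  ∑ v ∈ s, g v • bary s v

lemma affineInterp_apply (s : Finset (Pt d)) (g : Pt d → ℝ) (x : Pt d) :
    affineInterp s g x = ∑ v ∈ s, g v * bary s v x := by
  rw [affineInterp, affineMap_sum_apply]
  rfl

namespace SimplicialMesh

variable (T : SimplicialMesh Ω) {s t : Finset (Pt d)}

open Classical in
/-- The piecewise affine function with prescribed values at the vertices of the mesh, extended by
zero. -/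
noncomputable def interp (g : Pt d → ℝ) (x : Pt d) : ℝ :=
  if h : ∃ s ∈ T.cells, x ∈ hull s then affineInterp h.choose g x else 0

/-- At a common point only shared vertices have nonzero coordinates, and these coordinates agree.
Therefore the choice of cell in `interp` is immaterial. -/
lemma affineInterp_eq (g : Pt d → ℝ) (hs : s ∈ T.cells) (ht : t ∈ T.cells) {x : Pt d}
    (hxs : x ∈ hull s) (hxt : x ∈ hull t) : affineInterp s g x = affineInterp t g x := by
  classical
  have key : ∀ {s t : Finset (Pt d)}, s ∈ T.cells → t ∈ T.cells → x ∈ hull s → x ∈ hull t →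
      affineInterp s g x = ∑ v ∈ s ∩ t, g v * bary s v x := by
    intro s t hs ht hxs hxt
    rw [affineInterp_apply]
    refine (Finset.sum_subset Finset.inter_subset_left fun v hv hvt => ?_).symm
    have : bary s v x = 0 := by
      by_contra h
      exact hvt (Finset.mem_inter.2 ⟨hv, T.mem_of_bary_ne_zero hs ht hxs hxt hv h⟩)
    rw [this, mul_zero]
  rw [key hs ht hxs hxt, key ht hs hxt hxs, Finset.inter_comm t s]
  refine Finset.sum_congr rfl fun v hv => ?_
  rw [Finset.mem_inter] at hv
  rw [T.bary_eq_bary hs ht hxs hxt hv.1 hv.2]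

lemma interp_eq (g : Pt d → ℝ) (hs : s ∈ T.cells) {x : Pt d} (hxs : x ∈ hull s) :
    T.interp g x = affineInterp s g x := by
  have h : ∃ s ∈ T.cells, x ∈ hull s := ⟨s, hs, hxs⟩
  rw [interp, dif_pos h]
  exact T.affineInterp_eq g h.choose_spec.1 hs h.choose_spec.2 hxs

/-- At a boundary point only vertices with positive coordinate contribute, and by
`vertex_mem_frontier` these lie in the boundary, where `g` vanishes. -/
lemma interp_eq_zero (hΩ : IsOpen Ω) (hreg : interior (closure Ω) = Ω) {g : Pt d → ℝ}
    (hg : ∀ v ∈ frontier Ω, g v = 0) {x : Pt d} (hx : x ∉ Ω) : T.interp g x = 0 := by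
  by_cases h : ∃ s ∈ T.cells, x ∈ hull s
  · obtain ⟨s, hs, hxs⟩ := h
    have hs' := T.isSimplex hs
    have hxf : x ∈ frontier Ω := by
      rw [hΩ.frontier_eq]; exact ⟨T.hull_subset hs hxs, hx⟩
    rw [T.interp_eq g hs hxs, affineInterp_apply]
    refine Finset.sum_eq_zero fun v hv => ?_
    rcases (hs'.mem_hull.1 hxs v hv).eq_or_lt with h0 | hpos
    · rw [← h0, mul_zero]
    · rw [hg v (T.vertex_mem_frontier hΩ hreg hs hxf hxs hv hpos), zero_mul]
  · rw [interp, dif_neg h]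

/-- The cells and the complement of `Ω` form a finite closed cover of the whole space. -/
lemma lipschitzWith_of_cells (hΩ : IsOpen Ω) {w : Pt d → ℝ} {K : NNReal}
    (h0 : ∀ x ∉ Ω, w x = 0) (hw : ∀ s ∈ T.cells, LipschitzOnWith K w (hull s)) :
    LipschitzWith K w := by
  refine lipschitzWith_of_finite_closed_cover (ι := Option T.cells)
    (C := fun i => i.elim Ωᶜ fun s => hull s.1) ?_ ?_ ?_
  · rintro (_ | s)
    · exact hΩ.isClosed_compl
    · exact IsSimplex.isClosed_hull
  · refine eq_univ_of_forall fun x => ?_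
    by_cases hx : x ∈ Ω
    · obtain ⟨s, hs, hxs⟩ := T.exists_mem_hull (subset_closure hx)
      exact mem_iUnion.2 ⟨some ⟨s, hs⟩, hxs⟩
    · exact mem_iUnion.2 ⟨none, hx⟩
  · rintro (_ | s)
    · refine LipschitzOnWith.of_dist_le_mul fun x hx y hy => ?_
      rw [h0 x hx, h0 y hy, dist_self]
      positivity
    · exact hw s.1 s.2

lemma exists_lipschitzWith (hΩ : IsOpen Ω) {w : Pt d → ℝ} (h0 : ∀ x ∉ Ω, w x = 0)
    (haff : ∀ s ∈ T.cells, ∃ f : Pt d →ᵃ[ℝ] ℝ, ∀ x ∈ hull s, w x = f x) :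
    ∃ K, LipschitzWith K w := by
  choose! f hf using haff
  choose K hK using fun s => (f s).lipschitzWith_of_finiteDimensional
  refine ⟨∑ s ∈ T.cells, K s, T.lipschitzWith_of_cells hΩ h0 fun s hs => ?_⟩
  have h1 : LipschitzOnWith (K s) w (hull s) :=
    LipschitzOnWith.of_dist_le_mul fun x hx y hy => by
      rw [hf s hs x hx, hf s hs y hy]
      exact (hK s).dist_le_mul x y
  exact h1.weaken (Finset.single_le_sum (fun _ _ => zero_le) hs)

/-- A function that vanishes outside of the domain and is constant on every cell is zero. -/
lemma eq_zero_of_const_on_cells (hd : 1 ≤ d) (hΩ : IsOpen Ω) (hb : Bornology.IsBounded Ω)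
    {w : Pt d → ℝ} (h0 : ∀ x ∉ Ω, w x = 0)
    (hw : ∀ s ∈ T.cells, ∀ x ∈ hull s, ∀ y ∈ hull s, w x = w y) (x : Pt d) : w x = 0 := by
  have hL : LipschitzWith 0 w := T.lipschitzWith_of_cells hΩ h0 fun s hs =>
    LipschitzOnWith.of_dist_le_mul fun x hx y hy => by rw [hw s hs x hx y hy]; simp
  obtain ⟨y, hy⟩ : ∃ y, y ∉ Ω := by
    by_contra! hcon
    have : Nontrivial (Pt d) := by
      have : Nonempty (Fin d) := ⟨⟨0, hd⟩⟩
      infer_instance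
    exact NormedSpace.unbounded_univ ℝ (Pt d) (hb.subset fun x _ => hcon x)
  have := hL.dist_le_mul x y
  rw [h0 y hy] at this
  simpa using this

lemma mem_conforming (hΩ : IsOpen Ω) (hb : Bornology.IsBounded Ω) {w : Pt d → ℝ}
    (h0 : ∀ x ∉ Ω, w x = 0)
    (haff : ∀ s ∈ T.cells, ∃ f : Pt d →ᵃ[ℝ] ℝ, ∀ x ∈ hull s, w x = f x) : w ∈ T.conforming := by
  obtain ⟨K, hK⟩ := T.exists_lipschitzWith hΩ h0 haff
  refine ⟨memH10_of_lipschitzWith T hb hK h0 haff, fun s hs => ?_⟩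
  obtain ⟨f, hf⟩ := haff s hs
  obtain ⟨q, hq, hqf⟩ := exists_poly_affine f
  exact ⟨q, hq, fun x hx => by rw [hf x hx, hqf]⟩

lemma facet_mem_faces (hs : s ∈ T.cells) {v : Pt d} (hv : v ∈ s) : facet s v ∈ T.faces :=
  ⟨s, hs, v, hv, rfl⟩

lemma trace_mem_skeletal (hΩ : IsOpen Ω) {w : Pt d → ℝ} (h0 : ∀ x ∉ Ω, w x = 0)
    (haff : ∀ s ∈ T.cells, ∃ f : Pt d →ᵃ[ℝ] ℝ, ∀ x ∈ hull s, w x = f x) {p : ℕ} (hp : 1 ≤ p) :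
    T.trace w ∈ T.skeletal p := by
  refine ⟨fun F hF => ?_, fun F hF hFΩ => ?_, fun F hF => ?_⟩
  · obtain ⟨s, hs, v, hv, rfl⟩ := hF
    obtain ⟨f, hf⟩ := haff s hs
    obtain ⟨q, hq, hqf⟩ := exists_poly_affine f
    refine ⟨q, hq.trans hp, ?_⟩
    rw [trace, indicator_of_mem (T.facet_mem_faces hs hv)]
    refine indicator_congr fun x hx => ?_
    rw [hf x (IsSimplex.facet_subset hx), hqf]
  · rw [trace, indicator_of_mem hF]
    funext x
    by_cases hx : x ∈ F
    · rw [indicator_of_mem hx, h0 x (by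
        have := hFΩ hx
        rw [hΩ.frontier_eq] at this
        exact this.2)]
      rfl
    · rw [indicator_of_notMem hx]; rfl
  · rw [trace, indicator_of_notMem hF]

lemma trace_apply {w : Pt d → ℝ} (hs : s ∈ T.cells) {v x : Pt d} (hv : v ∈ s)
    (hx : x ∈ facet s v) : T.trace w (facet s v) x = w x := by
  rw [trace, indicator_of_mem (T.facet_mem_faces hs hv), indicator_of_mem hx]

/-- A cell of a refined mesh is contained in a cell of the coarse mesh. -/
lemma Refines.exists_subset {Tf Tc : SimplicialMesh Ω} (h : Tf.Refines Tc) {t : Finset (Pt d)}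
    (ht : t ∈ Tf.cells) : ∃ s ∈ Tc.cells, hull t ⊆ hull s := by
  obtain ⟨y, hy⟩ := (Tf.isSimplex ht).interior_nonempty
  obtain ⟨s, hs, hys⟩ := Tc.exists_mem_hull (Tf.hull_subset ht (interior_subset hy))
  obtain ⟨A, hA, hAs⟩ := h s hs
  have hyA := hys
  rw [hAs] at hyA
  simp only [mem_iUnion, exists_prop] at hyA
  obtain ⟨t', ht', hyt'⟩ := hyA
  -- Among the fine cells composing the coarse cell, the one containing the interior point `y` of
  -- `t` must be `t`.
  have := Tf.eq_of_mem_interior ht (hA ht') hy hyt'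
  subst this
  refine ⟨s, hs, ?_⟩
  rw [hAs]
  exact subset_biUnion_of_mem (u := fun t => hull t) ht'

end SimplicialMesh

end HDG

/-! ### Integration over facets and scaling of cells -/

namespace HDG

variable {d : ℕ} {s : Finset (Pt d)} {v : Pt d}

lemma IsSimplex.bary_linear_ne_zero (h : IsSimplex s) (hd : 1 ≤ d) (hv : v ∈ s) :
    (bary s v).linear ≠ 0 := by
  intro h0
  obtain ⟨w, hw, hwv⟩ : ∃ w ∈ s, w ≠ v := by
    refine Finset.exists_mem_ne ?_ v
    rw [h.card_eq]; omega
  have := (bary s v).linearMap_vsub v w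
  rw [h0, h.bary_self hv, h.bary_ne hv hw hwv.symm] at this
  simp at this

/-- An isometric affine parametrization of the hyperplane that contains a facet. -/
lemma IsSimplex.exists_facet_chart (h : IsSimplex s) (hd : 1 ≤ d) (hv : v ∈ s) {y : Pt d}
    (hy : bary s v y = 0) : ∃ J : Pt (d - 1) →ᵃ[ℝ] Pt d,
      Isometry J ∧ J 0 = y ∧ range J = {x | bary s v x = 0} := by
  set N := (bary s v).linear.ker with hN
  have hrank : Module.finrank ℝ N = d - 1 := by
    have h1 := LinearMap.finrank_range_add_finrank_ker (bary s v).linear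
    rw [LinearMap.range_eq_top.2 (LinearMap.surjective (h.bary_linear_ne_zero hd hv)),
      finrank_top, Module.finrank_self, finrank_euclideanSpace_fin] at h1
    have h2 : 1 + Module.finrank ℝ N = d := h1
    omega
  set b := (stdOrthonormalBasis ℝ N).reindex (finCongr hrank)
  set L : Pt (d - 1) →ₗᵢ[ℝ] Pt d := N.subtypeₗᵢ.comp b.repr.symm.toLinearIsometry with hL
  refine ⟨AffineMap.const ℝ (Pt (d - 1)) y + L.toLinearMap.toAffineMap, ?_, ?_, ?_⟩
  · have : ⇑(AffineMap.const ℝ (Pt (d - 1)) y + L.toLinearMap.toAffineMap) = fun z => y + L z := rfl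
    rw [this]
    exact (isometry_add_left y).comp L.isometry
  · change y + L 0 = y
    simp
  · ext x
    have hxy : bary s v x = (bary s v).linear (x - y) := by
      have := (bary s v).linearMap_vsub x y
      simp only [vsub_eq_sub, hy, sub_zero] at this
      exact this.symm
    constructor
    · rintro ⟨z, rfl⟩
      change bary s v (y + L z) = 0
      have hz : (bary s v).linear (L z) = 0 := (b.repr.symm z).2
      have := (bary s v).linearMap_vsub (y + L z) y
      simp only [vsub_eq_sub, add_sub_cancel_left, hy, sub_zero] at this
      rw [← this, hz]
    · intro hx
      have hx' : (bary s v).linear (x - y) = 0 := by rw [← hxy]; exact hx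
      refine ⟨b.repr ⟨x - y, hx'⟩, ?_⟩
      change y + L _ = x
      simp [hL]

lemma facetInt_congr {f g : Pt d → ℝ} (h : ∀ x ∈ facet s v, f x = g x) :
    facetInt (facet s v) f = facetInt (facet s v) g :=
  setIntegral_congr_fun IsSimplex.isCompact_facet.measurableSet h

lemma cellInt_congr {f g : Pt d → ℝ} (h : ∀ x ∈ hull s, f x = g x) :
    cellInt s f = cellInt s g :=
  setIntegral_congr_fun IsSimplex.isCompact_hull.measurableSet h

lemma facetInt_nonneg {F : Set (Pt d)} {f : Pt d → ℝ} (h : ∀ x, 0 ≤ f x) : 0 ≤ facetInt F f :=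
  integral_nonneg h

lemma cellInt_nonneg {f : Pt d → ℝ} (h : ∀ x, 0 ≤ f x) : 0 ≤ cellInt s f :=
  integral_nonneg h

lemma restrict_euclideanHausdorffMeasure {J : Pt (d - 1) → Pt d} (hJ : Isometry J)
    {F : Set (Pt d)} (hF : F ⊆ range J) :
    (Measure.euclideanHausdorffMeasure (d - 1) : Measure (Pt d)).restrict F
      = (Measure.map J volume).restrict F := by
  rw [← EuclideanSpace.euclideanHausdorffMeasure_eq_volume, hJ.map_euclideanHausdorffMeasure,
    Measure.restrict_restrict_of_subset hF]

/-- Isometries preserve the normalized Hausdorff measure, so surface integrals become Lebesgue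
integrals in `d - 1` variables. -/
lemma facetInt_eq {J : Pt (d - 1) → Pt d} (hJ : Isometry J) {F : Set (Pt d)} (hF : F ⊆ range J)
    (f : Pt d → ℝ) : facetInt F f = ∫ z in J ⁻¹' F, f (J z) := by
  rw [facetInt, restrict_euclideanHausdorffMeasure hJ hF]
  exact hJ.isClosedEmbedding.measurableEmbedding.setIntegral_map f F

namespace IsSimplex

lemma facet_subset_range (h : IsSimplex s) (hv : v ∈ s) {J : Pt (d - 1) → Pt d}
    (hJ : range J = {x | bary s v x = 0}) : facet s v ⊆ range J := by
  rw [hJ]; exact fun x hx => ((h.mem_facet hv).1 hx).2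

/-- A simplex containing a ball: its facets contain `(d-1)`-dimensional balls of the same radius. -/
lemma exists_ball_subset_facet (h : IsSimplex s) (hd : 1 ≤ d) (hv : v ∈ s) {x : Pt d} {r : ℝ}
    (hr : 0 < r) (hx : Metric.closedBall x r ⊆ hull s) :
    ∃ y ∈ facet s v, ∀ z, bary s v z = 0 → dist z y ≤ r → z ∈ facet s v := by
  have hxint : x ∈ interior (hull s) :=
    interior_mono hx (Metric.ball_subset_interior_closedBall (Metric.mem_ball_self hr))
  have hpos := h.mem_interior_hull.1 hxint
  set a := bary s v x with ha
  have ha1 : a < 1 := by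
    have h1 := h.sum_bary x
    classical
    rw [← Finset.add_sum_erase s _ hv] at h1
    have h2 : 0 < ∑ w ∈ s.erase v, bary s w x := by
      refine Finset.sum_pos (fun w hw => hpos w (Finset.mem_of_mem_erase hw)) ?_
      rw [← Finset.card_pos, Finset.card_erase_of_mem hv, h.card_eq]; omega
    linarith
  have h1a : 0 < 1 - a := by linarith
  have ha0 : 0 < a := hpos v hv
  -- The projection of `x` from `v` onto the facet plane. The homothety with centre `v` and ratio `1
  -- - a < 1` maps the `r`-ball around `y` in that plane into the `r`-ball around `x`, and
  -- multiplies the other coordinates by `1 - a`, so their signs are unchanged.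
  set y : Pt d := AffineMap.lineMap v x (1 - a)⁻¹ with hy
  have hxy : x = AffineMap.lineMap v y (1 - a) := by
    rw [hy]
    simp only [AffineMap.lineMap_apply_module]
    match_scalars <;> field_simp; ring
  have hz : ∀ z, bary s v z = 0 → dist z y ≤ r → z ∈ facet s v := by
    intro z hz0 hzr
    rw [h.mem_facet hv, h.mem_hull]
    refine ⟨fun w hw => ?_, hz0⟩
    by_cases hwv : w = v
    · rw [hwv, hz0]
    have hu : AffineMap.lineMap v z (1 - a) ∈ hull s := by
      refine hx ?_
      rw [Metric.mem_closedBall]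
      have : dist (AffineMap.lineMap v z (1 - a)) (AffineMap.lineMap v y (1 - a))
          = (1 - a) * dist z y := by
        rw [dist_eq_norm, dist_eq_norm]
        have e : (AffineMap.lineMap v z (1 - a) : Pt d) - AffineMap.lineMap v y (1 - a)
            = (1 - a) • (z - y) := by
          simp only [AffineMap.lineMap_apply_module]; module
        rw [e, norm_smul, Real.norm_eq_abs, abs_of_pos h1a]
      rw [hxy, this]
      nlinarith [dist_nonneg (x := z) (y := y)]
    have := h.mem_hull.1 hu w hw
    rw [AffineMap.apply_lineMap, AffineMap.lineMap_apply_ring, h.bary_ne hw hv hwv, mul_zero,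
      zero_add] at this
    exact nonneg_of_mul_nonneg_right this h1a
  refine ⟨y, hz y ?_ (by simpa using hr.le), hz⟩
  rw [hy, AffineMap.apply_lineMap, AffineMap.lineMap_apply_ring', h.bary_self hv, ← ha]
  field_simp; ring

lemma facet_measure_lt_top (h : IsSimplex s) (hd : 1 ≤ d) (hv : v ∈ s) {y : Pt d}
    (hy : y ∈ facet s v) :
    (Measure.euclideanHausdorffMeasure (d - 1) : Measure (Pt d)) (facet s v) < ⊤ := by
  obtain ⟨J, hJ, -, hJr⟩ := h.exists_facet_chart hd hv ((h.mem_facet hv).1 hy).2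
  rw [← Measure.restrict_apply_univ, restrict_euclideanHausdorffMeasure hJ
    (h.facet_subset_range hv hJr), Measure.restrict_apply_univ,
    hJ.isClosedEmbedding.measurableEmbedding.map_apply]
  exact (hJ.isClosedEmbedding.isCompact_preimage isCompact_facet).measure_lt_top

lemma facet_nonempty (h : IsSimplex s) (hd : 1 ≤ d) : (facet s v).Nonempty := by
  obtain ⟨w, hw, hwv⟩ : ∃ w ∈ s, w ≠ v := by
    refine Finset.exists_mem_ne ?_ v
    rw [h.card_eq]; omega
  exact ⟨w, subset_convexHull ℝ _ ⟨hw, hwv⟩⟩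

lemma integrableOn_facet (h : IsSimplex s) (hd : 1 ≤ d) (hv : v ∈ s) {f : Pt d → ℝ}
    (hf : Continuous f) :
    IntegrableOn f (facet s v) (Measure.euclideanHausdorffMeasure (d - 1)) := by
  obtain ⟨y, hy⟩ := h.facet_nonempty (v := v) hd
  obtain ⟨M, hM⟩ := (isCompact_facet (s := s) (v := v)).exists_bound_of_continuousOn hf.continuousOn
  exact Measure.integrableOn_of_bounded (h.facet_measure_lt_top hd hv hy).ne
    hf.aestronglyMeasurable
    ((ae_restrict_iff' isCompact_facet.measurableSet).2 (Eventually.of_forall hM))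

lemma integrableOn_hull {f : Pt d → ℝ} (hf : Continuous f) : IntegrableOn f (hull s) :=
  integrableOn_of_continuous hf isCompact_hull

lemma cellInt_mono {f g : Pt d → ℝ} (hf : Continuous f) (hg : Continuous g)
    (hfg : ∀ x ∈ hull s, f x ≤ g x) : cellInt s f ≤ cellInt s g :=
  setIntegral_mono_on (integrableOn_hull hf) (integrableOn_hull hg) isCompact_hull.measurableSet hfg

lemma facetInt_mono (h : IsSimplex s) (hd : 1 ≤ d) (hv : v ∈ s) {f g : Pt d → ℝ}
    (hf : Continuous f) (hg : Continuous g) (hfg : ∀ x ∈ facet s v, f x ≤ g x) :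
    facetInt (facet s v) f ≤ facetInt (facet s v) g :=
  setIntegral_mono_on (h.integrableOn_facet hd hv hf) (h.integrableOn_facet hd hv hg)
    isCompact_facet.measurableSet hfg

end IsSimplex

/-- The volume of the unit ball. -/
noncomputable def ballVol (n : ℕ) : ℝ := (volume : Measure (Pt n)).real (Metric.closedBall 0 1)

lemma ballVol_pos (n : ℕ) : 0 < ballVol n :=
  ENNReal.toReal_pos (Metric.measure_closedBall_pos _ _ one_pos).ne' measure_closedBall_lt_top.ne

lemma volume_real_closedBall {n : ℕ} (x : Pt n) {r : ℝ} (hr : 0 ≤ r) :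
    (volume : Measure (Pt n)).real (Metric.closedBall x r) = r ^ n * ballVol n := by
  have := Measure.addHaar_real_closedBall' (volume : Measure (Pt n)) x hr
  rwa [finrank_euclideanSpace_fin] at this

lemma cellInt_one : cellInt s (fun _ => 1) = volume.real (hull s) := by
  simp [cellInt]

namespace IsSimplex

variable {x : Pt d} {r h : ℝ}

lemma le_volume (hr : 0 ≤ r) (hx : Metric.closedBall x r ⊆ hull s) :
    r ^ d * ballVol d ≤ volume.real (hull s) := by
  rw [← volume_real_closedBall x hr]
  exact measureReal_mono hx isCompact_hull.measure_lt_top.ne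

lemma volume_le (hh : 0 ≤ h) (hx : hull s ⊆ Metric.closedBall x h) :
    volume.real (hull s) ≤ h ^ d * ballVol d := by
  rw [← volume_real_closedBall x hh]
  exact measureReal_mono hx measure_closedBall_lt_top.ne

lemma hull_subset_closedBall (hdiam : Metric.diam (hull s) ≤ h) (hx : x ∈ hull s) :
    hull s ⊆ Metric.closedBall x h := fun _ hy =>
  (Metric.dist_le_diam_of_mem isCompact_hull.isBounded hy hx).trans hdiam

lemma facetInt_one_le (hs : IsSimplex s) (hd : 1 ≤ d) (hv : v ∈ s) (hh : 0 ≤ h)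
    (hdiam : Metric.diam (hull s) ≤ h) :
    facetInt (facet s v) (fun _ => 1) ≤ h ^ (d - 1) * ballVol (d - 1) := by
  obtain ⟨y, hy⟩ := hs.facet_nonempty (v := v) hd
  obtain ⟨J, hJ, hJ0, hJr⟩ := hs.exists_facet_chart hd hv ((hs.mem_facet hv).1 hy).2
  rw [facetInt_eq hJ (hs.facet_subset_range hv hJr), ← volume_real_closedBall 0 hh]
  have hsub : J ⁻¹' facet s v ⊆ Metric.closedBall 0 h := by
    intro z hz
    rw [Metric.mem_closedBall, ← hJ.dist_eq, hJ0]
    exact hull_subset_closedBall hdiam (facet_subset hy) (facet_subset hz)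
  simp only [integral_const, smul_eq_mul, mul_one, measureReal_restrict_apply_univ]
  exact measureReal_mono hsub measure_closedBall_lt_top.ne

lemma facetInt_one_pos (hs : IsSimplex s) (hd : 1 ≤ d) (hv : v ∈ s) (hr : 0 < r)
    (hx : Metric.closedBall x r ⊆ hull s) : 0 < facetInt (facet s v) (fun _ => 1) := by
  obtain ⟨y, hy, hball⟩ := hs.exists_ball_subset_facet hd hv hr hx
  obtain ⟨J, hJ, hJ0, hJr⟩ := hs.exists_facet_chart hd hv ((hs.mem_facet hv).1 hy).2
  rw [facetInt_eq hJ (hs.facet_subset_range hv hJr)]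
  have hsub : Metric.closedBall 0 r ⊆ J ⁻¹' facet s v := by
    intro z hz
    refine hball _ ?_ ?_
    · have : J z ∈ range J := ⟨z, rfl⟩
      rwa [hJr] at this
    · rwa [← hJ0, hJ.dist_eq]
  simp only [integral_const, smul_eq_mul, mul_one, measureReal_restrict_apply_univ]
  refine lt_of_lt_of_le ?_ (measureReal_mono hsub
    (hJ.isClosedEmbedding.isCompact_preimage isCompact_facet).measure_lt_top.ne)
  rw [volume_real_closedBall 0 hr.le]
  have := ballVol_pos (d - 1)
  positivity

end IsSimplex

/-- Inverse inequality on a cell. -/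
lemma exists_inverse_inequality_cell (d m : ℕ) (ρ : ℝ) :
    ∃ C : ℝ, 0 < C ∧ ∀ q : Poly d, q.totalDegree ≤ m → ∀ (s : Finset (Pt d)) (x : Pt d) (r : ℝ),
      0 < r → Metric.closedBall x r ⊆ hull s → Metric.diam (hull s) ≤ ρ * r →
      ∀ y ∈ hull s, polyFun q y ^ 2 ≤ C * ((r ^ d)⁻¹ * cellInt s fun z => polyFun q z ^ 2) := by
  obtain ⟨C, hC, h⟩ := exists_inverse_inequality d m ρ
  refine ⟨C, hC, fun q hq s x r hr hx hdiam y hy => ?_⟩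
  have hxs : x ∈ hull s := hx (Metric.mem_closedBall_self hr.le)
  refine (h q hq x r hr y (IsSimplex.hull_subset_closedBall hdiam hxs hy)).trans ?_
  refine mul_le_mul_of_nonneg_left (mul_le_mul_of_nonneg_left ?_ (by positivity)) hC.le
  refine setIntegral_mono_set (IsSimplex.integrableOn_hull ((continuous_polyFun q).pow 2))
    (Eventually.of_forall fun _ => sq_nonneg _) (Eventually.of_forall hx)

/-- Inverse inequality on a facet. -/
lemma exists_inverse_inequality_facet (d m : ℕ) (hd : 1 ≤ d) (ρ : ℝ) :
    ∃ C : ℝ, 0 < C ∧ ∀ q : Poly d, q.totalDegree ≤ m → ∀ (s : Finset (Pt d)), IsSimplex s →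
      ∀ v ∈ s, ∀ (x : Pt d) (r : ℝ),
      0 < r → Metric.closedBall x r ⊆ hull s → Metric.diam (hull s) ≤ ρ * r →
      ∀ y ∈ facet s v, polyFun q y ^ 2
        ≤ C * ((r ^ (d - 1))⁻¹ * facetInt (facet s v) fun z => polyFun q z ^ 2) := by
  obtain ⟨C, hC, h⟩ := exists_inverse_inequality (d - 1) m ρ
  refine ⟨C, hC, fun q hq s hs v hv x r hr hx hdiam y hy => ?_⟩
  obtain ⟨y0, hy0, hball⟩ := hs.exists_ball_subset_facet hd hv hr hx
  obtain ⟨J, hJ, hJ0, hJr⟩ := hs.exists_facet_chart hd hv ((hs.mem_facet hv).1 hy0).2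
  obtain ⟨q', hq', hqJ⟩ := exists_poly_comp_affine q J
  have hFr := hs.facet_subset_range hv hJr
  rw [facetInt_eq hJ hFr]
  obtain ⟨z, rfl⟩ := hFr hy
  have hz : z ∈ Metric.closedBall (0 : Pt (d - 1)) (ρ * r) := by
    rw [Metric.mem_closedBall, ← hJ.dist_eq, hJ0]
    exact IsSimplex.hull_subset_closedBall hdiam (IsSimplex.facet_subset hy0)
      (IsSimplex.facet_subset hy)
  have h1 := h q' (hq'.trans hq) 0 r hr z hz
  rw [hqJ] at h1
  refine h1.trans ?_
  have hsub : Metric.closedBall 0 r ⊆ J ⁻¹' facet s v := by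
    intro z hz
    refine hball _ ?_ ?_
    · have : J z ∈ range J := ⟨z, rfl⟩
      rwa [hJr] at this
    · rwa [← hJ0, hJ.dist_eq]
  simp only [← hqJ]
  refine mul_le_mul_of_nonneg_left (mul_le_mul_of_nonneg_left ?_ (by positivity)) hC.le
  refine setIntegral_mono_set (integrableOn_of_continuous ((continuous_polyFun q').pow 2)
    (hJ.isClosedEmbedding.isCompact_preimage IsSimplex.isCompact_facet))
    (Eventually.of_forall fun _ => sq_nonneg _) (Eventually.of_forall hsub)

end HDG

/-! ### Linearity of the local solvers and the condensed form -/

namespace HDG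

variable {d : ℕ} {Ω : Set (Pt d)} {s : Finset (Pt d)} {v : Pt d}

lemma cellInt_lin {f g : Pt d → ℝ} (hf : Continuous f) (hg : Continuous g) (c : ℝ) :
    cellInt s (fun x => c * f x + g x) = c * cellInt s f + cellInt s g := by
  rw [cellInt, integral_add ((IsSimplex.integrableOn_hull hf).const_mul c)
    (IsSimplex.integrableOn_hull hg), integral_const_mul]
  rfl

lemma facetInt_lin (hs : IsSimplex s) (hd : 1 ≤ d) (hv : v ∈ s) {f g : Pt d → ℝ}
    (hf : Continuous f) (hg : Continuous g) (c : ℝ) :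
    facetInt (facet s v) (fun x => c * f x + g x)
      = c * facetInt (facet s v) f + facetInt (facet s v) g := by
  rw [facetInt, integral_add ((hs.integrableOn_facet hd hv hf).const_mul c)
    (hs.integrableOn_facet hd hv hg), integral_const_mul]
  rfl

namespace SimplicialMesh

variable (T : SimplicialMesh Ω) {p : ℕ}

lemma exists_poly_of_mem_skeletal {μ : Set (Pt d) → Pt d → ℝ} (hμ : μ ∈ T.skeletal p)
    (hs : s ∈ T.cells) (hv : v ∈ s) : ∃ q : Poly d, q.totalDegree ≤ p ∧
      μ (facet s v) = (facet s v).indicator (polyFun q) :=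
  hμ.1 _ (T.facet_mem_faces hs hv)

lemma finite_faces : T.faces.Finite := by
  have : T.faces = ⋃ s ∈ T.cells, (facet s) '' (s : Set (Pt d)) := by
    ext F
    simp only [faces, mem_ofPred_eq, mem_iUnion, mem_image, exists_prop, Finset.mem_coe, eq_comm]
  rw [this]
  exact T.cells.finite_toSet.biUnion fun s _ => s.finite_toSet.image _

instance finiteDimensional_skeletal : FiniteDimensional ℝ (T.skeletal p) := by
  classical
  have : Finite T.faces := T.finite_faces
  let Φ : (T.faces → MvPolynomial.restrictTotalDegree (Fin d) ℝ p) →ₗ[ℝ]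
      (Set (Pt d) → Pt d → ℝ) :=
    { toFun := fun c F => if h : F ∈ T.faces then F.indicator (polyFun (c ⟨F, h⟩ : Poly d)) else 0
      map_add' := fun a b => by
        funext F x
        by_cases h : F ∈ T.faces <;> by_cases hx : x ∈ F <;> simp [h, hx, polyFun]
      map_smul' := fun c a => by
        funext F x
        by_cases h : F ∈ T.faces <;> by_cases hx : x ∈ F <;> simp [h, hx, polyFun] }
  have hle : T.skeletal p ≤ Φ.range := by
    rintro μ ⟨h1, -, h3⟩
    choose! q hq hqμ using h1
    refine ⟨fun F => ⟨q F, (MvPolynomial.mem_restrictTotalDegree _ _ _).2 (hq F F.2)⟩, ?_⟩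
    funext F
    by_cases h : F ∈ T.faces
    · simp [Φ, h, hqμ F h]
    · simp [Φ, h, h3 F h]
  exact Submodule.finiteDimensional_of_le hle

end SimplicialMesh

namespace Method

variable {k p : ℕ} {T : SimplicialMesh Ω} {S : Method k T} {μ ν η : Set (Pt d) → Pt d → ℝ}

lemma WellPosed.isLocalSolution (hS : S.WellPosed p) (hμ : μ ∈ T.skeletal p) (hs : s ∈ T.cells) :
    S.IsLocalSolution μ s (S.U μ s, S.Q μ s) := by
  have := Classical.epsilon_spec (hS μ hμ s hs).exists
  exact this

/-- Superposition: both local equations are linear in the pair of data and solution. Uniqueness then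
makes the solvers, although defined by `Classical.epsilon`, linear in the data. -/
lemma IsLocalSolution.lin (hd : 1 ≤ d) (hμ : μ ∈ T.skeletal p) (hν : ν ∈ T.skeletal p)
    (hs : s ∈ T.cells) {a b : Poly d × (Fin d → Poly d)} (ha : S.IsLocalSolution μ s a)
    (hb : S.IsLocalSolution ν s b) (c : ℝ) :
    S.IsLocalSolution (c • μ + ν) s (c • a + b) := by
  have hs' := T.isSimplex hs
  have hp : ∀ q : Poly d, Continuous (polyFun q) := continuous_polyFun
  obtain ⟨ha1, ha2, ha3, ha4⟩ := ha
  obtain ⟨hb1, hb2, hb3, hb4⟩ := hb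
  -- On a facet, skeletal functions are replaced by their polynomials, which are continuous and
  -- hence integrable.
  have hfac : ∀ (g : Pt d → Pt d → ℝ), (∀ v, Continuous (g v)) →
      ∑ v ∈ s, facetInt (facet s v) (fun x => (c • μ + ν) (facet s v) x * g v x)
        = c * ∑ v ∈ s, facetInt (facet s v) (fun x => μ (facet s v) x * g v x)
          + ∑ v ∈ s, facetInt (facet s v) (fun x => ν (facet s v) x * g v x) := by
    intro g hg
    rw [Finset.mul_sum, ← Finset.sum_add_distrib]
    refine Finset.sum_congr rfl fun v hv => ?_
    obtain ⟨q, -, hq⟩ := T.exists_poly_of_mem_skeletal hμ hs hv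
    obtain ⟨r, -, hr⟩ := T.exists_poly_of_mem_skeletal hν hs hv
    have hg' := hg v
    rw [facetInt_congr (g := fun x => c * (polyFun q x * g v x) + polyFun r x * g v x),
      facetInt_congr (f := fun x => μ (facet s v) x * g v x) (g := fun x => polyFun q x * g v x),
      facetInt_congr (f := fun x => ν (facet s v) x * g v x) (g := fun x => polyFun r x * g v x),
      facetInt_lin hs' hd hv (by fun_prop) (by fun_prop)]
    · intro x hx; rw [hr, indicator_of_mem hx]
    · intro x hx; rw [hq, indicator_of_mem hx]
    · intro x hx
      simp only [Pi.add_apply, Pi.smul_apply, smul_eq_mul]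
      rw [hr, hq, indicator_of_mem hx, indicator_of_mem hx]
      ring
  refine ⟨Submodule.add_mem _ (Submodule.smul_mem _ _ ha1) hb1,
    Submodule.add_mem _ (Submodule.smul_mem _ _ ha2) hb2, fun w hw => ?_, fun z hz => ?_⟩
  · rw [hfac (fun v x => ∑ i, polyFun (w i) x * outwardNormal s v i) (fun v => by fun_prop)]
    have e1 := ha3 w hw
    have e2 := hb3 w hw
    have e3 : cellInt s (fun x => ∑ i, polyFun ((c • a + b).2 i) x * polyFun (w i) x)
        = c * cellInt s (fun x => ∑ i, polyFun (a.2 i) x * polyFun (w i) x)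
          + cellInt s (fun x => ∑ i, polyFun (b.2 i) x * polyFun (w i) x) := by
      rw [← cellInt_lin (by fun_prop) (by fun_prop)]
      refine cellInt_congr fun x _ => ?_
      rw [Finset.mul_sum, ← Finset.sum_add_distrib]
      refine Finset.sum_congr rfl fun i _ => ?_
      simp only [Prod.snd_add, Prod.smul_snd, Pi.add_apply, Pi.smul_apply, polyFun_add,
        polyFun_smul]
      ring
    have e4 : cellInt s (fun x => polyFun (c • a + b).1 x *
          ∑ i, polyFun (MvPolynomial.pderiv i (w i)) x)
        = c * cellInt s (fun x => polyFun a.1 x * ∑ i, polyFun (MvPolynomial.pderiv i (w i)) x)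
          + cellInt s (fun x => polyFun b.1 x *
            ∑ i, polyFun (MvPolynomial.pderiv i (w i)) x) := by
      rw [← cellInt_lin (by fun_prop) (by fun_prop)]
      refine cellInt_congr fun x _ => ?_
      simp only [Prod.fst_add, Prod.smul_fst, polyFun_add, polyFun_smul]
      ring
    rw [e3, e4]
    linear_combination c * e1 + e2
  · rw [hfac (fun v x => polyFun z x) (fun v => by fun_prop)]
    have e1 := ha4 z hz
    have e2 := hb4 z hz
    have e3 : ∑ v ∈ s, facetInt (facet s v) (fun x => ((∑ i, polyFun ((c • a + b).2 i) x *
          outwardNormal s v i) + S.τ * polyFun (c • a + b).1 x) * polyFun z x)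
        = c * ∑ v ∈ s, facetInt (facet s v) (fun x => ((∑ i, polyFun (a.2 i) x *
            outwardNormal s v i) + S.τ * polyFun a.1 x) * polyFun z x)
          + ∑ v ∈ s, facetInt (facet s v) (fun x => ((∑ i, polyFun (b.2 i) x *
            outwardNormal s v i) + S.τ * polyFun b.1 x) * polyFun z x) := by
      rw [Finset.mul_sum, ← Finset.sum_add_distrib]
      refine Finset.sum_congr rfl fun v hv => ?_
      rw [← facetInt_lin hs' hd hv (by fun_prop) (by fun_prop)]
      refine facetInt_congr fun x _ => ?_
      simp only [Prod.snd_add, Prod.smul_snd, Prod.fst_add, Prod.smul_fst, Pi.add_apply,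
        Pi.smul_apply, polyFun_add, polyFun_smul, add_mul, Finset.sum_add_distrib, mul_assoc,
        ← Finset.mul_sum]
      ring
    have e4 : cellInt s (fun x => ∑ i, polyFun ((c • a + b).2 i) x *
          polyFun (MvPolynomial.pderiv i z) x)
        = c * cellInt s (fun x => ∑ i, polyFun (a.2 i) x * polyFun (MvPolynomial.pderiv i z) x)
          + cellInt s (fun x => ∑ i, polyFun (b.2 i) x * polyFun (MvPolynomial.pderiv i z) x) := by
      rw [← cellInt_lin (by fun_prop) (by fun_prop)]
      refine cellInt_congr fun x _ => ?_
      rw [Finset.mul_sum, ← Finset.sum_add_distrib]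
      refine Finset.sum_congr rfl fun i _ => ?_
      simp only [Prod.snd_add, Prod.smul_snd, Pi.add_apply, Pi.smul_apply, polyFun_add,
        polyFun_smul]
      ring
    rw [e3, e4]
    linear_combination c * e1 + e2

lemma WellPosed.lin (hS : S.WellPosed p) (hd : 1 ≤ d) (hμ : μ ∈ T.skeletal p)
    (hν : ν ∈ T.skeletal p) (hs : s ∈ T.cells) (c : ℝ) :
    S.U (c • μ + ν) s = c • S.U μ s + S.U ν s ∧ S.Q (c • μ + ν) s = c • S.Q μ s + S.Q ν s := by
  have hm : c • μ + ν ∈ T.skeletal p := Submodule.add_mem _ (Submodule.smul_mem _ _ hμ) hν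
  have h := (hS _ hm s hs).unique (hS.isLocalSolution hm hs)
    ((hS.isLocalSolution hμ hs).lin hd hμ hν hs (hS.isLocalSolution hν hs) c)
  exact ⟨congrArg Prod.fst h, congrArg Prod.snd h⟩

/-- The function `U μ - μ` on a facet is a polynomial. -/
lemma exists_poly_trace_error (hμ : μ ∈ T.skeletal p) (hs : s ∈ T.cells) (hv : v ∈ s)
    {q : Poly d} (hq : q.totalDegree ≤ k) : ∃ r : Poly d, r.totalDegree ≤ max k p ∧
      ∀ x ∈ facet s v, polyFun q x - μ (facet s v) x = polyFun r x := by
  obtain ⟨q', hq', hμq⟩ := T.exists_poly_of_mem_skeletal hμ hs hv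
  refine ⟨q - q', (MvPolynomial.totalDegree_sub _ _).trans (max_le_max hq hq'), fun x hx => ?_⟩
  rw [hμq, indicator_of_mem hx, polyFun_sub]

lemma energyForm_comm (μ ν : Set (Pt d) → Pt d → ℝ) : S.energyForm μ ν = S.energyForm ν μ := by
  rw [energyForm, energyForm]
  simp only [mul_comm, mul_left_comm, mul_assoc]

lemma energyForm_self_nonneg (μ : Set (Pt d) → Pt d → ℝ) : 0 ≤ S.energyForm μ μ := by
  refine add_nonneg (Finset.sum_nonneg fun s _ => cellInt_nonneg fun x =>
    Finset.sum_nonneg fun i _ => mul_self_nonneg _)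
    (Finset.sum_nonneg fun s _ => Finset.sum_nonneg fun v _ => facetInt_nonneg fun x => ?_)
  rw [mul_assoc]
  exact mul_nonneg S.τ_nonneg (mul_self_nonneg _)

lemma WellPosed.energyForm_lin (hS : S.WellPosed p) (hd : 1 ≤ d) (hμ : μ ∈ T.skeletal p)
    (hν : ν ∈ T.skeletal p) (hη : η ∈ T.skeletal p) (c : ℝ) :
    S.energyForm (c • μ + ν) η = c * S.energyForm μ η + S.energyForm ν η := by
  have hp : ∀ q : Poly d, Continuous (polyFun q) := continuous_polyFun
  rw [energyForm, energyForm, energyForm]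
  have e1 : ∑ s ∈ T.cells, cellInt s (fun x => ∑ i, polyFun (S.Q (c • μ + ν) s i) x *
        polyFun (S.Q η s i) x)
      = c * ∑ s ∈ T.cells, cellInt s (fun x => ∑ i, polyFun (S.Q μ s i) x * polyFun (S.Q η s i) x)
        + ∑ s ∈ T.cells, cellInt s (fun x => ∑ i, polyFun (S.Q ν s i) x *
          polyFun (S.Q η s i) x) := by
    rw [Finset.mul_sum, ← Finset.sum_add_distrib]
    refine Finset.sum_congr rfl fun s hs => ?_
    rw [← cellInt_lin (by fun_prop) (by fun_prop)]
    refine cellInt_congr fun x _ => ?_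
    rw [Finset.mul_sum, ← Finset.sum_add_distrib]
    refine Finset.sum_congr rfl fun i _ => ?_
    rw [(hS.lin hd hμ hν hs c).2]
    simp only [Pi.add_apply, Pi.smul_apply, polyFun_add, polyFun_smul]
    ring
  have e2 : ∑ s ∈ T.cells, ∑ v ∈ s, facetInt (facet s v) (fun x =>
        S.τ * (polyFun (S.U (c • μ + ν) s) x - (c • μ + ν) (facet s v) x) *
          (polyFun (S.U η s) x - η (facet s v) x))
      = c * ∑ s ∈ T.cells, ∑ v ∈ s, facetInt (facet s v) (fun x =>
          S.τ * (polyFun (S.U μ s) x - μ (facet s v) x) *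
            (polyFun (S.U η s) x - η (facet s v) x))
        + ∑ s ∈ T.cells, ∑ v ∈ s, facetInt (facet s v) (fun x =>
          S.τ * (polyFun (S.U ν s) x - ν (facet s v) x) *
            (polyFun (S.U η s) x - η (facet s v) x)) := by
    rw [Finset.mul_sum, ← Finset.sum_add_distrib]
    refine Finset.sum_congr rfl fun s hs => ?_
    rw [Finset.mul_sum, ← Finset.sum_add_distrib]
    refine Finset.sum_congr rfl fun v hv => ?_
    have hdeg : ∀ {ξ}, ξ ∈ T.skeletal p → (S.U ξ s).totalDegree ≤ k := fun hξ =>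
      S.V_degree s hs _ (hS.isLocalSolution hξ hs).1
    obtain ⟨a, -, ha⟩ := exists_poly_trace_error hμ hs hv (hdeg hμ)
    obtain ⟨b, -, hb⟩ := exists_poly_trace_error hν hs hv (hdeg hν)
    obtain ⟨e, -, he⟩ := exists_poly_trace_error hη hs hv (hdeg hη)
    rw [facetInt_congr (f := fun x => S.τ * (polyFun (S.U μ s) x - μ (facet s v) x) *
        (polyFun (S.U η s) x - η (facet s v) x)) (g := fun x => S.τ * polyFun a x * polyFun e x)
        (fun x hx => by rw [ha x hx, he x hx]),
      facetInt_congr (f := fun x => S.τ * (polyFun (S.U ν s) x - ν (facet s v) x) *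
        (polyFun (S.U η s) x - η (facet s v) x)) (g := fun x => S.τ * polyFun b x * polyFun e x)
        (fun x hx => by rw [hb x hx, he x hx]),
      ← facetInt_lin (T.isSimplex hs) hd hv (by fun_prop) (by fun_prop)]
    refine facetInt_congr fun x hx => ?_
    rw [he x hx, ← ha x hx, ← hb x hx, (hS.lin hd hμ hν hs c).1]
    simp only [Pi.add_apply, Pi.smul_apply, polyFun_add, polyFun_smul, smul_eq_mul]
    ring
  rw [e1, e2]
  ring

/-- The condensed bilinear form on the skeletal space. -/
noncomputable def WellPosed.form (hS : S.WellPosed p) (hd : 1 ≤ d) :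
    LinearMap.BilinForm ℝ (T.skeletal p) :=
  LinearMap.mk₂ ℝ (fun μ ν => S.energyForm μ.1 ν.1)
    (fun a b c => by
      have := hS.energyForm_lin hd a.2 b.2 c.2 1
      simpa using this)
    (fun r a b => by
      -- Homogeneity needs that the form vanishes at zero, which additivity at `0 + 0` supplies.
      have h0 := hS.energyForm_lin hd (Submodule.zero_mem _) (Submodule.zero_mem _) b.2 1
      have := hS.energyForm_lin hd a.2 (Submodule.zero_mem _) b.2 r
      simp only [smul_zero, add_zero, one_mul] at h0 this
      simp only [Submodule.coe_smul, smul_eq_mul]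
      linarith)
    (fun a b c => by
      have := hS.energyForm_lin hd b.2 c.2 a.2 1
      simp only [energyForm_comm a.1]
      simpa using this)
    (fun r a b => by
      have h0 := hS.energyForm_lin hd (Submodule.zero_mem _) (Submodule.zero_mem _) a.2 1
      have := hS.energyForm_lin hd b.2 (Submodule.zero_mem _) a.2 r
      simp only [smul_zero, add_zero, one_mul] at h0 this
      simp only [Submodule.coe_smul, smul_eq_mul, energyForm_comm a.1]
      linarith)

lemma WellPosed.form_apply (hS : S.WellPosed p) (hd : 1 ≤ d) (μ ν : T.skeletal p) :
    hS.form hd μ ν = S.energyForm μ.1 ν.1 := rfl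

end Method

/-! ### The abstract Ritz quasi-projection -/

/-- The abstract Ritz quasi-projection: existence, uniqueness and stability. -/
lemma exists_unique_ritz_and_le {V W : Type*} [AddCommGroup V] [Module ℝ V]
    [FiniteDimensional ℝ V] [AddCommGroup W] [Module ℝ W] (a : LinearMap.BilinForm ℝ V)
    (b : LinearMap.BilinForm ℝ W) (ha : ∀ x, 0 ≤ a x x) (ha0 : ∀ x, a x x = 0 → x = 0)
    (hb : ∀ x, 0 ≤ b x x) (hbs : ∀ x y, b x y = b y x) (I : V →ₗ[ℝ] W) {C : ℝ} (hC : 0 ≤ C)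
    (hI : ∀ x, √(b (I x) (I x)) ≤ C * √(a x x)) (μ : W) :
    (∃! ν, ∀ η, a ν η = b μ (I η)) ∧
      ∀ ν, (∀ η, a ν η = b μ (I η)) → √(b (μ - I ν) (μ - I ν)) ≤ (1 + C ^ 2) * √(b μ μ) := by
  have hinj : Function.Injective a := by
    rw [injective_iff_map_eq_zero]
    intro x hx
    exact ha0 x (by rw [hx]; rfl)
  -- A definite form embeds `V` into its dual; the dimensions agree.
  have hsurj : Function.Surjective a :=
    (LinearMap.injective_iff_surjective_of_finrank_eq_finrank (by simp)).1 hinj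
  -- Cauchy–Schwarz and the triangle inequality need only semidefiniteness, so `b` is not required
  -- to be definite.
  have hcs : ∀ x y, |b x y| ≤ √(b x x) * √(b y y) := fun x y => by
    rw [← Real.sqrt_mul (hb x), ← Real.sqrt_sq_eq_abs]
    exact Real.sqrt_le_sqrt (LinearMap.BilinForm.apply_sq_le_of_symm b hb ⟨hbs⟩ x y)
  have htri : ∀ x y, √(b (x - y) (x - y)) ≤ √(b x x) + √(b y y) := fun x y => by
    refine Real.sqrt_le_iff.2 ⟨by positivity, ?_⟩
    have h1 := (abs_le.1 (hcs x y)).1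
    have h2 := Real.sq_sqrt (hb x)
    have h3 := Real.sq_sqrt (hb y)
    simp only [map_sub, LinearMap.sub_apply]
    rw [hbs y x]
    nlinarith
  constructor
  · obtain ⟨ν, hν⟩ := hsurj ((b μ).comp I)
    refine ⟨ν, fun η => by rw [hν]; rfl, fun ν' hν' => hinj ?_⟩
    ext η
    rw [hν, hν']; rfl
  · intro ν hν
    have h1 : √(a ν ν) ≤ C * √(b μ μ) := by
      rcases (Real.sqrt_nonneg (a ν ν)).eq_or_lt with h0 | hpos
      · rw [← h0]; positivity
      · have h2 : √(a ν ν) * √(a ν ν) ≤ (C * √(b μ μ)) * √(a ν ν) := by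
          calc √(a ν ν) * √(a ν ν) = b μ (I ν) := by rw [Real.mul_self_sqrt (ha ν), hν ν]
            _ ≤ √(b μ μ) * √(b (I ν) (I ν)) := (le_abs_self _).trans (hcs _ _)
            _ ≤ √(b μ μ) * (C * √(a ν ν)) := by gcongr; exact hI ν
            _ = (C * √(b μ μ)) * √(a ν ν) := by ring
        exact le_of_mul_le_mul_right h2 hpos
    calc √(b (μ - I ν) (μ - I ν)) ≤ √(b μ μ) + √(b (I ν) (I ν)) := htri _ _
      _ ≤ √(b μ μ) + C * (C * √(b μ μ)) := by
          gcongr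
          exact (hI ν).trans (mul_le_mul_of_nonneg_left h1 hC)
      _ = (1 + C ^ 2) * √(b μ μ) := by ring

end HDG

/-! ### Quasi-interpolation by averaging over vertex stars -/

namespace HDG

section PolynomialDerivatives

variable {n : ℕ}

lemma totalDegree_pderiv_le (i : Fin n) (q : Poly n) :
    (MvPolynomial.pderiv i q).totalDegree ≤ q.totalDegree := by
  conv_lhs => rw [q.as_sum, map_sum]
  refine MvPolynomial.totalDegree_finsetSum_le fun e he => ?_
  rw [MvPolynomial.pderiv_monomial]
  refine (MvPolynomial.totalDegree_monomial_le _ _).trans ?_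
  refine le_trans ?_ (MvPolynomial.le_totalDegree he)
  rw [Finsupp.sum_fintype _ _ fun _ => rfl, Finsupp.sum_fintype _ _ fun _ => rfl]
  refine Finset.sum_le_sum fun j _ => ?_
  simp

lemma hasDerivAt_polyFun_line (q : Poly n) (x v : Pt n) (t : ℝ) :
    HasDerivAt (fun t : ℝ => polyFun q (x + t • v))
      (∑ i, v i * polyFun (MvPolynomial.pderiv i q) (x + t • v)) t := by
  induction q using MvPolynomial.induction_on with
  | C a => simpa [polyFun] using hasDerivAt_const t a
  | add q r hq hr =>
    simp only [polyFun_add, map_add, mul_add, Finset.sum_add_distrib]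
    exact hq.add hr
  | mul_X q j hq =>
    have hX : HasDerivAt (fun t : ℝ => x j + t * v j) (v j) t := by
      simpa using ((hasDerivAt_id t).mul_const (v j)).const_add (x j)
    have h := hq.mul hX
    have e1 : (fun t : ℝ => polyFun (q * MvPolynomial.X j) (x + t • v))
        = fun t => polyFun q (x + t • v) * (x j + t * v j) := by
      funext t; simp [polyFun]
    rw [e1]
    refine h.congr_deriv ?_
    have e2 : ∀ i, v i * polyFun (MvPolynomial.pderiv i (q * MvPolynomial.X j)) (x + t • v)
        = v i * polyFun (MvPolynomial.pderiv i q) (x + t • v) * (x j + t * v j)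
          + if i = j then v j * polyFun q (x + t • v) else 0 := by
      intro i
      rw [MvPolynomial.pderiv_mul]
      by_cases hij : i = j
      · subst hij
        simp [polyFun]; ring
      · simp [polyFun, hij, MvPolynomial.pderiv_X_of_ne (Ne.symm hij)]; ring
    rw [Finset.sum_congr rfl fun i _ => e2 i, Finset.sum_add_distrib, Finset.sum_mul]
    simp [mul_comm]

/-- Mean value inequality for polynomials on convex sets. -/
lemma abs_polyFun_sub_le (q : Poly n) {s : Set (Pt n)} (hs : Convex ℝ s) {M : ℝ} (hM : 0 ≤ M)
    (h : ∀ x ∈ s, ∑ i, polyFun (MvPolynomial.pderiv i q) x ^ 2 ≤ M ^ 2) {x y : Pt n}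
    (hx : x ∈ s) (hy : y ∈ s) : |polyFun q y - polyFun q x| ≤ M * dist y x := by
  have hbound : ∀ t ∈ Ico (0 : ℝ) 1,
      ‖∑ i, (y - x) i * polyFun (MvPolynomial.pderiv i q) (x + t • (y - x))‖ ≤ M * dist y x := by
    intro t ht
    have hmem : x + t • (y - x) ∈ s := hs.add_smul_sub_mem hx hy ⟨ht.1, ht.2.le⟩
    rw [Real.norm_eq_abs]
    refine abs_le_of_sq_le_sq ?_ (mul_nonneg hM dist_nonneg)
    refine (Finset.sum_mul_sq_le_sq_mul_sq _ _ _).trans ?_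
    have e : ∑ i, (y - x) i ^ 2 = dist y x ^ 2 := by
      rw [dist_eq_norm, EuclideanSpace.real_norm_sq_eq]
    rw [e, mul_pow, mul_comm]
    gcongr
    exact h _ hmem
  have := norm_image_sub_le_of_norm_deriv_le_segment_01'
    (f := fun t : ℝ => polyFun q (x + t • (y - x)))
    (fun t _ => (hasDerivAt_polyFun_line q x (y - x) t).hasDerivWithinAt) hbound
  simpa using this

end PolynomialDerivatives

/-- If neighbouring values differ by at most the sum of weights, then the values at connected
vertices differ by at most twice the total weight. -/
lemma abs_sub_le_of_reachable {V : Type*} [Fintype V] {G : SimpleGraph V} {a E : V → ℝ}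
    (hE : ∀ x, 0 ≤ E x) (hadj : ∀ u v, G.Adj u v → |a u - a v| ≤ E u + E v) {u v : V}
    (h : G.Reachable u v) : |a u - a v| ≤ 2 * ∑ x, E x := by
  classical
  have hwalk : ∀ {u v : V} (p : G.Walk u v),
      |a u - a v| ≤ 2 * (p.support.map E).sum - E u - E v := by
    intro u v p
    induction p with
    | nil => simp; linarith
    | @cons x y z hxy p ih =>
      have h1 := hadj x y hxy
      have h2 := abs_sub_le (a x) (a y) (a z)
      simp only [SimpleGraph.Walk.support_cons, List.map_cons, List.sum_cons]
      linarith
  -- A path visits every vertex at most once, so the weights along it sum to at most the total.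
  obtain ⟨p, hp⟩ := h.exists_isPath
  have h1 := hwalk p
  have h2 : (p.support.map E).sum ≤ ∑ x, E x := by
    rw [← List.sum_toFinset E hp.support_nodup]
    exact Finset.sum_le_sum_of_subset_of_nonneg (Finset.subset_univ _) fun x _ _ => hE x
  have h3 := hE u
  have h4 := hE v
  linarith

variable {d : ℕ} {Ω : Set (Pt d)}

namespace SimplicialMesh

variable (T : SimplicialMesh Ω) {s t : Finset (Pt d)}

open Classical in
/-- The cells that share a vertex with the cell `s`. -/
noncomputable def neighbours (s : Finset (Pt d)) : Finset (Finset (Pt d)) :=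
  T.cells.filter fun t => (s ∩ t).Nonempty

lemma mem_neighbours : t ∈ T.neighbours s ↔ t ∈ T.cells ∧ ∃ x ∈ s, x ∈ t := by
  classical
  simp [neighbours, Finset.Nonempty]

lemma self_mem_neighbours (hs : s ∈ T.cells) : s ∈ T.neighbours s := by
  obtain ⟨x, hx⟩ := (T.isSimplex hs).nonempty
  exact T.mem_neighbours.2 ⟨hs, x, hx, hx⟩

/-- By counting, `t` has exactly one vertex outside `s`, and removing it leaves the vertices of `s`
other than `v`. This is how the single value of `μ` on the facet is compared with both cells. -/
lemma exists_facet_eq (hs : s ∈ T.cells) (ht : t ∈ T.cells) (hst : t ≠ s) {v : Pt d}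
    (hv : v ∈ s) (hsub : ∀ w ∈ s, w ≠ v → w ∈ t) : ∃ v' ∈ t, facet t v' = facet s v := by
  classical
  have hs' := T.isSimplex hs
  have ht' := T.isSimplex ht
  obtain ⟨v', hv't, hv's⟩ : ∃ v' ∈ t, v' ∉ s := by
    by_contra! hcon
    exact hst (ht'.eq_of_subset hs' hcon)
  have hsubset : s.erase v ⊆ t.erase v' := by
    intro w hw
    rw [Finset.mem_erase] at hw ⊢
    exact ⟨fun h => hv's (h ▸ hw.2), hsub w hw.2 hw.1⟩
  have heq := Finset.eq_of_subset_of_card_le hsubset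
    (by rw [Finset.card_erase_of_mem hv't, Finset.card_erase_of_mem hv, hs'.card_eq, ht'.card_eq])
  refine ⟨v', hv't, ?_⟩
  rw [facet, facet, ← Finset.coe_erase, ← Finset.coe_erase, heq]

/-- At every vertex, a cell value differs from a suitable vertex value (which vanishes on the
boundary) by the oscillations and jumps in the cells around the vertex. -/
lemma exists_vertex_values (hd : 1 ≤ d) (hΩ : IsLipschitzDomain Ω) {p : ℕ}
    {μ : Set (Pt d) → Pt d → ℝ} (hμ : μ ∈ T.skeletal p) (u : Finset (Pt d) → Pt d → ℝ)
    {E : Finset (Pt d) → ℝ} (hE : ∀ s, 0 ≤ E s)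
    (hjump : ∀ s ∈ T.cells, ∀ v ∈ s, ∀ y ∈ facet s v, |u s y - μ (facet s v) y| ≤ E s) :
    ∃ g : Pt d → ℝ, (∀ x ∈ frontier Ω, g x = 0) ∧
      ∀ s ∈ T.cells, ∀ x ∈ s, |u s x - g x| ≤ 3 * ∑ t ∈ T.neighbours s, E t := by
  classical
  -- An arbitrary cell at `x` supplies the value; all cells of the star give nearly the same one.
  set g : Pt d → ℝ := fun x => if x ∈ frontier Ω then 0 else
    if h : ∃ t ∈ T.cells, x ∈ t then u h.choose x else 0 with hg
  refine ⟨g, fun x hx => by simp only [hg]; rw [if_pos hx], fun s hs x hx => ?_⟩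
  set St := T.cells.filter fun t => x ∈ t with hSt
  have hsSt : s ∈ St := Finset.mem_filter.2 ⟨hs, hx⟩
  -- Adjacency records only the jump bound at `x`. The set `A` below is the component of `s`, and it
  -- is closed under facet neighbours through `x` because `μ` links the two cell values there.
  let G : SimpleGraph St :=
    { Adj := fun a b => a ≠ b ∧ |u a.1 x - u b.1 x| ≤ E a.1 + E b.1
      symm := ⟨fun a b h => ⟨h.1.symm, by rw [abs_sub_comm, add_comm]; exact h.2⟩⟩
      loopless := ⟨fun a h => h.1 rfl⟩ }
  set A := St.filter fun t => ∃ h : t ∈ St, G.Reachable ⟨s, hsSt⟩ ⟨t, h⟩ with hA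
  have hsum : ∑ t : St, E t.1 = ∑ t ∈ St, E t := Finset.sum_coe_sort St E
  have hAle : ∀ t ∈ A, |u s x - u t x| ≤ 2 * ∑ t ∈ St, E t := by
    intro t ht
    obtain ⟨-, htS, hr⟩ := Finset.mem_filter.1 ht
    rw [← hsum]
    exact abs_sub_le_of_reachable (G := G) (a := fun t : St => u t.1 x) (E := fun t : St => E t.1)
      (fun t => hE _) (fun _ _ h => h.2) hr
  have hStle : ∑ t ∈ St, E t ≤ ∑ t ∈ T.neighbours s, E t := by
    refine Finset.sum_le_sum_of_subset_of_nonneg (fun t ht => ?_) fun t _ _ => hE t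
    obtain ⟨htc, hxt⟩ := Finset.mem_filter.1 ht
    exact T.mem_neighbours.2 ⟨htc, x, hx, hxt⟩
  have hSt0 : 0 ≤ ∑ t ∈ St, E t := Finset.sum_nonneg fun t _ => hE t
  have hcl : ∀ t ∈ A, ∀ t' ∈ T.cells, x ∈ t' → ∀ v ∈ t, v ≠ x → (∀ w ∈ t, w ≠ v → w ∈ t') →
      t' ∈ A := by
    intro t ht t' ht' hxt' v hv hvx hsub
    obtain ⟨htS, htS', hr⟩ := Finset.mem_filter.1 ht
    by_cases htt : t' = t
    · rw [htt]; exact ht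
    have ht'S : t' ∈ St := Finset.mem_filter.2 ⟨ht', hxt'⟩
    refine Finset.mem_filter.2 ⟨ht'S, ht'S, hr.trans (SimpleGraph.Adj.reachable ?_)⟩
    obtain ⟨htc, hxt⟩ := Finset.mem_filter.1 htS
    obtain ⟨v', hv', hF⟩ := T.exists_facet_eq htc ht' htt hv hsub
    have hxF : x ∈ facet t v := subset_convexHull ℝ _ ⟨hxt, fun h => hvx h.symm⟩
    have h1 := hjump t htc v hv x hxF
    have h2 := hjump t' ht' v' hv' x (by rw [hF]; exact hxF)
    rw [hF] at h2
    refine ⟨fun h => htt (congrArg Subtype.val h).symm, ?_⟩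
    have h3 := abs_sub_le (u t x) (μ (facet t v) x) (u t' x)
    rw [abs_sub_comm (μ (facet t v) x)] at h3
    change |u t x - u t' x| ≤ E t + E t'
    linarith
  have hsA : s ∈ A := Finset.mem_filter.2 ⟨hsSt, hsSt, SimpleGraph.Reachable.refl _⟩
  have hAc : A ⊆ T.cells := (Finset.filter_subset _ _).trans (Finset.filter_subset _ _)
  have hAx : ∀ t ∈ A, x ∈ t := fun t ht =>
    (Finset.mem_filter.1 (Finset.mem_filter.1 ht).1).2
  have hconn := T.star_connected hd hΩ.1 hAc hAx ⟨s, hsA⟩ hcl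
  by_cases hxf : x ∈ frontier Ω
  · have hgx : g x = 0 := by simp only [hg]; rw [if_pos hxf]
    -- Otherwise `star_connected` would keep `x` away from the exterior. On a boundary facet `μ` is
    -- zero, so one more jump brings the factor from 2 to 3.
    obtain ⟨t, ht, v, hv, hvx, hF⟩ : ∃ t ∈ A, ∃ v ∈ t, v ≠ x ∧ facet t v ⊆ frontier Ω := by
      by_contra! hcon
      exact (hconn hcon).1 (hΩ.mem_closure_compl hxf)
    have htc := hAc ht
    have hxF : x ∈ facet t v := subset_convexHull ℝ _ ⟨hAx t ht, fun h => hvx h.symm⟩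
    have h1 := hjump t htc v hv x hxF
    rw [hμ.2.1 _ (T.facet_mem_faces htc hv) hF] at h1
    have h2 := hAle t ht
    have h3 : E t ≤ ∑ t ∈ St, E t :=
      Finset.single_le_sum (fun t _ => hE t) (Finset.mem_filter.1 ht).1
    have h4 := abs_sub_le (u s x) (u t x) 0
    have h5 : |u t x - 0| ≤ E t := h1
    rw [hgx]
    linarith
  · have hcell : ∃ t ∈ T.cells, x ∈ t := ⟨s, hs, hx⟩
    have hgx : g x = u hcell.choose x := by
      simp only [hg]; rw [if_neg hxf, dif_pos hcell]
    have hall := hconn fun t ht v hv hvx hF =>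
      hxf (hF (subset_convexHull ℝ _ ⟨hAx t ht, fun h => hvx h.symm⟩))
    have h1 := hAle _ (hall.2 _ hcell.choose_spec.1 hcell.choose_spec.2)
    rw [hgx]
    linarith

/-- Quasi-interpolation of a piecewise continuous function by a conforming piecewise affine one. -/
lemma exists_quasi_interpolant (hd : 1 ≤ d) (hΩ : IsLipschitzDomain Ω) {p : ℕ}
    {μ : Set (Pt d) → Pt d → ℝ} (hμ : μ ∈ T.skeletal p) (u : Finset (Pt d) → Pt d → ℝ)
    {E : Finset (Pt d) → ℝ} (hE : ∀ s, 0 ≤ E s)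
    (hosc : ∀ s ∈ T.cells, ∀ y ∈ hull s, ∀ z ∈ hull s, |u s y - u s z| ≤ E s)
    (hjump : ∀ s ∈ T.cells, ∀ v ∈ s, ∀ y ∈ facet s v, |u s y - μ (facet s v) y| ≤ E s) :
    ∃ w : Pt d → ℝ, (∀ x ∉ Ω, w x = 0) ∧
      (∀ s ∈ T.cells, ∃ f : Pt d →ᵃ[ℝ] ℝ, ∀ x ∈ hull s, w x = f x) ∧
      ∀ s ∈ T.cells, ∀ y ∈ hull s, |u s y - w y| ≤ 4 * ∑ t ∈ T.neighbours s, E t := by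
  obtain ⟨g, hg0, hg⟩ := T.exists_vertex_values hd hΩ hμ u hE hjump
  refine ⟨T.interp g, fun x hx => T.interp_eq_zero hΩ.1 hΩ.interior_closure hg0 hx,
    fun s hs => ⟨affineInterp s g, fun x hx => T.interp_eq g hs hx⟩, fun s hs y hy => ?_⟩
  have hs' := T.isSimplex hs
  have h1 : ∀ v ∈ s, |u s y - g v| ≤ 4 * ∑ t ∈ T.neighbours s, E t := by
    intro v hv
    have h2 := hosc s hs y hy v (subset_convexHull ℝ _ hv)
    have h3 := hg s hs v hv
    have h4 : E s ≤ ∑ t ∈ T.neighbours s, E t :=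
      Finset.single_le_sum (fun t _ => hE t) (T.self_mem_neighbours hs)
    have h5 := abs_sub_le (u s y) (u s v) (g v)
    linarith
  rw [T.interp_eq g hs hy, affineInterp_apply]
  -- The coordinates at `y` are nonnegative with sum one, so the error is a convex combination of
  -- the vertex errors.
  have h2 : u s y - ∑ v ∈ s, g v * bary s v y = ∑ v ∈ s, bary s v y * (u s y - g v) := by
    simp only [mul_sub, Finset.sum_sub_distrib, ← Finset.sum_mul, hs'.sum_bary, one_mul]
    simp only [mul_comm]
  rw [h2]
  calc |∑ v ∈ s, bary s v y * (u s y - g v)|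
      ≤ ∑ v ∈ s, |bary s v y * (u s y - g v)| := Finset.abs_sum_le_sum_abs _ _
    _ ≤ ∑ v ∈ s, bary s v y * (4 * ∑ t ∈ T.neighbours s, E t) :=
        Finset.sum_le_sum fun v hv => by
          rw [abs_mul, abs_of_nonneg (hs'.mem_hull.1 hy v hv)]
          exact mul_le_mul_of_nonneg_left (h1 v hv) (hs'.mem_hull.1 hy v hv)
    _ = 4 * ∑ t ∈ T.neighbours s, E t := by rw [← Finset.sum_mul, hs'.sum_bary, one_mul]

end SimplicialMesh

end HDG

/-! ### Consequences of shape regularity and quasi-uniformity -/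

namespace HDG

variable {d : ℕ} {Ω : Set (Pt d)}

namespace SimplicialMesh

variable (T : SimplicialMesh Ω) {s t : Finset (Pt d)} {h r ρ : ℝ}

/-- All cells have diameter at most `h`, and contain balls of radius `r`. -/
structure HasScale (h r : ℝ) : Prop where
  pos : 0 < r
  diam_le : ∀ s ∈ T.cells, Metric.diam (hull s) ≤ h
  exists_ball : ∀ s ∈ T.cells, ∃ x, Metric.closedBall x r ⊆ hull s

variable {T}

lemma HasScale.nonneg (hT : T.HasScale h r) (hs : s ∈ T.cells) : 0 ≤ h :=
  Metric.diam_nonneg.trans (hT.diam_le s hs)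

lemma pairwiseDisjoint_interior :
    (T.cells : Set (Finset (Pt d))).PairwiseDisjoint fun s => interior (hull s) := by
  intro s hs t ht hst
  refine Set.disjoint_left.2 fun x hxs hxt => hst ?_
  exact T.eq_of_mem_interior hs ht hxs (interior_subset hxt)

/-- The number of neighbours of a cell is bounded. -/
lemma HasScale.card_neighbours_le (hT : T.HasScale h r) (hρ : h ≤ ρ * r) (hs : s ∈ T.cells) :
    ((T.neighbours s).card : ℝ) ≤ (4 * ρ) ^ d := by
  have hr := hT.pos
  have hh := hT.nonneg hs
  choose! c hc using hT.exists_ball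
  obtain ⟨x0, hx0⟩ := (T.isSimplex hs).interior_nonempty
  have hx0s : x0 ∈ hull s := interior_subset hx0
  have hmem : ∀ t ∈ T.neighbours s, t ∈ T.cells := fun t ht => (T.mem_neighbours.1 ht).1
  -- Volume comparison: halving the radius puts the balls into the cell interiors, which are
  -- disjoint, and all of them lie in a ball of radius `2 * h`. The ratio of the radii is at most `4
  -- * ρ`.
  have hball : ∀ t ∈ T.neighbours s, Metric.closedBall (c t) (r / 2) ⊆ interior (hull t) := by
    intro t ht
    exact (Metric.closedBall_subset_ball (by linarith)).trans
      (interior_maximal (Metric.ball_subset_closedBall.trans (hc t (hmem t ht)))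
        Metric.isOpen_ball)
  have hsub : ⋃ t ∈ T.neighbours s, Metric.closedBall (c t) (r / 2)
      ⊆ Metric.closedBall x0 (2 * h) := by
    refine iUnion₂_subset fun t ht y hy => ?_
    obtain ⟨htc, z, hzs, hzt⟩ := T.mem_neighbours.1 ht
    have hyt := interior_subset (hball t ht hy)
    have h1 := IsSimplex.hull_subset_closedBall (hT.diam_le t htc)
      (subset_convexHull ℝ _ hzt : z ∈ hull t) hyt
    have h2 := IsSimplex.hull_subset_closedBall (hT.diam_le s hs) hx0s
      (subset_convexHull ℝ _ hzs : z ∈ hull s)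
    rw [Metric.mem_closedBall] at h1 h2 ⊢
    linarith [dist_triangle y z x0]
  have hdisj : (T.neighbours s : Set (Finset (Pt d))).PairwiseDisjoint
      fun t => Metric.closedBall (c t) (r / 2) := by
    intro a ha b hb hab
    exact (pairwiseDisjoint_interior (hmem a ha) (hmem b hb) hab).mono (hball a ha) (hball b hb)
  have h1 := measureReal_biUnion_finset (μ := (volume : Measure (Pt d))) hdisj
    (fun t _ => Metric.isClosed_closedBall.measurableSet)
    (fun t _ => measure_closedBall_lt_top.ne)
  have h2 := measureReal_mono (μ := (volume : Measure (Pt d))) hsub measure_closedBall_lt_top.ne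
  rw [h1, volume_real_closedBall _ (by linarith)] at h2
  simp only [volume_real_closedBall _ (half_pos hr).le, Finset.sum_const, nsmul_eq_mul] at h2
  have h3 : (2 * h) ^ d ≤ (4 * ρ) ^ d * (r / 2) ^ d := by
    rw [← mul_pow]
    refine pow_le_pow_left₀ (by linarith) ?_ d
    linarith
  have h4 : ((T.neighbours s).card : ℝ) * ((r / 2) ^ d * ballVol d)
      ≤ (4 * ρ) ^ d * ((r / 2) ^ d * ballVol d) := by
    refine h2.trans ?_
    rw [← mul_assoc]
    exact mul_le_mul_of_nonneg_right h3 (ballVol_pos d).le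
  exact le_of_mul_le_mul_right h4 (mul_pos (by positivity) (ballVol_pos d))

/-- The sum over neighbours is bounded in the discrete `ℓ²` norm. -/
lemma sum_sq_neighbours_le {N : ℝ} (hN : ∀ s ∈ T.cells, ((T.neighbours s).card : ℝ) ≤ N)
    (E : Finset (Pt d) → ℝ) :
    ∑ s ∈ T.cells, (∑ t ∈ T.neighbours s, E t) ^ 2 ≤ N ^ 2 * ∑ s ∈ T.cells, E s ^ 2 := by
  classical
  have hsymm : ∀ {s t}, s ∈ T.cells → t ∈ T.neighbours s → s ∈ T.neighbours t := by
    intro s t hs ht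
    obtain ⟨-, x, hx, hx'⟩ := T.mem_neighbours.1 ht
    exact T.mem_neighbours.2 ⟨hs, x, hx', hx⟩
  calc ∑ s ∈ T.cells, (∑ t ∈ T.neighbours s, E t) ^ 2
      ≤ ∑ s ∈ T.cells, N * ∑ t ∈ T.neighbours s, E t ^ 2 := by
        refine Finset.sum_le_sum fun s hs => sq_sum_le_card_mul_sum_sq.trans ?_
        exact mul_le_mul_of_nonneg_right (hN s hs) (Finset.sum_nonneg fun _ _ => sq_nonneg _)
    _ = N * ∑ t ∈ T.cells, (T.neighbours t).card * E t ^ 2 := by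
        -- Being neighbours is symmetric, so after exchanging the sums each `E t ^ 2` is counted
        -- once per neighbour of `t`.
        rw [← Finset.mul_sum, Finset.sum_comm' (t' := T.cells) (s' := fun t => T.neighbours t)]
        · simp
        · intro s t
          constructor
          · rintro ⟨hs, ht⟩
            exact ⟨hsymm hs ht, (T.mem_neighbours.1 ht).1⟩
          · rintro ⟨hs, ht⟩
            exact ⟨(T.mem_neighbours.1 hs).1, hsymm ht hs⟩
    _ ≤ N * ∑ t ∈ T.cells, N * E t ^ 2 := by
        rcases T.cells.eq_empty_or_nonempty with h0 | ⟨s, hs⟩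
        · simp [h0]
        · have hN0 : 0 ≤ N := (Nat.cast_nonneg _).trans (hN s hs)
          refine mul_le_mul_of_nonneg_left (Finset.sum_le_sum fun t ht => ?_) hN0
          exact mul_le_mul_of_nonneg_right (hN t ht) (sq_nonneg _)
    _ = N ^ 2 * ∑ s ∈ T.cells, E s ^ 2 := by rw [← Finset.mul_sum]; ring

/-- The ratio `|T| / |∂T|` is bounded from below by a multiple of `r`. -/
lemma HasScale.le_cellRatio (hd : 1 ≤ d) (hT : T.HasScale h r) (hρ0 : 0 < ρ) (hρ : h ≤ ρ * r)
    (hs : s ∈ T.cells) :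
    r * (ballVol d / ((d + 1) * (ρ ^ (d - 1) * ballVol (d - 1)))) ≤ cellRatio s := by
  have hr := hT.pos
  have hs' := T.isSimplex hs
  obtain ⟨x, hx⟩ := hT.exists_ball s hs
  have hb := ballVol_pos d
  have hb' := ballVol_pos (d - 1)
  have h1 := IsSimplex.le_volume hr.le hx
  have h2 : ∑ v ∈ s, facetInt (facet s v) (fun _ => 1)
      ≤ (d + 1) * ((ρ * r) ^ (d - 1) * ballVol (d - 1)) := by
    refine (Finset.sum_le_sum fun v hv => hs'.facetInt_one_le hd hv (by positivity)
      ((hT.diam_le s hs).trans hρ)).trans ?_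
    rw [Finset.sum_const, hs'.card_eq, nsmul_eq_mul]
    push_cast
    exact le_rfl
  have h3 : 0 < ∑ v ∈ s, facetInt (facet s v) (fun _ => 1) :=
    Finset.sum_pos (fun v hv => hs'.facetInt_one_pos hd hv hr hx) hs'.nonempty
  rw [cellRatio, cellInt_one, le_div_iff₀ h3]
  refine le_trans ?_ h1
  have h4 : r ^ d = r * r ^ (d - 1) := by
    rw [← pow_succ']; congr 1; omega
  calc r * (ballVol d / ((d + 1) * (ρ ^ (d - 1) * ballVol (d - 1)))) *
        ∑ v ∈ s, facetInt (facet s v) (fun _ => 1)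
      ≤ r * (ballVol d / ((d + 1) * (ρ ^ (d - 1) * ballVol (d - 1)))) *
        ((d + 1) * ((ρ * r) ^ (d - 1) * ballVol (d - 1))) := by gcongr
    _ = r ^ d * ballVol d := by
        rw [h4, mul_pow]; field_simp

lemma HasScale.cellRatio_mul_area (hd : 1 ≤ d) (hT : T.HasScale h r) (hs : s ∈ T.cells) :
    cellRatio s * ∑ v ∈ s, facetInt (facet s v) (fun _ => 1) = volume.real (hull s) := by
  have hs' := T.isSimplex hs
  obtain ⟨x, hx⟩ := hT.exists_ball s hs
  have h3 : 0 < ∑ v ∈ s, facetInt (facet s v) (fun _ => 1) :=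
    Finset.sum_pos (fun v hv => hs'.facetInt_one_pos hd hv hT.pos hx) hs'.nonempty
  rw [cellRatio, div_mul_cancel₀ _ h3.ne', cellInt_one]

lemma cellRatio_nonneg (s : Finset (Pt d)) : 0 ≤ cellRatio s :=
  div_nonneg (cellInt_nonneg fun _ => zero_le_one)
    (Finset.sum_nonneg fun _ _ => facetInt_nonneg fun _ => zero_le_one)

lemma bdryNorm_sq (f : Finset (Pt d) → Set (Pt d) → Pt d → ℝ) :
    T.bdryNorm f ^ 2 = ∑ s ∈ T.cells, cellRatio s *
      ∑ v ∈ s, facetInt (facet s v) fun x => f s (facet s v) x ^ 2 :=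
  Real.sq_sqrt (Finset.sum_nonneg fun s _ => mul_nonneg (cellRatio_nonneg s)
    (Finset.sum_nonneg fun _ _ => facetInt_nonneg fun _ => sq_nonneg _))

lemma vecNorm0_sq (q : Finset (Pt d) → Fin d → Poly d) :
    T.vecNorm0 q ^ 2 = ∑ s ∈ T.cells, cellInt s fun x => ∑ i, polyFun (q s i) x ^ 2 :=
  Real.sq_sqrt (Finset.sum_nonneg fun _ _ => cellInt_nonneg fun _ =>
    Finset.sum_nonneg fun _ _ => sq_nonneg _)

lemma vecNorm0_add_sq_le (q q' : Finset (Pt d) → Fin d → Poly d) :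
    T.vecNorm0 q' ^ 2 ≤ 2 * T.vecNorm0 (fun s i => q s i + q' s i) ^ 2 + 2 * T.vecNorm0 q ^ 2 := by
  have hp : ∀ q : Poly d, Continuous (polyFun q) := continuous_polyFun
  rw [vecNorm0_sq, vecNorm0_sq, vecNorm0_sq, Finset.mul_sum, Finset.mul_sum,
    ← Finset.sum_add_distrib]
  refine Finset.sum_le_sum fun s _ => ?_
  have h1 := cellInt_lin (s := s) (f := fun x => ∑ i, polyFun (q s i) x ^ 2) (g := fun _ => 0)
    (by fun_prop) (by fun_prop) 2
  have h0 : cellInt s (fun _ => 0) = 0 := by simp [cellInt]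
  rw [h0, add_zero] at h1
  rw [← h1, ← cellInt_lin (by fun_prop) (by fun_prop)]
  refine IsSimplex.cellInt_mono (by fun_prop) (by fun_prop) fun x _ => ?_
  rw [add_zero, Finset.mul_sum, Finset.mul_sum, ← Finset.sum_add_distrib]
  refine Finset.sum_le_sum fun i _ => ?_
  rw [polyFun_add]
  nlinarith [sq_nonneg (2 * polyFun (q s i) x + polyFun (q' s i) x)]

end SimplicialMesh

end HDG

/-! ### Conforming approximation of skeletal functions -/

namespace HDG

open SimplicialMesh

variable {d k p : ℕ} {Ω : Set (Pt d)} {T : SimplicialMesh Ω}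

lemma cellInt_sum {s : Finset (Pt d)} {ι : Type*} (A : Finset ι) {f : ι → Pt d → ℝ}
    (hf : ∀ i, Continuous (f i)) :
    cellInt s (fun x => ∑ i ∈ A, f i x) = ∑ i ∈ A, cellInt s (f i) :=
  integral_finsetSum _ fun i _ => IsSimplex.integrableOn_hull (hf i)

lemma Method.traceError_sq (S : Method k T) (μ : Set (Pt d) → Pt d → ℝ) :
    S.traceError μ ^ 2 = ∑ s ∈ T.cells, cellRatio s *
      ∑ v ∈ s, facetInt (facet s v) fun x => (polyFun (S.U μ s) x - μ (facet s v) x) ^ 2 :=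
  SimplicialMesh.bdryNorm_sq _

lemma Method.LS1.traceError_sq_le {S : Method k T} {K : ℝ} (h1 : S.LS1 p K)
    {μ : Set (Pt d) → Pt d → ℝ} (hμ : μ ∈ T.skeletal p) :
    S.traceError μ ^ 2 ≤ K ^ 2 * (T.meshSize ^ 2 * T.vecNorm0 (S.Q μ) ^ 2) := by
  rw [← mul_pow, ← mul_pow]
  exact pow_le_pow_left₀ (Real.sqrt_nonneg _) (h1 μ hμ) 2

/-- The broken gradient of `U μ` is bounded by `Q μ`. -/
lemma Method.gradient_U_sq_le {S : Method k T} {K : ℝ} (h1 : S.LS1 p K) (h3 : S.LS3 p K)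
    {μ : Set (Pt d) → Pt d → ℝ} (hμ : μ ∈ T.skeletal p) :
    T.vecNorm0 (fun s i => MvPolynomial.pderiv i (S.U μ s)) ^ 2
      ≤ (2 * K ^ 4 + 2) * T.vecNorm0 (S.Q μ) ^ 2 := by
  have e1 := SimplicialMesh.vecNorm0_add_sq_le (T := T) (S.Q μ)
    (fun s i => MvPolynomial.pderiv i (S.U μ s))
  have e2 : T.vecNorm0 (fun s i => S.Q μ s i + MvPolynomial.pderiv i (S.U μ s)) ^ 2
      ≤ (K * (T.meshSize⁻¹ * S.traceError μ)) ^ 2 :=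
    pow_le_pow_left₀ (Real.sqrt_nonneg _) (h3 μ hμ) 2
  have e3 := h1.traceError_sq_le hμ
  -- An inequality suffices and also covers mesh size zero, where the inverse is zero by convention.
  have e4 : (T.meshSize⁻¹ * T.meshSize) ^ 2 ≤ 1 := by
    rcases eq_or_ne T.meshSize 0 with h0 | h0
    · simp [h0]
    · rw [inv_mul_cancel₀ h0]; norm_num
  have e5 : (K * (T.meshSize⁻¹ * S.traceError μ)) ^ 2 ≤ K ^ 4 * T.vecNorm0 (S.Q μ) ^ 2 := by
    calc (K * (T.meshSize⁻¹ * S.traceError μ)) ^ 2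
        = K ^ 2 * T.meshSize⁻¹ ^ 2 * S.traceError μ ^ 2 := by ring
      _ ≤ K ^ 2 * T.meshSize⁻¹ ^ 2 * (K ^ 2 * (T.meshSize ^ 2 * T.vecNorm0 (S.Q μ) ^ 2)) := by
          gcongr
      _ = (T.meshSize⁻¹ * T.meshSize) ^ 2 * (K ^ 4 * T.vecNorm0 (S.Q μ) ^ 2) := by ring
      _ ≤ 1 * (K ^ 4 * T.vecNorm0 (S.Q μ) ^ 2) := by gcongr
      _ = _ := one_mul _
  linarith

/-- Approximation of skeletal functions by conforming piecewise affine functions. -/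
lemma exists_conforming_approximation (d : ℕ) (hd : 1 ≤ d) (p k : ℕ) {ρ : ℝ} (hρ0 : 0 < ρ)
    (K : ℝ) : ∃ C : ℝ, 0 < C ∧ ∀ (Ω : Set (Pt d)), IsLipschitzDomain Ω →
      ∀ (T : SimplicialMesh Ω) (r : ℝ), T.HasScale T.meshSize r → T.meshSize ≤ ρ * r →
      ∀ S : Method k T, S.WellPosed p → S.LS1 p K → S.LS3 p K → ∀ μ ∈ T.skeletal p,
      ∃ (w : Pt d → ℝ) (G : Finset (Pt d) → ℝ), (∀ x ∉ Ω, w x = 0) ∧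
        (∀ s ∈ T.cells, ∃ f : Pt d →ᵃ[ℝ] ℝ, ∀ x ∈ hull s, w x = f x) ∧ (∀ s, 0 ≤ G s) ∧
        (∀ s ∈ T.cells, ∀ v ∈ s, ∀ y ∈ facet s v, |μ (facet s v) y - w y| ≤ G s) ∧
        (∀ s ∈ T.cells, ∀ y ∈ hull s, ∀ z ∈ hull s, |w y - w z| ≤ G s) ∧
        r ^ d * ∑ s ∈ T.cells, G s ^ 2 ≤ C * (T.meshSize ^ 2 * T.vecNorm0 (S.Q μ) ^ 2) := by
  obtain ⟨C1, hC1, hinv⟩ := exists_inverse_inequality_cell d k ρ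
  obtain ⟨C2, hC2, hinvF⟩ := exists_inverse_inequality_facet d (max k p) hd ρ
  have hb := ballVol_pos d
  have hb' := ballVol_pos (d - 1)
  set c0 : ℝ := ballVol d / ((d + 1) * (ρ ^ (d - 1) * ballVol (d - 1))) with hc0
  have hc0pos : 0 < c0 := by positivity
  set C3 : ℝ := C1 * (2 * K ^ 4 + 2) + C2 * (c0⁻¹ * K ^ 2) with hC3
  have hC3pos : 0 < C3 := by
    have : 0 < C1 * (2 * K ^ 4 + 2) := by positivity
    have : 0 ≤ C2 * (c0⁻¹ * K ^ 2) := by positivity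
    linarith
  -- Here 81 is the square of the factor 9 in the choice of `G` below, `(4 * ρ) ^ d` bounds the
  -- number of neighbours, and `C3` collects the oscillation part, from (LS1) and (LS3), and the
  -- jump part, from (LS1).
  refine ⟨81 * ((4 * ρ) ^ d) ^ 2 * C3, by positivity, ?_⟩
  intro Ω hΩ T r hT hρ S hS hLS1 hLS3 μ hμ
  have hp : ∀ q : Poly d, Continuous (polyFun q) := continuous_polyFun
  set h := T.meshSize with hh
  have hr := hT.pos
  set D : Finset (Pt d) → ℝ := fun s =>
    cellInt s fun x => ∑ i, polyFun (MvPolynomial.pderiv i (S.U μ s)) x ^ 2 with hD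
  set B : Finset (Pt d) → ℝ := fun s => ∑ v ∈ s,
    facetInt (facet s v) fun x => (polyFun (S.U μ s) x - μ (facet s v) x) ^ 2 with hB
  have hD0 : ∀ s, 0 ≤ D s := fun s => cellInt_nonneg fun _ => Finset.sum_nonneg fun _ _ =>
    sq_nonneg _
  have hB0 : ∀ s, 0 ≤ B s := fun s => Finset.sum_nonneg fun _ _ => facetInt_nonneg fun _ =>
    sq_nonneg _
  -- One number that bounds both the oscillation (diameter times the largest gradient) and the jump
  -- to `μ`, each estimated by an inverse inequality.
  set E : Finset (Pt d) → ℝ := fun s =>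
    √(C1 * ((r ^ d)⁻¹ * D s) * h ^ 2 + C2 * ((r ^ (d - 1))⁻¹ * B s)) with hE
  have hX0 : ∀ s, 0 ≤ C1 * ((r ^ d)⁻¹ * D s) := fun s => by
    have := hD0 s; positivity
  have hY0 : ∀ s, 0 ≤ C2 * ((r ^ (d - 1))⁻¹ * B s) := fun s => by
    have := hB0 s; positivity
  have hE0 : ∀ s, 0 ≤ E s := fun s => Real.sqrt_nonneg _
  have hE2 : ∀ s, E s ^ 2 = C1 * ((r ^ d)⁻¹ * D s) * h ^ 2 + C2 * ((r ^ (d - 1))⁻¹ * B s) :=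
    fun s => Real.sq_sqrt (add_nonneg (mul_nonneg (hX0 s) (sq_nonneg _)) (hY0 s))
  have hdeg : ∀ s ∈ T.cells, (S.U μ s).totalDegree ≤ k := fun s hs =>
    S.V_degree s hs _ (hS.isLocalSolution hμ hs).1
  have hosc : ∀ s ∈ T.cells, ∀ y ∈ hull s, ∀ z ∈ hull s,
      |polyFun (S.U μ s) y - polyFun (S.U μ s) z| ≤ E s := by
    intro s hs y hy z hz
    obtain ⟨x, hx⟩ := hT.exists_ball s hs
    have hgrad : ∀ x ∈ hull s, ∑ i, polyFun (MvPolynomial.pderiv i (S.U μ s)) x ^ 2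
        ≤ √(C1 * ((r ^ d)⁻¹ * D s)) ^ 2 := by
      intro y hy
      rw [Real.sq_sqrt (hX0 s)]
      refine (Finset.sum_le_sum fun i _ => hinv _ ((totalDegree_pderiv_le i _).trans (hdeg s hs))
        s x r hr hx ((hT.diam_le s hs).trans hρ) y hy).trans ?_
      rw [← Finset.mul_sum, ← Finset.mul_sum, ← cellInt_sum _ fun i => by fun_prop]
    refine (abs_polyFun_sub_le _ IsSimplex.convex_hull (Real.sqrt_nonneg _) hgrad hz hy).trans ?_
    have hdist : dist y z ≤ h :=
      (Metric.dist_le_diam_of_mem IsSimplex.isCompact_hull.isBounded hy hz).trans (hT.diam_le s hs)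
    refine (mul_le_mul_of_nonneg_left hdist (Real.sqrt_nonneg _)).trans ?_
    refine Real.le_sqrt_of_sq_le ?_
    rw [mul_pow, Real.sq_sqrt (hX0 s)]
    linarith [hY0 s]
  have hjump : ∀ s ∈ T.cells, ∀ v ∈ s, ∀ y ∈ facet s v,
      |polyFun (S.U μ s) y - μ (facet s v) y| ≤ E s := by
    intro s hs v hv y hy
    obtain ⟨x, hx⟩ := hT.exists_ball s hs
    obtain ⟨q, hq, hqe⟩ := Method.exists_poly_trace_error hμ hs hv (hdeg s hs)
    refine Real.abs_le_sqrt ?_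
    have h1 := hinvF q hq s (T.isSimplex hs) v hv x r hr hx ((hT.diam_le s hs).trans hρ) y hy
    have h2 : facetInt (facet s v) (fun z => polyFun q z ^ 2) ≤ B s := by
      rw [facetInt_congr (f := fun z => polyFun q z ^ 2)
        (g := fun x => (polyFun (S.U μ s) x - μ (facet s v) x) ^ 2)
        (fun z hz => by rw [hqe z hz])]
      exact Finset.single_le_sum (f := fun v => facetInt (facet s v) fun x =>
        (polyFun (S.U μ s) x - μ (facet s v) x) ^ 2)
        (fun _ _ => facetInt_nonneg fun _ => sq_nonneg _) hv
    rw [hqe y hy]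
    refine h1.trans (le_trans ?_ (le_add_of_nonneg_left (mul_nonneg (hX0 s) (sq_nonneg _))))
    gcongr
  obtain ⟨w, hw0, hwa, hw⟩ := T.exists_quasi_interpolant hd hΩ hμ
    (fun s => polyFun (S.U μ s)) hE0 hosc hjump
  have hself : ∀ s ∈ T.cells, E s ≤ ∑ t ∈ T.neighbours s, E t := fun s hs =>
    Finset.single_le_sum (fun t _ => hE0 t) (T.self_mem_neighbours hs)
  -- The oscillation of `w` needs 4 + 1 + 4: twice the distance to `Uμ` plus the oscillation of
  -- `Uμ`. The distance from `μ` needs only 1 + 4.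
  refine ⟨w, fun s => 9 * ∑ t ∈ T.neighbours s, E t, hw0, hwa, fun s =>
    mul_nonneg (by norm_num) (Finset.sum_nonneg fun t _ => hE0 t), ?_, ?_, ?_⟩
  · intro s hs v hv y hy
    have h1 := hjump s hs v hv y hy
    have h2 := hw s hs y (IsSimplex.facet_subset hy)
    have h3 := hself s hs
    have h4 := abs_sub_le (μ (facet s v) y) (polyFun (S.U μ s) y) (w y)
    rw [abs_sub_comm (μ (facet s v) y) (polyFun (S.U μ s) y)] at h4
    have h5 := hE0 s
    change _ ≤ 9 * _
    linarith
  · intro s hs y hy z hz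
    have h1 := hosc s hs y hy z hz
    have h2 := hw s hs y hy
    have h3 := hw s hs z hz
    have h4 := hself s hs
    have h5 := abs_sub_le (w y) (polyFun (S.U μ s) y) (w z)
    have h6 := abs_sub_le (polyFun (S.U μ s) y) (polyFun (S.U μ s) z) (w z)
    rw [abs_sub_comm (w y) (polyFun (S.U μ s) y)] at h5
    change _ ≤ 9 * _
    linarith
  · have hsumE : r ^ d * ∑ s ∈ T.cells, E s ^ 2 ≤ C3 * (h ^ 2 * T.vecNorm0 (S.Q μ) ^ 2) := by
      -- Multiplying by `r ^ d` leaves the facet terms with a factor `r`, which is bounded by a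
      -- multiple of `|T| / |∂T|`, the weight in (LS1).
      have hrd : r ^ d * (r ^ (d - 1))⁻¹ = r := by
        have : r ^ d = r * r ^ (d - 1) := by rw [← pow_succ']; congr 1; omega
        rw [this]; field_simp
      have e1 : ∀ s ∈ T.cells, r ^ d * E s ^ 2
          ≤ C1 * h ^ 2 * D s + C2 * c0⁻¹ * (cellRatio s * B s) := by
        intro s hs
        have e2 := hT.le_cellRatio hd hρ0 hρ hs
        have e3 : r * B s ≤ c0⁻¹ * (cellRatio s * B s) := by
          rw [← mul_assoc]
          refine mul_le_mul_of_nonneg_right ?_ (hB0 s)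
          rw [inv_mul_eq_div, le_div_iff₀ hc0pos]
          exact e2
        calc r ^ d * E s ^ 2
            = C1 * h ^ 2 * D s * (r ^ d * (r ^ d)⁻¹) + C2 * (r ^ d * (r ^ (d - 1))⁻¹ * B s) := by
              rw [hE2]; ring
          _ = C1 * h ^ 2 * D s + C2 * (r * B s) := by
              rw [hrd, mul_inv_cancel₀ (pow_pos hr d).ne', mul_one]
          _ ≤ C1 * h ^ 2 * D s + C2 * (c0⁻¹ * (cellRatio s * B s)) := by gcongr
          _ = _ := by ring
      have e4 : ∑ s ∈ T.cells, D s ≤ (2 * K ^ 4 + 2) * T.vecNorm0 (S.Q μ) ^ 2 := by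
        have := Method.gradient_U_sq_le hLS1 hLS3 hμ
        rwa [SimplicialMesh.vecNorm0_sq] at this
      have e5 : ∑ s ∈ T.cells, cellRatio s * B s ≤ K ^ 2 * (h ^ 2 * T.vecNorm0 (S.Q μ) ^ 2) := by
        have := hLS1.traceError_sq_le hμ
        rwa [Method.traceError_sq] at this
      calc r ^ d * ∑ s ∈ T.cells, E s ^ 2 = ∑ s ∈ T.cells, r ^ d * E s ^ 2 := Finset.mul_sum _ _ _
        _ ≤ ∑ s ∈ T.cells, (C1 * h ^ 2 * D s + C2 * c0⁻¹ * (cellRatio s * B s)) :=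
            Finset.sum_le_sum e1
        _ = C1 * h ^ 2 * ∑ s ∈ T.cells, D s + C2 * c0⁻¹ * ∑ s ∈ T.cells, cellRatio s * B s := by
            rw [Finset.sum_add_distrib, Finset.mul_sum, Finset.mul_sum]
        _ ≤ C1 * h ^ 2 * ((2 * K ^ 4 + 2) * T.vecNorm0 (S.Q μ) ^ 2)
            + C2 * c0⁻¹ * (K ^ 2 * (h ^ 2 * T.vecNorm0 (S.Q μ) ^ 2)) := by gcongr
        _ = C3 * (h ^ 2 * T.vecNorm0 (S.Q μ) ^ 2) := by rw [hC3]; ring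
    have hnb := SimplicialMesh.sum_sq_neighbours_le
      (fun s hs => hT.card_neighbours_le hρ hs) E
    calc r ^ d * ∑ s ∈ T.cells, (9 * ∑ t ∈ T.neighbours s, E t) ^ 2
        = 81 * (r ^ d * ∑ s ∈ T.cells, (∑ t ∈ T.neighbours s, E t) ^ 2) := by
          simp only [mul_pow, ← Finset.mul_sum]; ring
      _ ≤ 81 * (r ^ d * (((4 * ρ) ^ d) ^ 2 * ∑ s ∈ T.cells, E s ^ 2)) := by gcongr
      _ = 81 * ((4 * ρ) ^ d) ^ 2 * (r ^ d * ∑ s ∈ T.cells, E s ^ 2) := by ring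
      _ ≤ 81 * ((4 * ρ) ^ d) ^ 2 * (C3 * (h ^ 2 * T.vecNorm0 (S.Q μ) ^ 2)) := by gcongr
      _ = _ := by ring

end HDG

/-! ### Energies of traces and of small remainders -/

namespace HDG

open SimplicialMesh

variable {d k p : ℕ} {Ω : Set (Pt d)} {T : SimplicialMesh Ω}

lemma hull_ae_eq_interior (s : Finset (Pt d)) :
    hull s =ᵐ[(volume : Measure (Pt d))] interior (hull s) :=
  (interior_ae_eq_of_null_frontier (IsSimplex.convex_hull.addHaar_frontier volume)).symm

lemma cellInt_eq_interior (s : Finset (Pt d)) (f : Pt d → ℝ) :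
    cellInt s f = ∫ x in interior (hull s), f x :=
  setIntegral_congr_set (hull_ae_eq_interior s)

/-- Cells are convex, so their boundaries are null sets, and their interiors are disjoint. -/
lemma SimplicialMesh.sum_cellInt (T : SimplicialMesh Ω) {f : Pt d → ℝ}
    (hf : IntegrableOn f (closure Ω)) :
    ∑ s ∈ T.cells, cellInt s f = ∫ x in closure Ω, f x := by
  have h1 : (⋃ s ∈ T.cells, interior (hull s)) =ᵐ[(volume : Measure (Pt d))] closure Ω := by
    rw [← T.cover]
    exact Filter.EventuallyEq.countable_bUnion T.cells.countable_toSet fun s _ =>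
      (hull_ae_eq_interior s).symm
  rw [← setIntegral_congr_set h1, integral_biUnion_finset _
    (fun s _ => isOpen_interior.measurableSet) pairwiseDisjoint_interior
    (fun s hs => hf.mono_set (interior_subset.trans (T.hull_subset hs)))]
  exact Finset.sum_congr rfl fun s _ => cellInt_eq_interior s f

/-- Steps of length `r` from the centre of the ball stay in the cell, so the linear part is at most
`G` on vectors of length `r`. -/
lemma mul_norm_gradient_le {s : Finset (Pt d)} {f : Pt d →ᵃ[ℝ] ℝ} {c : Pt d} {r G : ℝ}
    (hr : 0 < r) (hc : Metric.closedBall c r ⊆ hull s)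
    (hosc : ∀ y ∈ hull s, ∀ z ∈ hull s, |f y - f z| ≤ G) (x : Pt d) :
    r * ‖gradient f x‖ ≤ G := by
  have hcs : c ∈ hull s := hc (Metric.mem_closedBall_self hr.le)
  have hG : 0 ≤ G := (abs_nonneg _).trans (hosc c hcs c hcs)
  have hlin : ∀ v : Pt d, |f.linear v| ≤ G / r * ‖v‖ := by
    intro v
    rcases eq_or_ne v 0 with rfl | hv
    · simp
    · have hv' : 0 < ‖v‖ := norm_pos_iff.2 hv
      have hmem : (r / ‖v‖) • v + c ∈ hull s := hc (by
        rw [Metric.mem_closedBall, dist_eq_norm, add_sub_cancel_right, norm_smul, Real.norm_eq_abs,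
          abs_of_pos (by positivity), div_mul_cancel₀ _ hv'.ne'])
      have h1 := hosc _ hmem c hcs
      have h2 := f.map_vadd c ((r / ‖v‖) • v)
      rw [vadd_eq_add, vadd_eq_add] at h2
      rw [h2, add_sub_cancel_right, map_smul, smul_eq_mul, abs_mul, abs_of_pos (by positivity),
        div_mul_eq_mul_div, div_le_iff₀ hv'] at h1
      rw [div_mul_eq_mul_div, le_div_iff₀ hr]
      linarith
  have hL : LipschitzWith (Real.toNNReal (G / r)) f := LipschitzWith.of_dist_le_mul fun y z => by
    rw [Real.coe_toNNReal _ (by positivity), Real.dist_eq, dist_eq_norm]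
    have := f.linearMap_vsub y z
    rw [vsub_eq_sub, vsub_eq_sub] at this
    rw [← this]
    exact hlin _
  have := norm_gradient_le_of_lipschitz hL x
  rw [Real.coe_toNNReal _ (by positivity), le_div_iff₀ hr] at this
  linarith

/-- The energy of the trace of a conforming function is its Dirichlet energy. -/
lemma Method.energyForm_trace {S : Method k T} (h4 : S.LS4 p) {w : Pt d → ℝ}
    (hw : w ∈ T.conforming) (hwt : T.trace w ∈ T.skeletal p) :
    S.energyForm (T.trace w) (T.trace w) = ∑ s ∈ T.cells, cellInt s fun x => ‖gradient w x‖ ^ 2 := by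
  have h := h4 w hw _ hwt rfl
  -- The stabilization vanishes because the local solver reproduces `w` also on the facets.
  have e : ∑ s ∈ T.cells, ∑ v ∈ s, facetInt (facet s v) (fun x =>
      S.τ * (polyFun (S.U (T.trace w) s) x - T.trace w (facet s v) x) *
        (polyFun (S.U (T.trace w) s) x - T.trace w (facet s v) x)) = 0 := by
    refine Finset.sum_eq_zero fun s hs => Finset.sum_eq_zero fun v hv => ?_
    rw [facetInt_congr (g := fun _ => 0)]
    · simp [facetInt]
    · intro x hx
      rw [(h s hs).2 x (IsSimplex.facet_subset hx), T.trace_apply hs hv hx]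
      ring
  rw [energyForm, e, add_zero]
  refine Finset.sum_congr rfl fun s hs => ?_
  rw [cellInt_eq_interior, cellInt_eq_interior]
  refine setIntegral_congr_fun isOpen_interior.measurableSet fun x hx => ?_
  rw [EuclideanSpace.norm_sq_eq]
  refine Finset.sum_congr rfl fun i _ => ?_
  rw [(h s hs).1 x hx i, Real.norm_eq_abs, sq_abs]
  ring

/-- The Dirichlet energy of a piecewise affine function is bounded by its oscillations. -/
lemma SimplicialMesh.HasScale.dirichlet_le {h r ρ : ℝ} (hT : T.HasScale h r) (hρ : h ≤ ρ * r)
    {w : Pt d → ℝ}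
    (haff : ∀ s ∈ T.cells, ∃ f : Pt d →ᵃ[ℝ] ℝ, ∀ x ∈ hull s, w x = f x)
    {G : Finset (Pt d) → ℝ} (hG : ∀ s ∈ T.cells, ∀ y ∈ hull s, ∀ z ∈ hull s, |w y - w z| ≤ G s) :
    r ^ 2 * ∑ s ∈ T.cells, cellInt s (fun x => ‖gradient w x‖ ^ 2)
      ≤ ρ ^ d * ballVol d * (r ^ d * ∑ s ∈ T.cells, G s ^ 2) := by
  rw [Finset.mul_sum, Finset.mul_sum, Finset.mul_sum]
  refine Finset.sum_le_sum fun s hs => ?_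
  have hr := hT.pos
  obtain ⟨f, hf⟩ := haff s hs
  obtain ⟨c, hc⟩ := hT.exists_ball s hs
  have hcs : c ∈ hull s := hc (Metric.mem_closedBall_self hr.le)
  have hgr : ∀ x ∈ interior (hull s), r ^ 2 * ‖gradient w x‖ ^ 2 ≤ G s ^ 2 := by
    intro x hx
    rw [← mul_pow]
    refine pow_le_pow_left₀ (by positivity) ?_ 2
    rw [gradient_eq_of_eventually (g := f) (c := 0)]
    · refine mul_norm_gradient_le hr hc (fun y hy z hz => ?_) x
      rw [← hf y hy, ← hf z hz]
      exact hG s hs y hy z hz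
    · filter_upwards [mem_interior_iff_mem_nhds.1 hx] with z hz
      rw [hf z hz, add_zero]
  have hvol : volume.real (hull s) ≤ (ρ * r) ^ d * ballVol d :=
    IsSimplex.volume_le (hT.nonneg hs |>.trans hρ)
      (IsSimplex.hull_subset_closedBall ((hT.diam_le s hs).trans hρ) hcs)
  have hfin : volume (interior (hull s)) < ⊤ :=
    (measure_mono interior_subset).trans_lt IsSimplex.isCompact_hull.measure_lt_top
  have h1 : r ^ 2 * cellInt s (fun x => ‖gradient w x‖ ^ 2) ≤ volume.real (hull s) * G s ^ 2 := by
    rw [cellInt_eq_interior, ← integral_const_mul, measureReal_congr (hull_ae_eq_interior s),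
      ← smul_eq_mul, ← setIntegral_const]
    refine integral_mono_of_nonneg (Eventually.of_forall fun x => by positivity)
      (integrableOn_const hfin.ne) ?_
    filter_upwards [ae_restrict_mem isOpen_interior.measurableSet] with x hx using hgr x hx
  calc _ ≤ volume.real (hull s) * G s ^ 2 := h1
    _ ≤ (ρ * r) ^ d * ballVol d * G s ^ 2 := by gcongr
    _ = _ := by rw [mul_pow]; ring

/-- The Dirichlet energy does not depend on the mesh. -/
lemma SimplicialMesh.dirichlet_eq {T' : SimplicialMesh Ω} (hb : Bornology.IsBounded Ω)
    {w : Pt d → ℝ} {K : NNReal} (hw : LipschitzWith K w) :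
    ∑ s ∈ T.cells, cellInt s (fun x => ‖gradient w x‖ ^ 2)
      = ∑ s ∈ T'.cells, cellInt s (fun x => ‖gradient w x‖ ^ 2) := by
  have hint : IntegrableOn (fun x => ‖gradient w x‖ ^ 2) (closure Ω) := by
    refine Measure.integrableOn_of_bounded (M := (K : ℝ) ^ 2) hb.closure.measure_lt_top.ne
      ((measurable_gradient w).norm.pow_const 2).aestronglyMeasurable
      (Eventually.of_forall fun x => ?_)
    rw [norm_pow, norm_norm]
    exact pow_le_pow_left₀ (norm_nonneg _) (norm_gradient_le_of_lipschitz hw x) 2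
  rw [T.sum_cellInt hint, T'.sum_cellInt hint]

/-- The difference of a skeletal function and the trace of a function close to it is small. -/
lemma SimplicialMesh.HasScale.skelNorm_sub_trace_sq_le (hd : 1 ≤ d) {h r ρ : ℝ}
    (hT : T.HasScale h r) (hρ : h ≤ ρ * r) {μ : Set (Pt d) → Pt d → ℝ} (hμ : μ ∈ T.skeletal p)
    {w : Pt d → ℝ} (hw : T.trace w ∈ T.skeletal p) {G : Finset (Pt d) → ℝ}
    (hG : ∀ s ∈ T.cells, ∀ v ∈ s, ∀ y ∈ facet s v, |μ (facet s v) y - w y| ≤ G s) :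
    T.skelNorm (μ - T.trace w) ^ 2 ≤ ρ ^ d * ballVol d * (r ^ d * ∑ s ∈ T.cells, G s ^ 2) := by
  have hp : ∀ q : Poly d, Continuous (polyFun q) := continuous_polyFun
  have hr := hT.pos
  rw [skelNorm, bdryNorm_sq, Finset.mul_sum, Finset.mul_sum]
  refine Finset.sum_le_sum fun s hs => ?_
  have hs' := T.isSimplex hs
  obtain ⟨c, hc⟩ := hT.exists_ball s hs
  have hcs : c ∈ hull s := hc (Metric.mem_closedBall_self hr.le)
  have hvol : volume.real (hull s) ≤ (ρ * r) ^ d * ballVol d :=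
    IsSimplex.volume_le (hT.nonneg hs |>.trans hρ)
      (IsSimplex.hull_subset_closedBall ((hT.diam_le s hs).trans hρ) hcs)
  have h1 : ∑ v ∈ s, facetInt (facet s v) (fun x => (μ - T.trace w) (facet s v) x ^ 2)
      ≤ G s ^ 2 * ∑ v ∈ s, facetInt (facet s v) (fun _ => 1) := by
    rw [Finset.mul_sum]
    refine Finset.sum_le_sum fun v hv => ?_
    obtain ⟨q, -, hq⟩ := T.exists_poly_of_mem_skeletal (Submodule.sub_mem _ hμ hw) hs hv
    have h2 : facetInt (facet s v) (fun _ => G s ^ 2)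
        = G s ^ 2 * facetInt (facet s v) (fun _ => 1) := by
      rw [facetInt, facetInt, ← integral_const_mul, mul_one]
    rw [← h2, facetInt_congr (g := fun x => polyFun q x ^ 2)
      (fun x hx => by rw [hq, indicator_of_mem hx])]
    refine hs'.facetInt_mono hd hv (by fun_prop) (by fun_prop) fun x hx => ?_
    have h4 := hG s hs v hv x hx
    have h5 : polyFun q x = μ (facet s v) x - w x := by
      have := congrFun hq x
      rw [indicator_of_mem hx, Pi.sub_apply, Pi.sub_apply, T.trace_apply hs hv hx] at this
      exact this.symm
    rw [h5, ← sq_abs]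
    exact pow_le_pow_left₀ (abs_nonneg _) h4 2
  -- The weight `|T| / |∂T|` times the area `|∂T|` is the volume of the cell.
  calc _ ≤ cellRatio s * (G s ^ 2 * ∑ v ∈ s, facetInt (facet s v) (fun _ => 1)) :=
        mul_le_mul_of_nonneg_left h1 (cellRatio_nonneg s)
    _ = volume.real (hull s) * G s ^ 2 := by rw [← hT.cellRatio_mul_area hd hs]; ring
    _ ≤ (ρ * r) ^ d * ballVol d * G s ^ 2 := by gcongr
    _ = _ := by rw [mul_pow]; ring

lemma Method.vecNorm0_sq_le_energyForm (S : Method k T) (μ : Set (Pt d) → Pt d → ℝ) :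
    T.vecNorm0 (S.Q μ) ^ 2 ≤ S.energyForm μ μ := by
  rw [vecNorm0_sq, energyForm]
  simp only [pow_two]
  refine le_add_of_nonneg_right ?_
  refine Finset.sum_nonneg fun s _ => Finset.sum_nonneg fun v _ => facetInt_nonneg fun x => ?_
  rw [mul_assoc]
  exact mul_nonneg S.τ_nonneg (mul_self_nonneg _)

/-- The energy is bounded by `‖Q μ‖_0`. -/
lemma Method.energyForm_self_le (hd : 1 ≤ d) {S : Method k T} {K r ρ : ℝ} (h1 : S.LS1 p K)
    (hT : T.HasScale T.meshSize r) (hρ0 : 0 < ρ) (hρ : T.meshSize ≤ ρ * r)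
    (hτ : S.τ * T.meshSize ≤ K) {μ : Set (Pt d) → Pt d → ℝ} (hμ : μ ∈ T.skeletal p) :
    S.energyForm μ μ ≤ (1 + ρ * |K| ^ 3 /
      (ballVol d / ((d + 1) * (ρ ^ (d - 1) * ballVol (d - 1))))) * T.vecNorm0 (S.Q μ) ^ 2 := by
  have hb := ballVol_pos d
  have hb' := ballVol_pos (d - 1)
  have hr := hT.pos
  have hh : 0 ≤ T.meshSize := Real.iSup_nonneg fun _ => Metric.diam_nonneg
  set c0 : ℝ := ballVol d / ((d + 1) * (ρ ^ (d - 1) * ballVol (d - 1))) with hc0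
  have hc0pos : 0 < c0 := by positivity
  have e1 := h1.traceError_sq_le hμ
  rw [Method.traceError_sq] at e1
  have e2 : ∀ s ∈ T.cells, (r * c0) * ∑ v ∈ s, facetInt (facet s v) (fun x =>
      S.τ * (polyFun (S.U μ s) x - μ (facet s v) x) * (polyFun (S.U μ s) x - μ (facet s v) x))
      ≤ S.τ * (cellRatio s * ∑ v ∈ s, facetInt (facet s v) fun x =>
        (polyFun (S.U μ s) x - μ (facet s v) x) ^ 2) := by
    intro s hs
    have e3 : ∑ v ∈ s, facetInt (facet s v) (fun x =>
        S.τ * (polyFun (S.U μ s) x - μ (facet s v) x) * (polyFun (S.U μ s) x - μ (facet s v) x))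
        = S.τ * ∑ v ∈ s, facetInt (facet s v) fun x =>
          (polyFun (S.U μ s) x - μ (facet s v) x) ^ 2 := by
      rw [Finset.mul_sum]
      refine Finset.sum_congr rfl fun v _ => ?_
      rw [facetInt, facetInt, ← integral_const_mul]
      simp only [pow_two, mul_assoc]
    rw [e3, mul_left_comm]
    refine mul_le_mul_of_nonneg_left ?_ S.τ_nonneg
    exact mul_le_mul_of_nonneg_right (hT.le_cellRatio hd hρ0 hρ hs)
      (Finset.sum_nonneg fun _ _ => facetInt_nonneg fun _ => sq_nonneg _)
  have e4 := Finset.sum_le_sum e2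
  rw [← Finset.mul_sum, ← Finset.mul_sum] at e4
  set X := ∑ s ∈ T.cells, ∑ v ∈ s, facetInt (facet s v) (fun x =>
      S.τ * (polyFun (S.U μ s) x - μ (facet s v) x) * (polyFun (S.U μ s) x - μ (facet s v) x))
  set N := T.vecNorm0 (S.Q μ) ^ 2 with hN
  have hN0 : 0 ≤ N := sq_nonneg _
  have hK : 0 ≤ K := (mul_nonneg S.τ_nonneg hh).trans hτ
  -- Of the two factors `h` supplied by (LS1), one is absorbed by `τ`, the other is at most `ρ * r`
  -- and cancels the lower bound for `|T| / |∂T|`.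
  have e5 : r * c0 * X ≤ r * (ρ * |K| ^ 3 * N) := by
    calc r * c0 * X ≤ S.τ * (K ^ 2 * (T.meshSize ^ 2 * N)) :=
          e4.trans (mul_le_mul_of_nonneg_left e1 S.τ_nonneg)
      _ = (S.τ * T.meshSize) * (K ^ 2 * N) * T.meshSize := by ring
      _ ≤ K * (K ^ 2 * N) * (ρ * r) := by gcongr
      _ = _ := by rw [abs_of_nonneg hK]; ring
  have e6 : X ≤ ρ * |K| ^ 3 / c0 * N := by
    rw [div_mul_eq_mul_div, le_div_iff₀ hc0pos]
    rw [mul_assoc] at e5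
    have := le_of_mul_le_mul_left e5 hr
    linarith
  have e7 : S.energyForm μ μ = N + X := by
    rw [energyForm, hN, vecNorm0_sq]
    simp only [pow_two]
    rfl
  rw [e7]
  linarith

end HDG

/-! ### Energy stability of the injection -/

namespace HDG

open SimplicialMesh

variable {d k p : ℕ} {Ω : Set (Pt d)} {T : SimplicialMesh Ω}

lemma SimplicialMesh.meshSize_nonneg (T : SimplicialMesh Ω) : 0 ≤ T.meshSize :=
  Real.iSup_nonneg fun _ => Metric.diam_nonneg

lemma SimplicialMesh.diam_le_meshSize {s : Finset (Pt d)} (hs : s ∈ T.cells) :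
    Metric.diam (hull s) ≤ T.meshSize :=
  le_ciSup (f := fun s : {s : Finset (Pt d) // s ∈ T.cells} => Metric.diam (hull s.1))
    (Set.finite_range _).bddAbove ⟨s, hs⟩

/-- Since h ≤ κ diam T ≤ κσr, the inscribed balls may all be taken with the common radius `h / ρ`;
the mesh size is positive because some cell exists and contains a ball. -/
lemma SimplicialMesh.hasScale_of_regular (hd : 1 ≤ d) (hΩ : Ω.Nonempty) {σ κ ρ : ℝ}
    (hσ : T.ShapeRegular σ) (hκ : T.QuasiUniform κ) (hρ0 : 0 < ρ) (hρ : κ * σ ≤ ρ) :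
    T.HasScale T.meshSize (T.meshSize / ρ) := by
  have hdiam : ∀ s ∈ T.cells, 0 < Metric.diam (hull s) := by
    intro s hs
    obtain ⟨x, r, hr, -, hx⟩ := hσ s hs
    have : Nontrivial (Pt d) := by
      have : Nonempty (Fin d) := ⟨⟨0, hd⟩⟩
      infer_instance
    have h1 := Metric.diam_mono hx IsSimplex.isCompact_hull.isBounded
    rw [Metric.diam_closedBall_eq x hr.le] at h1
    linarith
  have hpos : 0 < T.meshSize := by
    obtain ⟨y, hy⟩ := hΩ
    obtain ⟨s, hs, -⟩ := T.exists_mem_hull (subset_closure hy)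
    exact (hdiam s hs).trans_le (diam_le_meshSize hs)
  refine ⟨div_pos hpos hρ0, fun s hs => diam_le_meshSize hs, fun s hs => ?_⟩
  obtain ⟨x, r, hr, hr', hx⟩ := hσ s hs
  refine ⟨x, (Metric.closedBall_subset_closedBall ?_).trans hx⟩
  have h1 := hκ s hs
  have hκ0 : 0 ≤ κ := by
    by_contra! hneg
    nlinarith [hdiam s hs]
  rw [div_le_iff₀ hρ0]
  calc T.meshSize ≤ κ * (σ * r) := h1.trans (mul_le_mul_of_nonneg_left hr' hκ0)
    _ = κ * σ * r := by ring
    _ ≤ ρ * r := by gcongr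
    _ = r * ρ := mul_comm _ _

/-- The parallelogram identity, with the energy of `x - y` dropped. -/
lemma Method.WellPosed.energyForm_add_le {S : Method k T} (hS : S.WellPosed p) (hd : 1 ≤ d)
    (x y : T.skeletal p) :
    S.energyForm (x + y).1 (x + y).1 ≤ 2 * S.energyForm x.1 x.1 + 2 * S.energyForm y.1 y.1 := by
  have h1 : 0 ≤ hS.form hd (x - y) (x - y) := Method.energyForm_self_nonneg _
  simp only [← hS.form_apply hd]
  simp only [map_sub, map_add, LinearMap.sub_apply, LinearMap.add_apply] at h1 ⊢
  linarith

/-- Definiteness of the condensed bilinear form and stability of the injection in energy norms. -/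
lemma exists_energy_bound (d : ℕ) (hd : 1 ≤ d) (p : ℕ) (hp : 1 ≤ p) (k : ℕ) {ρ cref : ℝ}
    (hρ0 : 0 < ρ) (hcref : 0 < cref) (K : ℝ) : ∃ C : ℝ, 0 ≤ C ∧
      ∀ (Ω : Set (Pt d)), IsLipschitzDomain Ω → ∀ (Tc Tf : SimplicialMesh Ω) (rc rf : ℝ),
      Tc.HasScale Tc.meshSize rc → Tc.meshSize ≤ ρ * rc →
      Tf.HasScale Tf.meshSize rf → Tf.meshSize ≤ ρ * rf →
      Tf.Refines Tc → cref * Tc.meshSize ≤ Tf.meshSize →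
      ∀ (Sc : Method k Tc) (Sf : Method k Tf), Sc.WellPosed p → Sf.WellPosed p →
      Sc.LS1 p K → Sf.LS1 p K → Sf.LS2 p K → Sc.LS3 p K → Sf.LS4 p → Sf.τ * Tf.meshSize ≤ K →
      ∀ I : Tc.skeletal p →ₗ[ℝ] Tf.skeletal p, IA1 I K → IA2 I →
      (∀ μ : Tc.skeletal p, Sc.energyForm μ.1 μ.1 = 0 → μ = 0) ∧
      ∀ μ : Tc.skeletal p, Sf.energyForm (I μ).1 (I μ).1 ≤ C * Sc.energyForm μ.1 μ.1 := by
  obtain ⟨C1, hC1, happ⟩ := exists_conforming_approximation d hd p k hρ0 K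
  have hb := ballVol_pos d
  have hb' := ballVol_pos (d - 1)
  set b : ℝ := ρ ^ d * ballVol d with hbdef
  have hbpos : 0 < b := by positivity
  set E : ℝ := 1 + ρ * |K| ^ 3 /
    (ballVol d / ((d + 1) * (ρ ^ (d - 1) * ballVol (d - 1)))) with hE
  have hEpos : 0 < E := by positivity
  -- The first term is the remainder: `E` from `energyForm_self_le`, `K ^ 4` from (LS2) and (IA1),
  -- `b * C1` from the distance of `μ` to the trace, `cref⁻¹ ^ 2` from the ratio of mesh sizes. The
  -- second is the Dirichlet energy of `w`.
  refine ⟨2 * (E * (K ^ 4 * (b * C1) * cref⁻¹ ^ 2)) + 2 * (b * C1 * ρ ^ 2), by positivity, ?_⟩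
  intro Ω hΩ Tc Tf rc rf hTc hρc hTf hρf href hcr Sc Sf hSc hSf h1c h1f h2f h3c h4f hτ I hI1 hI2
  have hrc := hTc.pos
  constructor
  · rintro ⟨μ, hμ⟩ h0
    -- Zero energy makes all bounds `G s` vanish, so that `w` is constant on cells, hence zero, and
    -- `μ` coincides with it.
    have hN : Tc.vecNorm0 (Sc.Q μ) ^ 2 ≤ 0 := (Sc.vecNorm0_sq_le_energyForm μ).trans_eq h0
    obtain ⟨w, G, hw0, hwa, hG0, hGj, hGo, hGs⟩ := happ Ω hΩ Tc rc hTc hρc Sc hSc h1c h3c μ hμ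
    have hsum : ∑ s ∈ Tc.cells, G s ^ 2 ≤ 0 := by
      have h1 : C1 * (Tc.meshSize ^ 2 * Tc.vecNorm0 (Sc.Q μ) ^ 2) ≤ 0 :=
        mul_nonpos_of_nonneg_of_nonpos hC1.le (mul_nonpos_of_nonneg_of_nonpos (sq_nonneg _) hN)
      exact nonpos_of_mul_nonpos_right (hGs.trans h1) (pow_pos hrc d)
    have hG : ∀ s ∈ Tc.cells, G s = 0 := fun s hs => by
      have := (Finset.sum_eq_zero_iff_of_nonneg (fun s _ => sq_nonneg (G s))).1
        (le_antisymm hsum (Finset.sum_nonneg fun s _ => sq_nonneg (G s))) s hs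
      exact pow_eq_zero_iff two_ne_zero |>.1 this
    have hw : ∀ x, w x = 0 := Tc.eq_zero_of_const_on_cells hd hΩ.1 hΩ.2.2.1 hw0
      fun s hs x hx y hy => by
        have := hGo s hs x hx y hy
        rw [hG s hs] at this
        exact sub_eq_zero.1 (abs_nonpos_iff.1 this)
    refine Subtype.ext (funext fun F => ?_)
    by_cases hF : F ∈ Tc.faces
    · obtain ⟨s, hs, v, hv, rfl⟩ := hF
      obtain ⟨q, -, hq⟩ := Tc.exists_poly_of_mem_skeletal hμ hs hv
      funext x
      by_cases hx : x ∈ facet s v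
      · have := hGj s hs v hv x hx
        rw [hG s hs, hw x, sub_zero] at this
        exact abs_nonpos_iff.1 this
      · change μ (facet s v) x = 0
        rw [hq, indicator_of_notMem hx]
    · exact hμ.2.2 F hF
  · intro μ
    set N := Tc.vecNorm0 (Sc.Q μ.1) ^ 2 with hN
    have hN0 : 0 ≤ N := sq_nonneg _
    have hNe : N ≤ Sc.energyForm μ.1 μ.1 := Sc.vecNorm0_sq_le_energyForm μ.1
    obtain ⟨w, G, hw0, hwa, hG0, hGj, hGo, hGs⟩ :=
      happ Ω hΩ Tc rc hTc hρc Sc hSc h1c h3c μ.1 μ.2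
    have hwaf : ∀ t ∈ Tf.cells, ∃ f : Pt d →ᵃ[ℝ] ℝ, ∀ x ∈ hull t, w x = f x := fun t ht => by
      obtain ⟨s, hs, hts⟩ := href.exists_subset ht
      obtain ⟨f, hf⟩ := hwa s hs
      exact ⟨f, fun x hx => hf x (hts hx)⟩
    have htc := Tc.trace_mem_skeletal hΩ.1 hw0 hwa hp
    have htf := Tf.trace_mem_skeletal hΩ.1 hw0 hwaf hp
    have hcc := Tc.mem_conforming hΩ.1 hΩ.2.2.1 hw0 hwa
    have hcf := Tf.mem_conforming hΩ.1 hΩ.2.2.1 hw0 hwaf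
    obtain ⟨KL, hKL⟩ := Tc.exists_lipschitzWith hΩ.1 hw0 hwa
    -- The fine energy is rewritten as a sum over coarse cells, where the oscillation bounds `G` are
    -- available.
    have hD : Sf.energyForm (Tf.trace w) (Tf.trace w) ≤ b * C1 * ρ ^ 2 * N := by
      rw [Method.energyForm_trace h4f hcf htf,
        SimplicialMesh.dirichlet_eq (T := Tf) (T' := Tc) hΩ.2.2.1 hKL]
      have h1 := hTc.dirichlet_le hρc hwa hGo
      have h2 : Tc.meshSize ^ 2 ≤ (ρ * rc) ^ 2 := pow_le_pow_left₀ Tc.meshSize_nonneg hρc 2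
      refine le_of_mul_le_mul_left ?_ (pow_pos hrc 2)
      calc _ ≤ b * (rc ^ d * ∑ s ∈ Tc.cells, G s ^ 2) := h1
        _ ≤ b * (C1 * (Tc.meshSize ^ 2 * N)) := by gcongr
        _ ≤ b * (C1 * ((ρ * rc) ^ 2 * N)) := by gcongr
        _ = _ := by ring
    set γ : Tc.skeletal p := ⟨Tc.trace w, htc⟩ with hγ
    have hγf : (I γ).1 = Tf.trace w := hI2 w hcc γ rfl
    have hskel : Tc.skelNorm (μ - γ).1 ^ 2 ≤ b * (C1 * (Tc.meshSize ^ 2 * N)) :=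
      (hTc.skelNorm_sub_trace_sq_le hd hρc μ.2 htc hGj).trans
        (mul_le_mul_of_nonneg_left hGs hbpos.le)
    have hhh : Tf.meshSize⁻¹ * Tc.meshSize ≤ cref⁻¹ := by
      rcases Tf.meshSize_nonneg.eq_or_lt with h0 | hpos
      · rw [← h0]; simp [hcref.le]
      · rw [inv_mul_le_iff₀ hpos, mul_comm, ← div_eq_inv_mul, le_div_iff₀ hcref, mul_comm]
        exact hcr
    have hQ : Tf.vecNorm0 (Sf.Q (I (μ - γ)).1) ^ 2 ≤ K ^ 4 * (b * C1) * cref⁻¹ ^ 2 * N := by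
      have h1 := pow_le_pow_left₀ (Real.sqrt_nonneg _) (h2f _ (I (μ - γ)).2).1 2
      have h2 := pow_le_pow_left₀ (Real.sqrt_nonneg _) (hI1 (μ - γ)) 2
      calc _ ≤ (K * (Tf.meshSize⁻¹ * Tf.skelNorm (I (μ - γ)).1)) ^ 2 := h1
        _ = K ^ 2 * Tf.meshSize⁻¹ ^ 2 * Tf.skelNorm (I (μ - γ)).1 ^ 2 := by ring
        _ ≤ K ^ 2 * Tf.meshSize⁻¹ ^ 2 * (K * Tc.skelNorm (μ - γ).1) ^ 2 :=
            mul_le_mul_of_nonneg_left h2 (by positivity)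
        _ = K ^ 4 * Tf.meshSize⁻¹ ^ 2 * Tc.skelNorm (μ - γ).1 ^ 2 := by ring
        _ ≤ K ^ 4 * Tf.meshSize⁻¹ ^ 2 * (b * (C1 * (Tc.meshSize ^ 2 * N))) := by gcongr
        _ = K ^ 4 * (b * C1) * (Tf.meshSize⁻¹ * Tc.meshSize) ^ 2 * N := by ring
        _ ≤ _ := by
            have : 0 ≤ Tf.meshSize⁻¹ * Tc.meshSize :=
              mul_nonneg (inv_nonneg.2 Tf.meshSize_nonneg) Tc.meshSize_nonneg
            gcongr
    have hν := Method.energyForm_self_le hd h1f hTf hρ0 hρf hτ (I (μ - γ)).2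
    -- Only the trace part is mapped exactly by `I`; the remainder is of order `h`, which pays for
    -- the inverse power of `h` in (LS2).
    have hsplit : I μ = I (μ - γ) + I γ := by rw [← map_add, sub_add_cancel]
    rw [hsplit]
    refine (hSf.energyForm_add_le hd _ _).trans ?_
    rw [hγf]
    have e1 : Sf.energyForm (I (μ - γ)).1 (I (μ - γ)).1
        ≤ E * (K ^ 4 * (b * C1) * cref⁻¹ ^ 2 * N) :=
      hν.trans (mul_le_mul_of_nonneg_left hQ hEpos.le)
    calc _ ≤ 2 * (E * (K ^ 4 * (b * C1) * cref⁻¹ ^ 2 * N)) + 2 * (b * C1 * ρ ^ 2 * N) := by gcongr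
      _ = (2 * (E * (K ^ 4 * (b * C1) * cref⁻¹ ^ 2)) + 2 * (b * C1 * ρ ^ 2)) * N := by ring
      _ ≤ _ := by gcongr

end HDG

/-! ### The main theorem -/

theorem mainTheorem3 (d : ℕ) (hd : 1 ≤ d) (p : ℕ) (hp : 1 ≤ p) (k : ℕ)
    (σ κ cref K : ℝ) (hcref : 0 < cref) :
    ∃ C : ℝ, 0 < C ∧
      ∀ (Ω : Set (HDG.Pt d)), HDG.IsLipschitzDomain Ω →
      ∀ (L : ℕ) (T : Fin (L + 1) → HDG.SimplicialMesh Ω),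
        (∀ l, (T l).ShapeRegular σ) →
        (∀ l, (T l).QuasiUniform κ) →
        (∀ l : Fin L, (T l.succ).Refines (T l.castSucc)) →
        (∀ l : Fin L, cref * (T l.castSucc).meshSize ≤ (T l.succ).meshSize) →
      ∀ (S : ∀ l, HDG.Method k (T l)),
        (∀ l, (S l).WellPosed p) →
        (∀ l, (S l).LS1 p K) →
        (∀ l, (S l).LS2 p K) →
        (∀ l, (S l).LS3 p K) →
        (∀ l, (S l).LS4 p) →
        (∀ l, (S l).τ * (T l).meshSize ≤ K) →
      ∀ (I : ∀ l : Fin L, (T l.castSucc).skeletal p →ₗ[ℝ] (T l.succ).skeletal p),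
        (∀ l, HDG.IA1 (I l) K) →
        (∀ l, HDG.IA2 (I l)) →
      ∀ (l : Fin L) (μ : (T l.succ).skeletal p),
        (∃! ν, HDG.IsRitz (S l.castSucc) (S l.succ) (I l) μ ν) ∧
        (S l.succ).energyNorm
            (μ - I l (HDG.ritz (S l.castSucc) (S l.succ) (I l) μ) : (T l.succ).skeletal p).1
          ≤ C * (S l.succ).energyNorm μ.1 := by
  -- The maximum with 1 makes the ratio of scales positive for arbitrary real `κ` and `σ`.
  have hρ0 : 0 < max (κ * σ) 1 := lt_max_of_lt_right one_pos
  obtain ⟨C, hC, hbound⟩ := HDG.exists_energy_bound d hd p hp k hρ0 hcref K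
  -- The energy bound is for squares, so the injection has norm at most `√C`, and the abstract lemma
  -- gives one plus its square.
  refine ⟨1 + √C ^ 2, by positivity, ?_⟩
  intro Ω hΩ L T hσ hκ href hcr S hS h1 h2 h3 h4 hτ I hI1 hI2 l μ
  have hscale : ∀ l, (T l).HasScale (T l).meshSize ((T l).meshSize / max (κ * σ) 1) := fun l =>
    HDG.SimplicialMesh.hasScale_of_regular hd hΩ.2.1.nonempty (hσ l) (hκ l) hρ0 (le_max_left _ _)
  have hle : ∀ l, (T l).meshSize ≤ max (κ * σ) 1 * ((T l).meshSize / max (κ * σ) 1) := fun l =>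
    (mul_div_cancel₀ _ hρ0.ne').ge
  obtain ⟨hdef, hI⟩ := hbound Ω hΩ _ _ _ _ (hscale l.castSucc) (hle _) (hscale l.succ) (hle _)
    (href l) (hcr l) _ _ (hS l.castSucc) (hS l.succ) (h1 _) (h1 _) (h2 _) (h3 _) (h4 _) (hτ _)
    (I l) (hI1 l) (hI2 l)
  obtain ⟨hex, hritz⟩ := HDG.exists_unique_ritz_and_le ((hS l.castSucc).form hd)
    ((hS l.succ).form hd) (fun x => HDG.Method.energyForm_self_nonneg x.1) hdef
    (fun x => HDG.Method.energyForm_self_nonneg x.1)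
    (fun x y => HDG.Method.energyForm_comm x.1 y.1) (I l) (Real.sqrt_nonneg C)
    (fun x => by
      rw [← Real.sqrt_mul hC]
      exact Real.sqrt_le_sqrt (hI x)) μ
  exact ⟨hex, hritz _ (Classical.epsilon_spec hex.exists)⟩
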